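/- Let $\ell_\infty$ be the real Banach space of bounded real sequences with the supremum norm, with first coordinate functional $e_1^*(x)=x_1$ and unit vectors $e_n$, and let $\widetilde{\ell}_\infty$ be its complexification, i.e. the space of bounded complex sequences $x+iy$ ($x,y\in\ell_\infty$) with the supremum norm. Let $\beta:[0,\infty)\to\ell_\infty$ be the staircase path $$\beta(t)=\sum_{j=1}^{n-1}e_j+(t-n+1)e_n\qquad\text{if } n-1\le t\le n,\ n\in\mathbb N .$$ A map is called holomorphic (real analytic) on a set if it is defined and holomorphic (real analytic) in a neighbourhood of each point of that set. For every $\varepsilon\in(0,1]$ there exist $r,\delta\in(0,\varepsilon/64)$ and a real analytic map $G:\ell_\infty\to\ell_\infty$ with a holomorphic extension $\widetilde G:\widetilde{\ell}_\infty\to\widetilde{\ell}_\infty$ such that: (1) $G$ maps the straight tube $\mathcal S=\{x\in\ell_\infty: x_1>-r,\ |x_n|<r\text{ for all }n\ge 2\}$ diffeomorphically (bijectively and bianalytically) onto a set $\mathcal T$, a twisted tube around $\beta$, with $$\{x\in\ell_\infty:\operatorname{dist}(x,\beta([0,\infty)))<\tfrac r2\}\subseteq\mathcal T\subseteq\{x\in\ell_\infty:\operatorname{dist}(x,\beta([0,\infty)))<2r\}.$$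 Below, $G^{-1}$ denotes the inverse of $G|_{\mathcal S}:\mathcal S\to\mathcal T$. (2) If $t\ge 0$, $x\in\ell_\infty$ and $\|x-\beta(t)\|_\infty\le r/2$, then $x\in\mathcal T$ and $|e_1^*(G^{-1}(x))-t|\le\varepsilon$. (2') There is a function $\alpha:\mathbb R\to\mathbb R$ with a holomorphic extension $\widetilde\alpha:\mathbb C\to\mathbb C$ such that $H:=\alpha\circ e_1^*\circ G^{-1}:\mathcal T\to\mathbb R$ satisfies $\|DH(x)\|\le 1+\varepsilon$ for all $x\in\mathcal T$, and $|H(x)-t|\le\varepsilon$ whenever $t\ge 0$ and $\|x-\beta(t)\|_\infty<r/2$. (3) $\|DG(x)\|\le 2+\varepsilon$ for all $x\in\mathcal S$, and $\|D(G^{-1})(u)\|\le 2+\varepsilon$ for all $u\in\mathcal T$. (4) $\|\widetilde G(x+iy)-G(x)\|_\infty\le\varepsilon$ for all $x\in\mathcal S$ and all $y\in\ell_\infty$ with $\|y\|_\infty\le\delta$. (5) $G^{-1}$ has a holomorphic extension $\widetilde{G^{-1}}$ from $\widetilde{\mathcal T_\delta}:=\{u+iv:u\in\mathcal T,\ v\in\ell_\infty,\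 \|v\|_\infty<\delta\}$ into $\widetilde{\ell}_\infty$ such that, for all $u\in\mathcal T$ and $v\in\ell_\infty$ with $\|v\|_\infty<\delta$, and with $\widetilde{e_1^*}(z)=z_1$, $$\|\widetilde{G^{-1}}(u+iv)-G^{-1}(u)\|_\infty\le\varepsilon\qquad\text{and}\qquad \big|\widetilde\alpha\big(\widetilde{e_1^*}(\widetilde{G^{-1}}(u+iv))\big)\big|\le 2\,(H(u)+1).$$ -/

import Mathlib

open Set
open scoped ENNReal

noncomputable section

/-- The real Banach space of bounded real sequences with the supremum norm.
Coordinates are indexed from `0`, so that the first coordinate of `x` is `x 0`. -/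
abbrev EllInf : Type := lp (fun _ : ℕ => ℝ) ∞

/-- The complexification of `EllInf`: bounded complex sequences with the norm `sup_n |z_n|`. -/
abbrev EllInfC : Type := lp (fun _ : ℕ => ℂ) ∞

theorem memlp_cplx (x y : EllInf) :
    Memℓp (fun n => (⟨x n, y n⟩ : ℂ)) ∞ := by
  refine memℓp_infty ⟨‖x‖ + ‖y‖, ?_⟩
  rintro _ ⟨n, rfl⟩
  have h1 : |x n| ≤ ‖x‖ := lp.norm_apply_le_norm ENNReal.top_ne_zero x n
  have h2 : |y n| ≤ ‖y‖ := lp.norm_apply_le_norm ENNReal.top_ne_zero y n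
  exact (Complex.norm_le_abs_re_add_abs_im _).trans (add_le_add h1 h2)

/-- The point `x + i y` of the complexification, for real bounded sequences `x`, `y`. -/
def cplx (x y : EllInf) : EllInfC := ⟨fun n => ⟨x n, y n⟩, memlp_cplx x y⟩

/-- The `k`-th coordinate of the staircase path. -/
def stairCoord (t : ℝ) (k : ℕ) : ℝ :=
  if (k : ℝ) + 1 ≤ t then 1 else if (k : ℝ) ≤ t then t - k else 0

theorem memlp_stairCoord (t : ℝ) : Memℓp (stairCoord t) ∞ := by
  refine memℓp_infty ⟨1, ?_⟩
  rintro _ ⟨n, rfl⟩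
  simp only [stairCoord, Real.norm_eq_abs]
  split_ifs with h1 h2
  · simp
  · rw [abs_le]; constructor <;> linarith
  · simp

/-- The staircase path `β`, used for parameters `t ≥ 0`. The next theorem shows that it is given
by the usual formula. -/
def stairPath (t : ℝ) : EllInf := ⟨stairCoord t, memlp_stairCoord t⟩

/-- If `m ≤ t ≤ m + 1` then `β t` is `(1, …, 1, t - m, 0, 0, …)`, with `m` ones. -/
theorem stairPath_eq (m : ℕ) (t : ℝ) (h1 : (m : ℝ) ≤ t) (h2 : t ≤ m + 1) :
    stairPath t =
      (∑ j ∈ Finset.range m, lp.single (E := fun _ : ℕ => ℝ) ∞ j 1)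
        + lp.single (E := fun _ : ℕ => ℝ) ∞ m (t - m) := by
  ext k
  have hs : (stairPath t : ℕ → ℝ) k = stairCoord t k := rfl
  rw [hs, lp.coeFn_add, Pi.add_apply, lp.coeFn_sum, Finset.sum_apply]
  simp only [lp.coeFn_single, Pi.single_apply, Finset.sum_ite_eq, Finset.mem_range]
  unfold stairCoord
  rcases lt_trichotomy k m with h | h | h
  · have : (k : ℝ) + 1 ≤ m := by exact_mod_cast h
    rw [if_pos (this.trans h1), if_pos h, if_neg h.ne, add_zero]
  · subst h
    rw [if_neg (lt_irrefl _), if_pos rfl, if_pos h1, zero_add]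
    split_ifs with h3
    · linarith
    · rfl
  · have : (m : ℝ) + 1 ≤ k := by exact_mod_cast h
    rw [if_neg (by linarith), if_neg (not_lt.mpr h.le), if_neg h.ne', add_zero]
    split_ifs with h3
    · linarith
    · rfl

/-- The image `β([0,∞))` of the staircase path. -/
def stairImage : Set EllInf := stairPath '' Ici 0

/-- The straight tube: `x_1 > -r`, and `|x_n| < r` for all `n ≥ 2`. -/
def straightTube (r : ℝ) : Set EllInf := {x | -r < x 0 ∧ ∀ n : ℕ, 1 ≤ n → |x n| < r}

/-- The open neighbourhood of radius `ρ` of the staircase path, in the supremum norm. -/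
def stairNhd (ρ : ℝ) : Set EllInf := {x | Metric.infDist x stairImage < ρ}

/-- The complex strip `{u + i v : u ∈ T, v ∈ ℓ_∞, ‖v‖ < δ}`. -/
def complexStrip (T : Set EllInf) (δ : ℝ) : Set EllInfC :=
  {w | ∃ u ∈ T, ∃ v : EllInf, ‖v‖ < δ ∧ w = cplx u v}

/-- `G` maps `S` diffeomorphically (in fact bianalytically) onto `T`, with inverse `Ginv`; analyticity at the points of
`S` and `T` is analyticity in a neighbourhood of each of these points. -/
structure IsDiffeoBetween (G Ginv : EllInf → EllInf) (S T : Set EllInf) : Prop where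
  bijOn : BijOn G S T
  invOn : InvOn Ginv G S T
  analytic : AnalyticOnNhd ℝ G S
  analytic_inv : AnalyticOnNhd ℝ Ginv T

/-- `Fc` is a holomorphic extension of the real map `F : D → ℓ_∞` to the set `Dc` (holomorphic in
a neighbourhood of every point of `Dc`). -/
structure IsHolomorphicExtension (F : EllInf → EllInf) (D : Set EllInf)
    (Fc : EllInfC → EllInfC) (Dc : Set EllInfC) : Prop where
  holomorphic : AnalyticOnNhd ℂ Fc Dc
  extends_real : ∀ x ∈ D, cplx x 0 ∈ Dc ∧ Fc (cplx x 0) = cplx (F x) 0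

/-- The gluing function `H = α ∘ e₁* ∘ G⁻¹`. -/
def glue (α : ℝ → ℝ) (Ginv : EllInf → EllInf) (u : EllInf) : ℝ := α (Ginv u 0)

end

/-! ### Bounded sequences over `ℝ` or `ℂ` -/

/-! Coordinate `0` of `x` is read as a time, the others as transverse coordinates, and `G(x)_n =
γ_n(x_0) + A_n(x_0) x_n - B_n(x_0) x_{n+1}`, with `γ` a smoothed staircase. While the path runs
along `e_k`, coordinates `n > k` receive `x_n` (`A ≈ 1`, `B ≈ 0`) and coordinates `n < k` receive
`-x_{n+1}` (`A ≈ 0`, `B ≈ 1`). So around the corner at time `k + 1` the slot `x_{k+1}` must pass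
from direction `e_{k+1}` to direction `-e_k`. This takes two stages: `B_k` is switched on near `k +
1 - θ`, and `A_{k+1}` is switched off near `k + 1 + θ`. At the corner itself the direction is
`e_{k+1} - e_k`, transverse to both segments, and the time is read from the sum of coordinates `k`
and `k + 1`. Since `a_n + b_n ≤ 1` and the real staircase has slopes in `[0, 1]`, `DG` has norm
about `2` at most.

The inverse is not explicit. Freezing `p = a_k(t)`, `q = b_k(t)` at one time `t` gives an explicit
chart (`chartTime`, `chartSide`) in which `G` becomes the identity plus a map of Lipschitz constant
`31 η` (`readMap_contraction`). This yields local preimages with good constants. Injectivity follows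
because distant times have distant images (`stair_sep`) and close times fit in one chart. A
Lipschitz inverse of a differentiable map forces an invertible derivative, hence an analytic inverse
(`analyticAt_invFunOn`). All of this is proved over `ℝ` and `ℂ` at once, so the holomorphic
extension of the inverse comes from the same estimates. The sharp constant `2` for the inverse uses
real slopes (`segChart_lip_real`).

The scales are ordered `1/κ₂ ≪ r ≪ 1/κ₁ ≪ θ`: the smoothing of the path is invisible at the size of
the tube, the frozen coefficients barely vary over a chart, and the switches are complete by the
time a kink is reached. The height `δ` is so small that the entire sigmoids behave on the strip as
on the line.

The time coordinate of the inverse has Lipschitz constant about `1 + a_k + b_k`: near `1` inside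
segments, up to `2` at corners. Composing with `α`, whose slope is at most `1/2` near integers and
never much above `1`, gives `‖DH‖ ≤ 1 + ε`. Such an `α` is the primitive of `1 + 1/M - |∑
e^{2πijt}|²/M²`. -/

/-- The Banach space of bounded sequences in `𝕜`. -/
abbrev BddSeq (𝕜 : Type) [RCLike 𝕜] : Type := lp (fun _ : ℕ => 𝕜) ∞

namespace BddSeq

variable {𝕜 : Type} [RCLike 𝕜]

theorem memlp_of_bound {f : ℕ → 𝕜} {C : ℝ} (h : ∀ n, ‖f n‖ ≤ C) : Memℓp f ∞ :=
  memℓp_infty ⟨C, by rintro _ ⟨n, rfl⟩; exact h n⟩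

open Classical in
/-- The element of `BddSeq 𝕜` with coordinates `f n` (zero if `f` is unbounded). -/
noncomputable def ofFun (f : ℕ → 𝕜) : BddSeq 𝕜 := if h : Memℓp f ∞ then ⟨f, h⟩ else 0

theorem ofFun_apply {f : ℕ → 𝕜} {C : ℝ} (h : ∀ n, ‖f n‖ ≤ C) (n : ℕ) : ofFun f n = f n := by
  rw [ofFun, dif_pos (memlp_of_bound h)]

theorem apply_le (x : BddSeq 𝕜) (n : ℕ) : ‖x n‖ ≤ ‖x‖ :=
  lp.norm_apply_le_norm ENNReal.top_ne_zero x n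

theorem sub_apply_le (x y : BddSeq 𝕜) (n : ℕ) : ‖x n - y n‖ ≤ ‖x - y‖ := by
  simpa using apply_le (x - y) n

theorem norm_le {x : BddSeq 𝕜} {C : ℝ} (hC : 0 ≤ C) (h : ∀ n, ‖x n‖ ≤ C) : ‖x‖ ≤ C :=
  lp.norm_le_of_forall_le hC h

theorem norm_sub_le {x y : BddSeq 𝕜} {C : ℝ} (hC : 0 ≤ C) (h : ∀ n, ‖x n - y n‖ ≤ C) :
    ‖x - y‖ ≤ C :=
  norm_le hC (by simpa using h)

/-- The `n`-th coordinate as a continuous linear functional. -/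
noncomputable def coord (𝕜 : Type) [RCLike 𝕜] (n : ℕ) : BddSeq 𝕜 →L[𝕜] 𝕜 :=
  LinearMap.mkContinuous
    { toFun := fun x => x n, map_add' := fun _ _ => rfl, map_smul' := fun _ _ => rfl } 1
    (fun x => by rw [one_mul]; exact apply_le x n)

@[simp] theorem coord_apply (n : ℕ) (x : BddSeq 𝕜) : coord 𝕜 n x = x n := rfl

/-- The backward shift. -/
noncomputable def shift (𝕜 : Type) [RCLike 𝕜] : BddSeq 𝕜 →L[𝕜] BddSeq 𝕜 :=
  LinearMap.mkContinuous
    { toFun := fun x => ⟨fun n => x (n + 1), memlp_of_bound fun n => apply_le x (n + 1)⟩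
      map_add' := fun _ _ => rfl
      map_smul' := fun _ _ => rfl } 1
    (fun x => by
      rw [one_mul]
      exact norm_le (norm_nonneg x) fun n => apply_le x (n + 1))

@[simp] theorem shift_apply (n : ℕ) (x : BddSeq 𝕜) : shift 𝕜 x n = x (n + 1) := rfl

end BddSeq

/-- A function that differs from the identity by a contraction is open, with a quantitative
estimate. -/
theorem exists_eq_of_contraction {𝕜 : Type} [RCLike 𝕜] {E : Type*} [NormedAddCommGroup E]
    [NormedSpace 𝕜 E] [CompleteSpace E] {f : E → E} {s : Set E} {c ρ : ℝ} (hc : 0 ≤ c) (hρ : 0 ≤ ρ)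
    {y : E} (hs : Metric.closedBall y ρ ⊆ s)
    (hf : ∀ p ∈ s, ∀ q ∈ s, ‖(f p - p) - (f q - q)‖ ≤ c * ‖p - q‖)
    {u : E} (hu : ‖u - f y‖ ≤ (1 - c) * ρ) : ∃ p, ‖p - y‖ ≤ ρ ∧ f p = u := by
  have happ : ApproximatesLinearOn f ((ContinuousLinearEquiv.refl 𝕜 E : E ≃L[𝕜] E) : E →L[𝕜] E) s
      ⟨c, hc⟩ := by
    intro p hp q hq
    have := hf p hp q hq
    have e : f p - f q - (p - q) = (f p - p) - (f q - q) := by abel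
    rw [← e] at this
    exact this
  rcases subsingleton_or_nontrivial E with hE | hE
  · exact ⟨y, by simpa using hρ, Subsingleton.elim _ _⟩
  have key := happ.surjOn_closedBall_of_nonlinearRightInverse
    (ContinuousLinearEquiv.refl 𝕜 E).toNonlinearRightInverse hρ hs
  have hn : (((ContinuousLinearEquiv.refl 𝕜 E).toNonlinearRightInverse).nnnorm : ℝ) = 1 := by
    change ‖(((ContinuousLinearEquiv.refl 𝕜 E).symm : E ≃L[𝕜] E) : E →L[𝕜] E)‖ = 1
    exact ContinuousLinearMap.norm_id
  have hmem : u ∈ Metric.closedBall (f y)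
      (((((ContinuousLinearEquiv.refl 𝕜 E).toNonlinearRightInverse).nnnorm : ℝ)⁻¹ - c) * ρ) := by
    rw [hn, Metric.mem_closedBall, dist_eq_norm]
    simpa using hu
  obtain ⟨p, hp, hpu⟩ := key hmem
  exact ⟨p, by simpa [dist_eq_norm] using hp, hpu⟩

/-! ### Profiles -/

/-- The coordinates of the staircase path, extended to small negative parameters. -/
noncomputable def stair (n : ℕ) (t : ℝ) : ℝ := if n = 0 then min t 1 else max 0 (min (t - n) 1)

theorem stair_lt {n : ℕ} {t : ℝ} (ht : 0 ≤ t) (h : n < ⌊t⌋₊) : stair n t = 1 := by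
  have h1 : ((n + 1 : ℕ) : ℝ) ≤ t := (Nat.le_floor_iff ht).1 h
  push_cast at h1
  have : (0 : ℝ) ≤ n := n.cast_nonneg
  unfold stair
  split_ifs
  · exact min_eq_right (by linarith)
  · rw [min_eq_right (by linarith)]; norm_num

theorem stair_floor {t : ℝ} (ht : 0 ≤ t) : stair ⌊t⌋₊ t = t - ⌊t⌋₊ := by
  have h1 := Nat.floor_le ht
  have h2 := Nat.lt_floor_add_one t
  unfold stair
  split_ifs with h
  · rw [h, min_eq_left (by rw [h] at h2; push_cast at h2; linarith)]; simp
  · rw [min_eq_left (by linarith), max_eq_right (by linarith)]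

theorem stair_gt {n : ℕ} {t : ℝ} (h : ⌊t⌋₊ < n) : stair n t = 0 := by
  have h1 : t < n := Nat.lt_of_floor_lt h
  unfold stair
  rw [if_neg (by omega), min_eq_left (by linarith), max_eq_left (by linarith)]

theorem stair_lip (n : ℕ) (t u : ℝ) : |stair n t - stair n u| ≤ |t - u| := by
  unfold stair
  split_ifs
  · simpa using abs_min_sub_min_le_max t 1 u 1
  · have h1 := abs_max_sub_max_le_max 0 (min (t - n) 1) 0 (min (u - n) 1)
    have h2 := abs_min_sub_min_le_max (t - n) 1 (u - n) 1
    simp only [sub_self, abs_zero, sub_sub_sub_cancel_right, max_eq_left (abs_nonneg (t - u))] at h1 h2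
    exact h1.trans (max_le (abs_nonneg _) h2)

/-- The thin strip-like box around the real point `t` of half-width `2000 r` and half-height
`3 δ`. -/
def paramBox (𝕜 : Type) [RCLike 𝕜] (r δ t : ℝ) : Set 𝕜 :=
  {z | |RCLike.re z - t| ≤ 2000 * r ∧ |RCLike.im z| ≤ 3 * δ}

/-- The functions `γ n`, `A n`, `B n` which define a twisted tube, over `ℝ` or `ℂ`, with their
real restrictions `g n`, `a n`, `b n`. Here `γ n` is a smoothing of the `n`-th coordinate of the
staircase path, `A n` is close to `1` before time `n + θ` and close to `0` after it, and `B n` is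
close to `0` before time `n + 1 - θ` and close to `1` after it. -/
structure Profile (𝕜 : Type) [RCLike 𝕜] (r δ η K : ℝ) (γ A B : ℕ → 𝕜 → 𝕜)
    (g a b : ℕ → ℝ → ℝ) : Prop where
  r_pos : 0 < r
  r_le : r ≤ 1 / 10000
  δ_pos : 0 < δ
  δ_le : δ ≤ η * r
  η_pos : 0 < η
  η_le : η ≤ 1 / 1000000
  K_nonneg : 0 ≤ K
  K_le : K * r ≤ η / 24000
  bdd : ∀ z, ∃ C, ∀ n, ‖γ n z‖ ≤ C ∧ ‖A n z‖ ≤ C ∧ ‖B n z‖ ≤ C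
  A_zero : ∀ z, A 0 z = 0
  γ_real : ∀ n (t : ℝ), γ n (t : 𝕜) = (g n t : 𝕜)
  A_real : ∀ n (t : ℝ), A n (t : 𝕜) = (a n t : 𝕜)
  B_real : ∀ n (t : ℝ), B n (t : 𝕜) = (b n t : 𝕜)
  a_nonneg : ∀ n t, 0 ≤ a n t
  b_nonneg : ∀ n t, 0 ≤ b n t
  ab_le : ∀ n t, a n t + b n t ≤ 1
  γ_lip : ∀ n z w, |RCLike.im z| ≤ 3 * δ → |RCLike.im w| ≤ 3 * δ → ‖γ n z - γ n w‖ ≤ 4 * ‖z - w‖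
  A_lip : ∀ n z w, |RCLike.im z| ≤ 3 * δ → |RCLike.im w| ≤ 3 * δ → ‖A n z - A n w‖ ≤ K * ‖z - w‖
  B_lip : ∀ n z w, |RCLike.im z| ≤ 3 * δ → |RCLike.im w| ≤ 3 * δ → ‖B n z - B n w‖ ≤ K * ‖z - w‖
  A_lt : ∀ t, 0 ≤ t → ∀ n < ⌊t⌋₊, ∀ z ∈ paramBox 𝕜 r δ t, ‖A n z‖ ≤ η
  B_lt : ∀ t, 0 ≤ t → ∀ n < ⌊t⌋₊, ∀ z ∈ paramBox 𝕜 r δ t, ‖B n z - 1‖ ≤ η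
  A_gt : ∀ t, 0 ≤ t → ∀ n > ⌊t⌋₊, ∀ z ∈ paramBox 𝕜 r δ t, ‖A n z - 1‖ ≤ η
  B_gt : ∀ t, 0 ≤ t → ∀ n > ⌊t⌋₊, ∀ z ∈ paramBox 𝕜 r δ t, ‖B n z‖ ≤ η
  balance : ∀ t, 0 ≤ t → ∀ z ∈ paramBox 𝕜 r δ t, ∀ w ∈ paramBox 𝕜 r δ t,
    ‖(γ ⌊t⌋₊ z + (a ⌊t⌋₊ t : 𝕜) * γ (⌊t⌋₊ - 1) z + (b ⌊t⌋₊ t : 𝕜) * γ (⌊t⌋₊ + 1) z - z)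
      - (γ ⌊t⌋₊ w + (a ⌊t⌋₊ t : 𝕜) * γ (⌊t⌋₊ - 1) w + (b ⌊t⌋₊ t : 𝕜) * γ (⌊t⌋₊ + 1) w - w)‖
      ≤ η * ‖z - w‖
  g_near : ∀ n t, -1 ≤ t → |g n t - stair n t| ≤ η * r

/-! ### The tube map and its explicit approximate inverses, one for each segment -/

section Charts

variable {𝕜 : Type} [RCLike 𝕜]

/-- The twisted tube map. -/
noncomputable def tubeMap (γ A B : ℕ → 𝕜 → 𝕜) (x : BddSeq 𝕜) : BddSeq 𝕜 :=
  BddSeq.ofFun fun n => γ n (x 0) + A n (x 0) * x n - B n (x 0) * x (n + 1)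

/-- The time coordinate of the chart around the `k`-th segment. -/
def chartTime (k : ℕ) (p q : 𝕜) (y : ℕ → 𝕜) : 𝕜 := y k + p * (y (k - 1) - 1) + q * y (k + 1) + k

/-- The transverse coordinates of the chart around the `k`-th segment. -/
def chartSide (γ : ℕ → 𝕜 → 𝕜) (k : ℕ) (p q : 𝕜) (y : ℕ → 𝕜) (j : ℕ) : 𝕜 :=
  if j = 0 then 0 else if j ≤ k then γ (j - 1) (chartTime k p q y) - y (j - 1)
    else y j - γ j (chartTime k p q y)

/-- The chart around the `k`-th segment: an explicit approximate inverse of the tube map. -/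
noncomputable def chart (γ : ℕ → 𝕜 → 𝕜) (k : ℕ) (p q : 𝕜) (y : BddSeq 𝕜) : BddSeq 𝕜 :=
  BddSeq.ofFun fun j => if j = 0 then chartTime k p q y else chartSide γ k p q y j

/-- The coordinates of the inverse of the chart. -/
def chartInv (γ : ℕ → 𝕜 → 𝕜) (k : ℕ) (p q : 𝕜) (x : ℕ → 𝕜) (n : ℕ) : 𝕜 :=
  if n < k then γ n (x 0) - x (n + 1)
  else if n = k then (x 0 - k) + p * (1 - γ (k - 1) (x 0)) - q * γ (k + 1) (x 0)
    + p * x k - q * x (k + 1)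
  else γ n (x 0) + x n

/-- Coordinate `k` of `chartInv` is built to cancel the weighted contributions of its two
neighbours. For `k = 0` the truncated index `k - 1` is again `0`, and `p = 0` removes that term. -/
theorem chartTime_chartInv {γ : ℕ → 𝕜 → 𝕜} {k : ℕ} {p q : 𝕜} (hp : k = 0 → p = 0) (x : ℕ → 𝕜) :
    chartTime k p q (chartInv γ k p q x) = x 0 := by
  have h2 : chartInv γ k p q x (k + 1) = γ (k + 1) (x 0) + x (k + 1) := by simp [chartInv]
  have h1 : p * (chartInv γ k p q x (k - 1) - 1) = p * (γ (k - 1) (x 0) - x k - 1) := by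
    rcases Nat.eq_zero_or_pos k with h | h
    · simp [hp h]
    · have : k - 1 + 1 = k := by omega
      rw [chartInv, if_pos (by omega), this]
  have h0 : chartInv γ k p q x k = (x 0 - k) + p * (1 - γ (k - 1) (x 0)) - q * γ (k + 1) (x 0)
    + p * x k - q * x (k + 1) := by simp [chartInv]
  rw [chartTime, h0, h1, h2]
  ring

theorem chart_chartInv {γ : ℕ → 𝕜 → 𝕜} {k : ℕ} {p q : 𝕜} (hp : k = 0 → p = 0) {x y : BddSeq 𝕜}
    (hy : ∀ n, y n = chartInv γ k p q x n) : chart γ k p q y = x := by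
  have hT : chartTime k p q y = x 0 := by
    rw [show (y : ℕ → 𝕜) = chartInv γ k p q x from funext hy]
    exact chartTime_chartInv hp x
  have hc : ∀ j, (if j = 0 then chartTime k p q y else chartSide γ k p q y j) = x j := by
    intro j
    split_ifs with h
    · rw [h, hT]
    · unfold chartSide
      rw [if_neg h, hT]
      split_ifs with h'
      · have : j - 1 + 1 = j := by omega
        rw [hy, chartInv, if_pos (by omega), this]; ring
      · rw [hy, chartInv, if_neg (by omega), if_neg (by omega)]; ring
  ext j
  rw [chart, BddSeq.ofFun_apply (C := ‖x‖), hc]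
  intro n
  rw [hc]
  exact BddSeq.apply_le x n

/-- The limits of `A n` far from the `k`-th segment. -/
def limA (k : ℕ) (p : 𝕜) (n : ℕ) : 𝕜 := if n < k then 0 else if n = k then p else 1

/-- The limits of `B n` far from the `k`-th segment. -/
def limB (k : ℕ) (q : 𝕜) (n : ℕ) : 𝕜 := if n < k then 1 else if n = k then q else 0

/-- The tube map read in a chart, as a perturbation of the identity. -/
theorem tube_chart_formula {γ A B : ℕ → 𝕜 → 𝕜} {k : ℕ} {p q : 𝕜} (hp : k = 0 → p = 0)
    (hA : ∀ z, A 0 z = 0) (y x : ℕ → 𝕜)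
    (hx : ∀ j, x j = if j = 0 then chartTime k p q y else chartSide γ k p q y j) (n : ℕ) :
    γ n (x 0) + A n (x 0) * x n - B n (x 0) * x (n + 1) - y n =
      (if n = k then γ k (chartTime k p q y) + p * γ (k - 1) (chartTime k p q y)
        + q * γ (k + 1) (chartTime k p q y) - chartTime k p q y + (k - p) else 0)
      + (A n (chartTime k p q y) - limA k p n) * chartSide γ k p q y n
      - (B n (chartTime k p q y) - limB k q n) * chartSide γ k p q y (n + 1) := by
  have hx0 : x 0 = chartTime k p q y := by simp [hx]
  have hxs : x (n + 1) = chartSide γ k p q y (n + 1) := by simp [hx]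
  -- At `n = 0` the chart has the time in place of a side coordinate; `A 0 = 0` makes the difference
  -- harmless.
  have hAn : A n (chartTime k p q y) * x n = A n (chartTime k p q y) * chartSide γ k p q y n := by
    rcases Nat.eq_zero_or_pos n with h | h
    · subst h; simp [hA]
    · rw [hx n, if_neg (by omega)]
  rw [hx0, hxs, hAn]
  rcases lt_trichotomy n k with h | h | h
  · have e1 : chartSide γ k p q y (n + 1) = γ n (chartTime k p q y) - y n := by
      rw [chartSide, if_neg (by omega), if_pos (by omega)]; rfl
    rw [if_neg h.ne, limA, limB, if_pos h, if_pos h, e1]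
    ring
  · subst h
    rw [if_pos rfl, limA, limB, if_neg (lt_irrefl _), if_pos rfl, if_neg (lt_irrefl _), if_pos rfl]
    have e1 : chartSide γ n p q y (n + 1) = y (n + 1) - γ (n + 1) (chartTime n p q y) := by
      rw [chartSide, if_neg (by omega), if_neg (by omega)]
    have e2 : p * chartSide γ n p q y n = p * (γ (n - 1) (chartTime n p q y) - y (n - 1)) := by
      rcases Nat.eq_zero_or_pos n with h | h
      · simp [hp h]
      · rw [chartSide, if_neg (by omega), if_pos le_rfl]
    have e3 : y n = chartTime n p q y - p * (y (n - 1) - 1) - q * y (n + 1) - n := by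
      rw [chartTime]; ring
    have e4 : q * chartSide γ n p q y (n + 1)
      = q * (y (n + 1) - γ (n + 1) (chartTime n p q y)) := by rw [e1]
    linear_combination (-1 : 𝕜) * e3 + e2 - e4
  · have e1 : chartSide γ k p q y n = y n - γ n (chartTime k p q y) := by
      rw [chartSide, if_neg (by omega), if_neg (by omega)]
    rw [if_neg h.ne', limA, limB, if_neg (by omega), if_neg (by omega), if_neg (by omega),
      if_neg (by omega), e1]
    ring

end Charts

/-! ### In a chart the tube map is a small perturbation of the identity -/

section Estimates

variable {𝕜 : Type} [RCLike 𝕜]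

/-- Coordinates `⌊t⌋` and `⌊t⌋ + 1` suffice: each accounts for at most `d` of the elapsed time, and
`d < 1/2` prevents the second from having saturated at `1`. -/
theorem stair_sep_aux {t u d : ℝ} (ht : 0 ≤ t) (htu : t ≤ u) (hd : d < 1 / 2)
    (h : ∀ n, |stair n t - stair n u| ≤ d) : u - t ≤ 2 * d := by
  have hk := stair_floor ht
  have hk1 := stair_gt (t := t) (n := ⌊t⌋₊ + 1) (Nat.lt_succ_self _)
  have e0 := abs_le.1 (h ⌊t⌋₊)
  have e1 := abs_le.1 (h (⌊t⌋₊ + 1))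
  have f1 := Nat.floor_le ht
  have f2 := Nat.lt_floor_add_one t
  have hd0 : 0 ≤ d := (abs_nonneg _).trans (h 0)
  have v0 : stair ⌊t⌋₊ u = min (u - ⌊t⌋₊) 1 := by
    unfold stair
    split_ifs with h0
    · simp [h0]
    · exact max_eq_right (le_min (by linarith) zero_le_one)
  have v1 : stair (⌊t⌋₊ + 1) u = max 0 (min (u - ⌊t⌋₊ - 1) 1) := by
    unfold stair
    rw [if_neg (by omega)]; push_cast; rw [sub_sub]
  rw [hk, v0] at e0
  rw [hk1, v1] at e1
  rcases le_total u (⌊t⌋₊ + 1) with h1 | h1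
  · rw [min_eq_left (by linarith)] at e0
    linarith [e0.1]
  · rw [min_eq_right (by linarith)] at e0
    have : u - ⌊t⌋₊ - 1 ≤ d := by
      have h2 : min (u - ⌊t⌋₊ - 1) 1 ≤ d := (le_max_right _ _).trans (by linarith [e1.1])
      rcases min_le_iff.1 h2 with h3 | h3
      · exact h3
      · linarith
    linarith [e0.1]

/-- The staircase path is injective, quantitatively. -/
theorem stair_sep {t u d : ℝ} (ht : 0 ≤ t) (hu : 0 ≤ u) (hd : d < 1 / 2)
    (h : ∀ n, |stair n t - stair n u| ≤ d) : |t - u| ≤ 2 * d := by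
  rcases le_total t u with htu | htu
  · rw [abs_sub_comm, abs_of_nonneg (by linarith)]
    exact stair_sep_aux ht htu hd h
  · rw [abs_of_nonneg (by linarith)]
    exact stair_sep_aux hu htu hd fun n => by rw [abs_sub_comm]; exact h n

/-- The chart attached to the time `t`. -/
noncomputable def segChart (γ : ℕ → 𝕜 → 𝕜) (a b : ℕ → ℝ → ℝ) (t : ℝ) : BddSeq 𝕜 → BddSeq 𝕜 :=
  chart γ ⌊t⌋₊ (a ⌊t⌋₊ t : 𝕜) (b ⌊t⌋₊ t : 𝕜)

/-- The time coordinate of `segChart`. -/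
noncomputable def segTime (a b : ℕ → ℝ → ℝ) (t : ℝ) (y : BddSeq 𝕜) : 𝕜 :=
  chartTime ⌊t⌋₊ (a ⌊t⌋₊ t : 𝕜) (b ⌊t⌋₊ t : 𝕜) y

/-- The transverse coordinates of `segChart`. -/
noncomputable def segSide (γ : ℕ → 𝕜 → 𝕜) (a b : ℕ → ℝ → ℝ) (t : ℝ) (y : BddSeq 𝕜) : ℕ → 𝕜 :=
  chartSide γ ⌊t⌋₊ (a ⌊t⌋₊ t : 𝕜) (b ⌊t⌋₊ t : 𝕜) y

/-- The domain of the chart attached to the time `t`. -/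
def chartDom (𝕜 : Type) [RCLike 𝕜] (r δ t : ℝ) : Set (BddSeq 𝕜) :=
  {y | ∀ n, |RCLike.re (y n) - stair n t| ≤ 600 * r ∧ |RCLike.im (y n)| ≤ δ}

theorem norm_le_abs_re_add_abs_im (z : 𝕜) : ‖z‖ ≤ |RCLike.re z| + |RCLike.im z| := by
  refine (sq_le_sq₀ (norm_nonneg z) (by positivity)).1 ?_
  rw [RCLike.norm_sq_eq_def, ← abs_mul_abs_self (RCLike.re z), ← abs_mul_abs_self (RCLike.im z)]
  nlinarith [mul_nonneg (abs_nonneg (RCLike.re z)) (abs_nonneg (RCLike.im z))]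

theorem norm_sub_ofReal_le (z : 𝕜) (s : ℝ) :
    ‖z - (s : 𝕜)‖ ≤ |RCLike.re z - s| + |RCLike.im z| := by
  simpa using norm_le_abs_re_add_abs_im (z - (s : 𝕜))

theorem abs_re_sub_le (z : 𝕜) (s : ℝ) : |RCLike.re z - s| ≤ ‖z - (s : 𝕜)‖ := by
  simpa using RCLike.abs_re_le_norm (z - (s : 𝕜))

theorem abs_im_le_norm_sub_ofReal (z : 𝕜) (s : ℝ) : |RCLike.im z| ≤ ‖z - (s : 𝕜)‖ := by
  simpa using RCLike.abs_im_le_norm (z - (s : 𝕜))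

namespace Profile

variable {r δ η K : ℝ} {γ A B : ℕ → 𝕜 → 𝕜} {g a b : ℕ → ℝ → ℝ}

theorem coef_zero (h : Profile 𝕜 r δ η K γ A B g a b) {k : ℕ} (hk : k = 0) (t : ℝ) :
    a k t = 0 := by
  have := h.A_real 0 t
  rw [h.A_zero] at this
  rw [hk]
  exact_mod_cast this.symm

theorem a_le_one (h : Profile 𝕜 r δ η K γ A B g a b) (n : ℕ) (t : ℝ) : a n t ≤ 1 := by
  linarith [h.ab_le n t, h.b_nonneg n t]

theorem b_le_one (h : Profile 𝕜 r δ η K γ A B g a b) (n : ℕ) (t : ℝ) : b n t ≤ 1 := by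
  linarith [h.ab_le n t, h.a_nonneg n t]

theorem δ_le_r (h : Profile 𝕜 r δ η K γ A B g a b) : δ ≤ r / 1000000 := by
  have := mul_le_mul_of_nonneg_right h.η_le h.r_pos.le
  linarith [h.δ_le]

theorem ηr_le (h : Profile 𝕜 r δ η K γ A B g a b) : η * r ≤ r / 1000000 := by
  have := mul_le_mul_of_nonneg_right h.η_le h.r_pos.le
  linarith

theorem time_mem_paramBox (h : Profile 𝕜 r δ η K γ A B g a b) (t : ℝ) :
    (t : 𝕜) ∈ paramBox 𝕜 r δ t := by
  constructor
  · simp [h.r_pos.le]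
  · simp [h.δ_pos.le]

theorem tubeMap_apply (h : Profile 𝕜 r δ η K γ A B g a b) (x : BddSeq 𝕜) (n : ℕ) :
    tubeMap γ A B x n = γ n (x 0) + A n (x 0) * x n - B n (x 0) * x (n + 1) := by
  obtain ⟨C, hC⟩ := h.bdd (x 0)
  refine BddSeq.ofFun_apply (C := C + C * ‖x‖ + C * ‖x‖) (fun n => ?_) n
  obtain ⟨h1, h2, h3⟩ := hC n
  have hC0 : 0 ≤ C := (norm_nonneg _).trans h1
  refine (norm_sub_le _ _).trans (add_le_add ((norm_add_le _ _).trans (add_le_add h1 ?_)) ?_)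
  · rw [norm_mul]
    exact mul_le_mul h2 (BddSeq.apply_le x _) (norm_nonneg _) hC0
  · rw [norm_mul]
    exact mul_le_mul h3 (BddSeq.apply_le x _) (norm_nonneg _) hC0

theorem segChart_apply (h : Profile 𝕜 r δ η K γ A B g a b) (t : ℝ) (y : BddSeq 𝕜) (j : ℕ) :
    segChart γ a b t y j = if j = 0 then segTime a b t y else segSide γ a b t y j := by
  obtain ⟨C, hC⟩ := h.bdd (segTime a b t y)
  have hC0 : 0 ≤ C := (norm_nonneg _).trans (hC 0).1
  refine BddSeq.ofFun_apply (C := ‖segTime a b t y‖ + (C + ‖y‖)) (fun j => ?_) j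
  split_ifs with hj
  · exact le_add_of_nonneg_right (by positivity)
  · refine le_trans ?_ (le_add_of_nonneg_left (norm_nonneg _))
    unfold chartSide
    split_ifs
    · exact (norm_sub_le _ _).trans (add_le_add (hC _).1 (BddSeq.apply_le y _))
    · rw [add_comm]
      exact (norm_sub_le _ _).trans (add_le_add (BddSeq.apply_le y _) (hC _).1)

theorem segTime_lip (h : Profile 𝕜 r δ η K γ A B g a b) (t : ℝ) (y y' : BddSeq 𝕜) :
    ‖segTime a b t y - segTime a b t y'‖ ≤ (1 + a ⌊t⌋₊ t + b ⌊t⌋₊ t) * ‖y - y'‖ := by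
  have e : segTime a b t y - segTime a b t y' = (y ⌊t⌋₊ - y' ⌊t⌋₊)
      + (a ⌊t⌋₊ t : 𝕜) * (y (⌊t⌋₊ - 1) - y' (⌊t⌋₊ - 1))
      + (b ⌊t⌋₊ t : 𝕜) * (y (⌊t⌋₊ + 1) - y' (⌊t⌋₊ + 1)) := by
    simp only [segTime, chartTime]; ring
  rw [e]
  refine (norm_add₃_le).trans ?_
  rw [norm_mul, norm_mul, RCLike.norm_of_nonneg (h.a_nonneg _ _),
    RCLike.norm_of_nonneg (h.b_nonneg _ _)]
  have := mul_le_mul_of_nonneg_left (BddSeq.sub_apply_le y y' (⌊t⌋₊ - 1)) (h.a_nonneg ⌊t⌋₊ t)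
  have := mul_le_mul_of_nonneg_left (BddSeq.sub_apply_le y y' (⌊t⌋₊ + 1)) (h.b_nonneg ⌊t⌋₊ t)
  have := BddSeq.sub_apply_le y y' ⌊t⌋₊
  linarith

theorem segTime_lip_two (h : Profile 𝕜 r δ η K γ A B g a b) (t : ℝ) (y y' : BddSeq 𝕜) :
    ‖segTime a b t y - segTime a b t y'‖ ≤ 2 * ‖y - y'‖ :=
  (h.segTime_lip t y y').trans
    (mul_le_mul_of_nonneg_right (by linarith [h.ab_le ⌊t⌋₊ t]) (norm_nonneg _))

/-- Either the previous coordinate has already reached `1`, or `⌊t⌋ = 0` and the coefficient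
vanishes together with the truncated index. -/
theorem coef_mul_stair (h : Profile 𝕜 r δ η K γ A B g a b) {t : ℝ} (ht : 0 ≤ t) :
    a ⌊t⌋₊ t * stair (⌊t⌋₊ - 1) t = a ⌊t⌋₊ t := by
  rcases Nat.eq_zero_or_pos ⌊t⌋₊ with h0 | h0
  · simp [h.coef_zero h0]
  · rw [stair_lt ht (by omega), mul_one]

/-- The time coordinate is an average of coordinates. -/
theorem segTime_re (h : Profile 𝕜 r δ η K γ A B g a b) {t : ℝ} (ht : 0 ≤ t) (y : BddSeq 𝕜) :
    RCLike.re (segTime a b t y) - t = (RCLike.re (y ⌊t⌋₊) - stair ⌊t⌋₊ t)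
      + a ⌊t⌋₊ t * (RCLike.re (y (⌊t⌋₊ - 1)) - stair (⌊t⌋₊ - 1) t)
      + b ⌊t⌋₊ t * (RCLike.re (y (⌊t⌋₊ + 1)) - stair (⌊t⌋₊ + 1) t) := by
  rw [mul_sub (a ⌊t⌋₊ t), h.coef_mul_stair ht, stair_gt (Nat.lt_succ_self _), stair_floor ht]
  simp only [segTime, chartTime, map_add, RCLike.re_ofReal_mul, map_sub, RCLike.one_re,
    RCLike.natCast_re]
  ring

theorem segTime_im (t : ℝ) (y : BddSeq 𝕜) :
    RCLike.im (segTime a b t y) = RCLike.im (y ⌊t⌋₊)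
      + a ⌊t⌋₊ t * RCLike.im (y (⌊t⌋₊ - 1)) + b ⌊t⌋₊ t * RCLike.im (y (⌊t⌋₊ + 1)) := by
  simp only [segTime, chartTime, map_add, RCLike.im_ofReal_mul, map_sub, RCLike.one_im,
    RCLike.natCast_im]
  ring

theorem abs_weighted_le (h : Profile 𝕜 r δ η K γ A B g a b) (n : ℕ) (t : ℝ) {u v w C : ℝ}
    (hu : |u| ≤ C) (hv : |v| ≤ C) (hw : |w| ≤ C) : |u + a n t * v + b n t * w| ≤ 2 * C := by
  have h1 := mul_le_mul_of_nonneg_left hv (h.a_nonneg n t)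
  have h2 := mul_le_mul_of_nonneg_left hw (h.b_nonneg n t)
  have h3 : |u + a n t * v + b n t * w| ≤ |u| + |a n t * v| + |b n t * w| := abs_add_three _ _ _
  rw [abs_mul, abs_mul, abs_of_nonneg (h.a_nonneg n t), abs_of_nonneg (h.b_nonneg n t)] at h3
  have hC : 0 ≤ C := (abs_nonneg _).trans hu
  have h4 := mul_le_mul_of_nonneg_right (h.ab_le n t) hC
  linarith

theorem segTime_bounds (h : Profile 𝕜 r δ η K γ A B g a b) {t : ℝ} (ht : 0 ≤ t) {y : BddSeq 𝕜}
    (hy : y ∈ chartDom 𝕜 r δ t) : |RCLike.re (segTime a b t y) - t| ≤ 1200 * r ∧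
      |RCLike.im (segTime a b t y)| ≤ 2 * δ := by
  constructor
  · rw [h.segTime_re ht]
    refine (h.abs_weighted_le _ _ (hy _).1 (hy _).1 (hy _).1).trans (by linarith)
  · rw [segTime_im]
    exact h.abs_weighted_le _ _ (hy _).2 (hy _).2 (hy _).2

theorem segTime_mem (h : Profile 𝕜 r δ η K γ A B g a b) {t : ℝ} (ht : 0 ≤ t) {y : BddSeq 𝕜}
    (hy : y ∈ chartDom 𝕜 r δ t) : segTime a b t y ∈ paramBox 𝕜 r δ t := by
  have := h.segTime_bounds ht hy
  exact ⟨this.1.trans (by linarith [h.r_pos]), this.2.trans (by linarith [h.δ_pos])⟩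

theorem γ_near_stair (h : Profile 𝕜 r δ η K γ A B g a b) {t : ℝ} (ht : 0 ≤ t) {z : 𝕜} {ρ : ℝ}
    (h1 : |RCLike.re z - t| ≤ ρ) (h2 : |RCLike.im z| ≤ 3 * δ) (n : ℕ) :
    ‖γ n z - (stair n t : 𝕜)‖ ≤ 4 * ρ + 4 * |RCLike.im z| + η * r := by
  have e1 := h.γ_lip n z (t : 𝕜) h2 (by simp [h.δ_pos.le])
  have e2 := norm_sub_ofReal_le z t
  have e3 : ‖γ n (t : 𝕜) - (stair n t : 𝕜)‖ ≤ η * r := by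
    rw [h.γ_real, ← RCLike.ofReal_sub, RCLike.norm_ofReal]
    exact h.g_near n t (by linarith)
  have e4 := norm_sub_le_norm_sub_add_norm_sub (γ n z) (γ n (t : 𝕜)) (stair n t : 𝕜)
  linarith

/-- A side coordinate compares `γ_n(T)` with `y_n`, and both are near `stair n t`. The time error
`1200 r` is amplified by the Lipschitz constant `4`, and `y_n` adds `600 r`; the rest is slack. -/
theorem segSide_bound (h : Profile 𝕜 r δ η K γ A B g a b) {t : ℝ} (ht : 0 ≤ t) {y : BddSeq 𝕜}
    (hy : y ∈ chartDom 𝕜 r δ t) (j : ℕ) : ‖segSide γ a b t y j‖ ≤ 8000 * r := by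
  have hT := h.segTime_bounds ht hy
  have hr := h.r_pos
  have hδ := h.δ_le_r
  have hη := h.ηr_le
  have key : ∀ n, ‖γ n (segTime a b t y) - y n‖ ≤ 8000 * r := by
    intro n
    have e1 := h.γ_near_stair ht hT.1 (hT.2.trans (by linarith [h.δ_pos])) n
    have e2 := norm_sub_ofReal_le (y n) (stair n t)
    have e3 := norm_sub_le_norm_sub_add_norm_sub (γ n (segTime a b t y)) (stair n t : 𝕜) (y n)
    rw [norm_sub_rev (stair n t : 𝕜)] at e3
    linarith [(hy n).1, (hy n).2]
  unfold segSide chartSide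
  split_ifs
  · simp [hr.le]
  · exact key _
  · rw [norm_sub_rev]; exact key _

theorem segSide_lip (h : Profile 𝕜 r δ η K γ A B g a b) {t : ℝ} (ht : 0 ≤ t) {y y' : BddSeq 𝕜}
    (hy : y ∈ chartDom 𝕜 r δ t) (hy' : y' ∈ chartDom 𝕜 r δ t) (j : ℕ) :
    ‖segSide γ a b t y j - segSide γ a b t y' j‖ ≤ 9 * ‖y - y'‖ := by
  have hT := (h.segTime_mem ht hy).2
  have hT' := (h.segTime_mem ht hy').2
  have hn := norm_nonneg (y - y')
  have key : ∀ n, ‖γ n (segTime a b t y) - γ n (segTime a b t y')‖ ≤ 8 * ‖y - y'‖ := by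
    intro n
    have e1 := h.γ_lip n _ _ hT hT'
    have e2 := h.segTime_lip_two t y y'
    linarith
  unfold segSide chartSide
  split_ifs
  · simp
  · rw [sub_sub_sub_comm]
    refine (norm_sub_le _ _).trans ?_
    have := key (j - 1)
    have := BddSeq.sub_apply_le y y' (j - 1)
    simp only [segTime] at *
    linarith
  · rw [sub_sub_sub_comm]
    refine (norm_sub_le _ _).trans ?_
    have := key j
    have := BddSeq.sub_apply_le y y' j
    simp only [segTime] at *
    linarith

theorem segChart_lip (h : Profile 𝕜 r δ η K γ A B g a b) {t : ℝ} (ht : 0 ≤ t) {y y' : BddSeq 𝕜}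
    (hy : y ∈ chartDom 𝕜 r δ t) (hy' : y' ∈ chartDom 𝕜 r δ t) :
    ‖segChart γ a b t y - segChart γ a b t y'‖ ≤ 9 * ‖y - y'‖ := by
  have hn := norm_nonneg (y - y')
  refine BddSeq.norm_sub_le (by positivity) fun j => ?_
  rw [h.segChart_apply, h.segChart_apply]
  split_ifs
  · exact (h.segTime_lip_two t y y').trans (by linarith)
  · exact h.segSide_lip ht hy hy' j

/-- Off the index `⌊t⌋` the profile provides the limits. At that index the limit is the coefficient
frozen at time `t`, whose variation over the box is at most `2001 K r`, below `η` because `K r ≤ η /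
24000`. -/
theorem A_sub_lim (h : Profile 𝕜 r δ η K γ A B g a b) {t : ℝ} (ht : 0 ≤ t) {z : 𝕜}
    (hz : z ∈ paramBox 𝕜 r δ t) (n : ℕ) : ‖A n z - limA ⌊t⌋₊ (a ⌊t⌋₊ t : 𝕜) n‖ ≤ η := by
  unfold limA
  split_ifs with h1 h2
  · simpa using h.A_lt t ht n h1 z hz
  · rw [← h.A_real, h2]
    have e1 := h.A_lip ⌊t⌋₊ z (t : 𝕜) hz.2 (by simp [h.δ_pos.le])
    have e2 := norm_sub_ofReal_le z t
    have e3 : ‖z - (t : 𝕜)‖ ≤ 2001 * r := by linarith [hz.1, hz.2, h.δ_le_r, h.r_pos]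
    have e4 := mul_le_mul_of_nonneg_left e3 h.K_nonneg
    linarith [h.K_le, h.η_pos]
  · exact h.A_gt t ht n (by omega) z hz

theorem B_sub_lim (h : Profile 𝕜 r δ η K γ A B g a b) {t : ℝ} (ht : 0 ≤ t) {z : 𝕜}
    (hz : z ∈ paramBox 𝕜 r δ t) (n : ℕ) : ‖B n z - limB ⌊t⌋₊ (b ⌊t⌋₊ t : 𝕜) n‖ ≤ η := by
  unfold limB
  split_ifs with h1 h2
  · exact h.B_lt t ht n h1 z hz
  · rw [← h.B_real, h2]
    have e1 := h.B_lip ⌊t⌋₊ z (t : 𝕜) hz.2 (by simp [h.δ_pos.le])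
    have e2 := norm_sub_ofReal_le z t
    have e3 : ‖z - (t : 𝕜)‖ ≤ 2001 * r := by linarith [hz.1, hz.2, h.δ_le_r, h.r_pos]
    have e4 := mul_le_mul_of_nonneg_left e3 h.K_nonneg
    linarith [h.K_le, h.η_pos]
  · simpa using h.B_gt t ht n (by omega) z hz

theorem norm_mul_sub_mul_le {u u' v v' : 𝕜} {p q s d : ℝ} (hu : ‖u‖ ≤ p) (hv : ‖v'‖ ≤ q)
    (huu : ‖u - u'‖ ≤ s) (hvv : ‖v - v'‖ ≤ d) : ‖u * v - u' * v'‖ ≤ p * d + s * q := by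
  have e : u * v - u' * v' = u * (v - v') + (u - u') * v' := by ring
  rw [e]
  refine (norm_add_le _ _).trans ?_
  rw [norm_mul, norm_mul]
  exact add_le_add (mul_le_mul hu hvv (norm_nonneg _) ((norm_nonneg _).trans hu))
    (mul_le_mul huu hv (norm_nonneg _) ((norm_nonneg _).trans huu))

/-- The error term on the diagonal. -/
noncomputable def defect (γ : ℕ → 𝕜 → 𝕜) (a b : ℕ → ℝ → ℝ) (t : ℝ) (z : 𝕜) : 𝕜 :=
  γ ⌊t⌋₊ z + (a ⌊t⌋₊ t : 𝕜) * γ (⌊t⌋₊ - 1) z + (b ⌊t⌋₊ t : 𝕜) * γ (⌊t⌋₊ + 1) z - z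
    + (⌊t⌋₊ - (a ⌊t⌋₊ t : 𝕜))

theorem defect_lip (h : Profile 𝕜 r δ η K γ A B g a b) {t : ℝ} (ht : 0 ≤ t) {z w : 𝕜}
    (hz : z ∈ paramBox 𝕜 r δ t) (hw : w ∈ paramBox 𝕜 r δ t) :
    ‖defect γ a b t z - defect γ a b t w‖ ≤ η * ‖z - w‖ := by
  rw [defect, defect, add_sub_add_right_eq_sub]
  exact h.balance t ht z hz w hw

/-- The exact staircase is balanced: its values at `⌊t⌋`, `⌊t⌋ - 1`, `⌊t⌋ + 1` are `t - ⌊t⌋`, `1`,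
`0`. Only the smoothing errors remain, with total weight `1 + a + b ≤ 2`. -/
theorem defect_self (h : Profile 𝕜 r δ η K γ A B g a b) {t : ℝ} (ht : 0 ≤ t) :
    ‖defect γ a b t (t : 𝕜)‖ ≤ 2 * (η * r) := by
  have e : defect γ a b t (t : 𝕜) = (((g ⌊t⌋₊ t - stair ⌊t⌋₊ t)
      + a ⌊t⌋₊ t * (g (⌊t⌋₊ - 1) t - stair (⌊t⌋₊ - 1) t)
      + b ⌊t⌋₊ t * (g (⌊t⌋₊ + 1) t - stair (⌊t⌋₊ + 1) t) : ℝ) : 𝕜) := by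
    rw [mul_sub (a ⌊t⌋₊ t), h.coef_mul_stair ht, stair_gt (Nat.lt_succ_self _), stair_floor ht,
      defect, h.γ_real, h.γ_real, h.γ_real]
    push_cast
    ring
  rw [e, RCLike.norm_ofReal]
  exact h.abs_weighted_le _ _ (h.g_near _ _ (by linarith)) (h.g_near _ _ (by linarith))
    (h.g_near _ _ (by linarith))

/-- The tube map read in a chart. -/
noncomputable def _root_.readMap (γ A B : ℕ → 𝕜 → 𝕜) (a b : ℕ → ℝ → ℝ) (t : ℝ) (y : BddSeq 𝕜) :
    BddSeq 𝕜 := tubeMap γ A B (segChart γ a b t y)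

theorem readMap_apply (h : Profile 𝕜 r δ η K γ A B g a b) (t : ℝ) (y : BddSeq 𝕜) (n : ℕ) :
    readMap γ A B a b t y n - y n = (if n = ⌊t⌋₊ then defect γ a b t (segTime a b t y) else 0)
      + (A n (segTime a b t y) - limA ⌊t⌋₊ (a ⌊t⌋₊ t : 𝕜) n) * segSide γ a b t y n
      - (B n (segTime a b t y) - limB ⌊t⌋₊ (b ⌊t⌋₊ t : 𝕜) n) * segSide γ a b t y (n + 1) := by
  rw [readMap, h.tubeMap_apply]
  exact tube_chart_formula (fun h0 => by rw [h.coef_zero h0]; simp) h.A_zero y _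
    (fun j => h.segChart_apply t y j) n

/-- In a chart the tube map differs from the identity by a contraction. -/
theorem readMap_contraction (h : Profile 𝕜 r δ η K γ A B g a b) {t : ℝ} (ht : 0 ≤ t)
    (y : BddSeq 𝕜) (hy : y ∈ chartDom 𝕜 r δ t) (y' : BddSeq 𝕜) (hy' : y' ∈ chartDom 𝕜 r δ t) :
    ‖(readMap γ A B a b t y - y) - (readMap γ A B a b t y' - y')‖ ≤ 31 * η * ‖y - y'‖ := by
  have hT := h.segTime_mem ht hy
  have hT' := h.segTime_mem ht hy'
  have hTT := h.segTime_lip_two t y y'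
  have hn := norm_nonneg (y - y')
  have hη := h.η_pos
  have hK := mul_le_mul_of_nonneg_left hTT h.K_nonneg
  have hKr := mul_le_mul_of_nonneg_right h.K_le hn
  have hηn := mul_nonneg hη.le hn
  -- Per coordinate: the defect contributes `2 η`; each of the two products contributes `9 η` from
  -- the side coordinate and `2 K · 8000 r`, less than `η`, from the coefficient.
  refine BddSeq.norm_sub_le (by positivity) fun n => ?_
  have eA := norm_mul_sub_mul_le (h.A_sub_lim ht hT n) (h.segSide_bound ht hy' n)
    (s := K * (2 * ‖y - y'‖)) (u' := A n (segTime a b t y') - limA ⌊t⌋₊ (a ⌊t⌋₊ t : 𝕜) n)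
    (by rw [sub_sub_sub_cancel_right]; exact (h.A_lip n _ _ hT.2 hT'.2).trans hK)
    (h.segSide_lip ht hy hy' n)
  have eB := norm_mul_sub_mul_le (h.B_sub_lim ht hT n) (h.segSide_bound ht hy' (n + 1))
    (s := K * (2 * ‖y - y'‖)) (u' := B n (segTime a b t y') - limB ⌊t⌋₊ (b ⌊t⌋₊ t : 𝕜) n)
    (by rw [sub_sub_sub_cancel_right]; exact (h.B_lip n _ _ hT.2 hT'.2).trans hK)
    (h.segSide_lip ht hy hy' (n + 1))
  have eD : ‖(if n = ⌊t⌋₊ then defect γ a b t (segTime a b t y) else 0)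
      - (if n = ⌊t⌋₊ then defect γ a b t (segTime a b t y') else 0)‖ ≤ η * (2 * ‖y - y'‖) := by
    split_ifs
    · exact (h.defect_lip ht hT hT').trans (mul_le_mul_of_nonneg_left hTT hη.le)
    · rw [sub_zero, norm_zero]; positivity
  simp only [lp.coeFn_sub, Pi.sub_apply]
  rw [h.readMap_apply, h.readMap_apply]
  have hre : ∀ u v w u' v' w' : 𝕜,
      u + v - w - (u' + v' - w') = (u - u') + ((v - v') - (w - w')) := by intros; ring
  rw [hre]
  refine (norm_add_le _ _).trans ?_
  have := norm_sub_le ((A n (segTime a b t y) - limA ⌊t⌋₊ (a ⌊t⌋₊ t : 𝕜) n) * segSide γ a b t y n -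
    (A n (segTime a b t y') - limA ⌊t⌋₊ (a ⌊t⌋₊ t : 𝕜) n) * segSide γ a b t y' n)
    ((B n (segTime a b t y) - limB ⌊t⌋₊ (b ⌊t⌋₊ t : 𝕜) n) * segSide γ a b t y (n + 1) -
    (B n (segTime a b t y') - limB ⌊t⌋₊ (b ⌊t⌋₊ t : 𝕜) n) * segSide γ a b t y' (n + 1))
  linarith

/-- The contraction estimate leaves a translation free; this fixes it. The defect is at most `2003 η
r` and each product at most `8000 η r`, and `η ≤ 10⁻⁶`. -/
theorem readMap_near (h : Profile 𝕜 r δ η K γ A B g a b) {t : ℝ} (ht : 0 ≤ t) {y : BddSeq 𝕜}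
    (hy : y ∈ chartDom 𝕜 r δ t) : ‖readMap γ A B a b t y - y‖ ≤ r / 50 := by
  have hT := h.segTime_mem ht hy
  have hη := h.η_pos
  have hr := h.r_pos
  refine BddSeq.norm_sub_le (by positivity) fun n => ?_
  rw [h.readMap_apply]
  have eA := mul_le_mul (h.A_sub_lim ht hT n) (h.segSide_bound ht hy n) (norm_nonneg _) hη.le
  have eB := mul_le_mul (h.B_sub_lim ht hT n) (h.segSide_bound ht hy (n + 1)) (norm_nonneg _) hη.le
  rw [← norm_mul] at eA eB
  have eD : ‖(if n = ⌊t⌋₊ then defect γ a b t (segTime a b t y) else 0)‖ ≤ 2003 * (η * r) := by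
    split_ifs
    · have e1 := h.defect_lip ht hT (h.time_mem_paramBox t)
      have e2 := h.defect_self ht
      have e3 := norm_sub_ofReal_le (segTime a b t y) t
      have e4 : ‖segTime a b t y - (t : 𝕜)‖ ≤ 2001 * r := by
        linarith [hT.1, hT.2, h.δ_le_r]
      have e5 := mul_le_mul_of_nonneg_left e4 hη.le
      have e6 := norm_sub_norm_le (defect γ a b t (segTime a b t y)) (defect γ a b t (t : 𝕜))
      linarith
    · rw [norm_zero]; positivity
  refine (norm_sub_le _ _).trans ?_
  have := norm_add_le (if n = ⌊t⌋₊ then defect γ a b t (segTime a b t y) else 0)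
    ((A n (segTime a b t y) - limA ⌊t⌋₊ (a ⌊t⌋₊ t : 𝕜) n) * segSide γ a b t y n)
  linarith [h.ηr_le]

/-- Points of the tube at times close to `t` are covered by the chart at `t`. -/
theorem exists_chart_point (h : Profile 𝕜 r δ η K γ A B g a b) {t : ℝ} (ht : 0 ≤ t) {x : BddSeq 𝕜}
    {ρ : ℝ} (hρ : ρ ≤ 100 * r) (h0 : |RCLike.re (x 0) - t| ≤ ρ)
    (him : ∀ n, |RCLike.im (x n)| ≤ δ / 100) (hre : ∀ n, 1 ≤ n → |RCLike.re (x n)| ≤ 2 * r) :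
    ∃ y ∈ chartDom 𝕜 r δ t, segChart γ a b t y = x ∧
      ∀ n, ‖y n - (stair n t : 𝕜)‖ ≤ 5 * ρ + 6 * r ∧ |RCLike.im (y n)| ≤ δ / 2 := by
  have hr := h.r_pos
  have hδ := h.δ_pos
  have hδr := h.δ_le_r
  have hηr := h.ηr_le
  have hρ0 : 0 ≤ ρ := (abs_nonneg _).trans h0
  have hx0 : |RCLike.im (x 0)| ≤ 3 * δ := (him 0).trans (by linarith)
  have hγ : ∀ n, ‖γ n (x 0) - (stair n t : 𝕜)‖ ≤ 4 * ρ + r / 10 := fun n => by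
    have := h.γ_near_stair ht h0 hx0 n
    linarith [him 0]
  -- Since `γ n` is real at real points, its imaginary part is controlled by the distance from `x 0`
  -- to its own real part.
  have hγim : ∀ n, |RCLike.im (γ n (x 0))| ≤ 4 * (δ / 100) := fun n => by
    have e1 := h.γ_lip n (x 0) ((RCLike.re (x 0) : ℝ) : 𝕜) hx0 (by simp [hδ.le])
    rw [h.γ_real] at e1
    have e2 := abs_im_le_norm_sub_ofReal (γ n (x 0)) (g n (RCLike.re (x 0)))
    have e3 := norm_sub_ofReal_le (x 0) (RCLike.re (x 0))
    rw [sub_self, abs_zero, zero_add] at e3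
    linarith [him 0]
  have hxn : ∀ n, 1 ≤ n → ‖x n‖ ≤ 2 * r + r / 10 := fun n hn => by
    have := norm_le_abs_re_add_abs_im (x n)
    linarith [hre n hn, him n]
  set k := ⌊t⌋₊ with hk
  have hp : k = 0 → a k t = 0 := fun h0 => h.coef_zero h0 t
  set c : ℕ → 𝕜 := chartInv γ k (a k t : 𝕜) (b k t : 𝕜) x with hc
  have hab := h.ab_le k t
  have ha := h.a_nonneg k t
  have hb := h.b_nonneg k t
  have norm_c : ∀ n, ‖c n - (stair n t : 𝕜)‖ ≤ 5 * ρ + 6 * r := by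
    intro n
    rw [hc, chartInv]
    split_ifs with h1 h2
    · rw [sub_right_comm]
      refine (norm_sub_le _ _).trans ?_
      linarith [hγ n, hxn (n + 1) (by omega)]
    · subst h2
      have e0 : ‖x 0 - (t : 𝕜)‖ ≤ ρ + r / 10 := by
        have := norm_sub_ofReal_le (x 0) t
        linarith [him 0]
      have e1 : ‖(a k t : 𝕜) * ((1 - γ (k - 1) (x 0)) + x k)‖ ≤ a k t * (4 * ρ + 4 * r) := by
        rcases Nat.eq_zero_or_pos k with h3 | h3
        · simp [hp h3]
        · rw [norm_mul, RCLike.norm_of_nonneg ha]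
          refine mul_le_mul_of_nonneg_left ((norm_add_le _ _).trans ?_) ha
          have e2 := hγ (k - 1)
          rw [stair_lt ht (by omega), norm_sub_rev] at e2
          push_cast at e2
          linarith [hxn k h3]
      have e3 : ‖(b k t : 𝕜) * (γ (k + 1) (x 0) + x (k + 1))‖ ≤ b k t * (4 * ρ + 4 * r) := by
        rw [norm_mul, RCLike.norm_of_nonneg hb]
        refine mul_le_mul_of_nonneg_left ((norm_add_le _ _).trans ?_) hb
        have e2 := hγ (k + 1)
        rw [stair_gt (by omega)] at e2
        push_cast at e2
        rw [sub_zero] at e2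
        linarith [hxn (k + 1) (by omega)]
      have e4 : x 0 - (k : 𝕜) + (a k t : 𝕜) * (1 - γ (k - 1) (x 0)) - (b k t : 𝕜) * γ (k + 1) (x 0)
          + (a k t : 𝕜) * x k - (b k t : 𝕜) * x (k + 1) - (stair k t : 𝕜)
          = (x 0 - (t : 𝕜)) + (a k t : 𝕜) * ((1 - γ (k - 1) (x 0)) + x k)
            - (b k t : 𝕜) * (γ (k + 1) (x 0) + x (k + 1)) := by
        rw [hk, stair_floor ht]; push_cast; ring
      rw [e4]
      refine (norm_sub_le _ _).trans ?_
      have e5 := norm_add_le (x 0 - (t : 𝕜)) ((a k t : 𝕜) * ((1 - γ (k - 1) (x 0)) + x k))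
      have e6 := mul_le_mul_of_nonneg_right hab (show 0 ≤ 4 * ρ + 4 * r by positivity)
      linarith
    · rw [add_sub_right_comm]
      refine (norm_add_le _ _).trans ?_
      linarith [hγ n, hxn n (by omega)]
  -- Half of the height `δ` of the chart domain is kept free, so that balls of radius `δ / 2` around
  -- the point stay inside.
  have im_c : ∀ n, |RCLike.im (c n)| ≤ δ / 2 := by
    intro n
    rw [hc, chartInv]
    split_ifs with h1 h2
    · rw [map_sub]
      refine (abs_sub _ _).trans ?_
      linarith [hγim n, him (n + 1)]
    · have e4 : RCLike.im (x 0 - (k : 𝕜) + (a k t : 𝕜) * (1 - γ (k - 1) (x 0))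
          - (b k t : 𝕜) * γ (k + 1) (x 0) + (a k t : 𝕜) * x k - (b k t : 𝕜) * x (k + 1))
          = RCLike.im (x 0) + a k t * (RCLike.im (x k) - RCLike.im (γ (k - 1) (x 0)))
            + b k t * (- RCLike.im (γ (k + 1) (x 0)) - RCLike.im (x (k + 1))) := by
        simp only [map_add, map_sub, RCLike.im_ofReal_mul, RCLike.one_im, RCLike.natCast_im]
        ring
      rw [e4]
      refine (h.abs_weighted_le k t (C := δ / 20) ?_ ?_ ?_).trans (by linarith)
      · linarith [him 0]
      · refine (abs_sub _ _).trans ?_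
        linarith [hγim (k - 1), him k]
      · refine (abs_sub _ _).trans ?_
        rw [abs_neg]
        linarith [hγim (k + 1), him (k + 1)]
    · rw [map_add]
      refine (abs_add_le _ _).trans ?_
      linarith [hγim n, him n]
  have bdd_c : ∀ n, ‖c n‖ ≤ 5 * ρ + 6 * r + (1 + t) := by
    intro n
    have e1 := norm_c n
    have e2 : |stair n t| ≤ 1 + t := by
      have := stair_lip n t 0
      have e3 : stair n 0 = 0 := by
        unfold stair
        split_ifs
        · simp
        · rw [min_eq_left, max_eq_left] <;> linarith [(n.cast_nonneg : (0 : ℝ) ≤ n)]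
      rw [e3, sub_zero, sub_zero, abs_of_nonneg ht] at this
      linarith
    rw [← RCLike.norm_ofReal (K := 𝕜)] at e2
    have := norm_add_le (c n - (stair n t : 𝕜)) (stair n t : 𝕜)
    rw [sub_add_cancel] at this
    linarith
  have hofc : ∀ n, BddSeq.ofFun c n = c n := BddSeq.ofFun_apply bdd_c
  refine ⟨BddSeq.ofFun c, fun n => ?_, ?_, fun n => ?_⟩
  · rw [hofc]
    exact ⟨(abs_re_sub_le _ _).trans ((norm_c n).trans (by linarith)),
      (im_c n).trans (by linarith)⟩
  · exact chart_chartInv (fun h0 => by rw [hp h0]; simp) hofc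
  · rw [hofc]; exact ⟨norm_c n, im_c n⟩

end Profile

end Estimates

/-! ### Analyticity of an inverse that is Lipschitz at a point -/

section InverseFunction

open Filter Topology

variable {𝕜 : Type} [RCLike 𝕜] {E : Type*} [NormedAddCommGroup E] [NormedSpace 𝕜 E]
  [CompleteSpace E]

/-- If a local inverse of a differentiable map is Lipschitz at a point, then the derivative is
bijective. -/
theorem exists_equiv_of_lipschitz_inverse {f g : E → E} {f' : E →L[𝕜] E} {x : E} {C : ℝ}
    (hf : HasFDerivAt f f' x)
    (hgf : ∀ᶠ x' in 𝓝 x, g (f x') = x') (hfg : ∀ᶠ u in 𝓝 (f x), f (g u) = u)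
    (hlip : ∀ᶠ u in 𝓝 (f x), ‖g u - x‖ ≤ C * ‖u - f x‖) :
    ∃ e : E ≃L[𝕜] E, (e : E →L[𝕜] E) = f' := by
  have hC : ∀ᶠ u in 𝓝 (f x), ‖g u - x‖ ≤ (|C| + 1) * ‖u - f x‖ :=
    hlip.mono fun u hu => hu.trans
      (mul_le_mul_of_nonneg_right (by linarith [le_abs_self C]) (norm_nonneg _))
  set D := |C| + 1 with hD
  have hD0 : 0 < D := by positivity
  have hlo := hasFDerivAt_iff_isLittleO.1 hf
  -- The Lipschitz bound for `g` reads `‖x' - x‖ ≤ D ‖f x' - f x‖`; a linearisation error of at most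
  -- `‖x' - x‖ / (2D)` is absorbed on the left, and homogeneity passes from small vectors to all.
  have hanti : ∀ v, ‖v‖ ≤ 2 * D * ‖f' v‖ := by
    have h1 : ∀ᶠ x' in 𝓝 x, ‖x' - x‖ ≤ 2 * D * ‖f' (x' - x)‖ := by
      have h2 := hlo.def (c := 1 / (2 * D)) (by positivity)
      filter_upwards [hgf, hf.continuousAt.eventually hC, h2] with x' a1 a2 a3
      rw [a1] at a2
      have a4 : ‖f x' - f x‖ ≤ ‖f x' - f x - f' (x' - x)‖ + ‖f' (x' - x)‖ := by
        simpa using norm_add_le (f x' - f x - f' (x' - x)) (f' (x' - x))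
      have a5 : D * ‖f x' - f x‖ ≤ D * (1 / (2 * D) * ‖x' - x‖ + ‖f' (x' - x)‖) :=
        mul_le_mul_of_nonneg_left (by linarith) hD0.le
      have a6 : D * (1 / (2 * D) * ‖x' - x‖) = ‖x' - x‖ / 2 := by field_simp
      rw [mul_add, a6] at a5
      linarith
    obtain ⟨ρ, hρ, hball⟩ := Metric.eventually_nhds_iff.1 h1
    intro v
    rcases eq_or_ne v 0 with rfl | hv
    · simp
    have hv' : 0 < ‖v‖ := norm_pos_iff.2 hv
    set s : ℝ := ρ / (2 * ‖v‖) with hs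
    have hs0 : 0 < s := by positivity
    have hns : ‖((s : 𝕜) • v)‖ = s * ‖v‖ := by
      rw [norm_smul, RCLike.norm_of_nonneg hs0.le]
    have := hball (y := x + (s : 𝕜) • v) (by
      rw [dist_eq_norm, add_sub_cancel_left, hns, hs]
      field_simp
      linarith)
    rw [add_sub_cancel_left, map_smul, norm_smul, norm_smul, RCLike.norm_of_nonneg hs0.le] at this
    have h3 : s * ‖v‖ ≤ s * (2 * D * ‖f' v‖) := by linarith
    exact le_of_mul_le_mul_left h3 hs0
  have hAL : AntilipschitzWith ⟨2 * D, by positivity⟩ f' :=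
    AddMonoidHomClass.antilipschitz_of_bound f' hanti
  have hclosed : IsClosed (Set.range f') := hAL.isClosed_range f'.uniformContinuous
  -- In infinite dimension the lower bound does not give surjectivity. The preimage of `f x + s v`,
  -- recentred at `x` and divided by `s`, is sent by `f'` close to `v`; the closed range then
  -- contains `v`.
  have hdense : ∀ v, v ∈ closure (Set.range f') := by
    intro v
    rw [Metric.mem_closure_range_iff]
    intro c hc
    rcases eq_or_ne v 0 with rfl | hv
    · exact ⟨0, by simpa using hc⟩
    have hv' : 0 < ‖v‖ := norm_pos_iff.2 hv
    have hgc : Tendsto g (𝓝 (f x)) (𝓝 x) := by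
      rw [tendsto_iff_norm_sub_tendsto_zero]
      have : Tendsto (fun u => D * ‖u - f x‖) (𝓝 (f x)) (𝓝 0) := by
        have : Continuous fun u => D * ‖u - f x‖ := by fun_prop
        simpa using this.tendsto (f x)
      exact squeeze_zero' (Eventually.of_forall fun _ => norm_nonneg _) hC this
    have h2 := hgc.eventually (hlo.def (c := c / (2 * D * ‖v‖)) (by positivity))
    obtain ⟨ρ, hρ, hball⟩ := Metric.eventually_nhds_iff.1 (h2.and (hfg.and hC))
    set s : ℝ := ρ / (2 * ‖v‖) with hs
    have hs0 : 0 < s := by positivity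
    have hns : ‖((s : 𝕜) • v)‖ = s * ‖v‖ := by
      rw [norm_smul, RCLike.norm_of_nonneg hs0.le]
    obtain ⟨b1, b2, b3⟩ := hball (y := f x + (s : 𝕜) • v) (by
      rw [dist_eq_norm, add_sub_cancel_left, hns, hs]
      field_simp
      linarith)
    rw [b2, add_sub_cancel_left] at b1
    rw [add_sub_cancel_left, hns] at b3
    have hsne : (s : 𝕜) ≠ 0 := by exact_mod_cast hs0.ne'
    refine ⟨(s : 𝕜)⁻¹ • (g (f x + (s : 𝕜) • v) - x), ?_⟩
    rw [dist_eq_norm]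
    have e : v - f' ((s : 𝕜)⁻¹ • (g (f x + (s : 𝕜) • v) - x)) =
        (s : 𝕜)⁻¹ • ((s : 𝕜) • v - f' (g (f x + (s : 𝕜) • v) - x)) := by
      rw [smul_sub (s : 𝕜)⁻¹ ((s : 𝕜) • v), smul_smul, inv_mul_cancel₀ hsne, one_smul, map_smul]
    rw [e, norm_smul, norm_inv, RCLike.norm_of_nonneg hs0.le]
    have b4 : ‖(s : 𝕜) • v - f' (g (f x + (s : 𝕜) • v) - x)‖ ≤ s * (c / 2) := by
      refine b1.trans ((mul_le_mul_of_nonneg_left b3 (by positivity)).trans (le_of_eq ?_))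
      field_simp
    calc s⁻¹ * ‖(s : 𝕜) • v - f' (g (f x + (s : 𝕜) • v) - x)‖ ≤ s⁻¹ * (s * (c / 2)) :=
          mul_le_mul_of_nonneg_left b4 (by positivity)
      _ = c / 2 := by field_simp
      _ < c := by linarith
  refine ⟨ContinuousLinearEquiv.ofBijective f' ?_ ?_, ?_⟩
  · exact LinearMap.ker_eq_bot.2 hAL.injective
  · refine LinearMap.range_eq_top.2 fun v => ?_
    have := hdense v
    rw [hclosed.closure_eq] at this
    exact this
  · ext; rfl

/-- The inverse of an injective analytic map is analytic near `f x` as soon as it is defined in a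
neighbourhood of `f x` and Lipschitz at `f x`. -/
theorem analyticAt_invFunOn {f : E → E} {U : Set E} {x : E} {C ρ : ℝ} (hU : IsOpen U)
    (hinj : InjOn f U) (hx : x ∈ U) (hf : AnalyticAt 𝕜 f x) (hρ : 0 < ρ)
    (hinv : ∀ u, ‖u - f x‖ < ρ → ∃ x' ∈ U, f x' = u ∧ ‖x' - x‖ ≤ C * ‖u - f x‖) :
    AnalyticAt 𝕜 (Function.invFunOn f U) (f x) := by
  have hleft : ∀ x' ∈ U, Function.invFunOn f U (f x') = x' := fun x' h => hinj.leftInvOn_invFunOn h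
  have hnear : ∀ᶠ u in 𝓝 (f x), ‖u - f x‖ < ρ := by
    rw [Metric.eventually_nhds_iff]
    exact ⟨ρ, hρ, fun u hu => by rwa [dist_eq_norm] at hu⟩
  obtain ⟨e, he⟩ := exists_equiv_of_lipschitz_inverse (g := Function.invFunOn f U) (C := C)
    hf.differentiableAt.hasFDerivAt
    ((hU.eventually_mem hx).mono hleft)
    (hnear.mono fun u hu => by
      obtain ⟨x', h1, h2, -⟩ := hinv u hu
      rw [← h2, hleft x' h1])
    (hnear.mono fun u hu => by
      obtain ⟨x', h1, h2, h3⟩ := hinv u hu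
      rw [← h2, hleft x' h1, h2]
      exact h3)
  have hs : HasStrictFDerivAt f (e : E →L[𝕜] E) x := by
    rw [he]; exact hf.hasStrictFDerivAt
  have hR := (hs.toOpenPartialHomeomorph f).analyticAt_symm' (a := x) (i := e)
    hs.mem_toOpenPartialHomeomorph_source hf (by simp [he])
  refine hR.congr ?_
  -- Near `f x` the local inverse takes its values in `U`, where injectivity of `f` identifies it
  -- with `invFunOn`.
  have h1 : ∀ᶠ u in 𝓝 (f x), hs.localInverse f e x u ∈ U :=
    hs.localInverse_tendsto (hU.mem_nhds hx)
  filter_upwards [h1, hs.eventually_right_inverse] with u hu hu'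
  have := hleft _ hu
  rw [hu'] at this
  exact this.symm

end InverseFunction

/-! ### Injectivity and local preimages -/

section LocalInverse

variable {𝕜 : Type} [RCLike 𝕜]

/-- A domain of injectivity of the tube map. -/
def tubeDom (𝕜 : Type) [RCLike 𝕜] (r δ : ℝ) : Set (BddSeq 𝕜) :=
  {x | -(2 * r) ≤ RCLike.re (x 0) ∧ (∀ n, 1 ≤ n → |RCLike.re (x n)| ≤ 2 * r) ∧
    ∀ n, |RCLike.im (x n)| ≤ δ / 100}

namespace Profile

variable {r δ η K : ℝ} {γ A B : ℕ → 𝕜 → 𝕜} {g a b : ℕ → ℝ → ℝ}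

/-- Charts exist only for times `t ≥ 0`, while the tube begins slightly earlier; this is the cost of
truncating the time at `0`. -/
theorem abs_sub_max_le (h : Profile 𝕜 r δ η K γ A B g a b) {x : BddSeq 𝕜}
    (hx : x ∈ tubeDom 𝕜 r δ) : |RCLike.re (x 0) - max (RCLike.re (x 0)) 0| ≤ 2 * r := by
  have := hx.1
  have := h.r_pos
  rcases le_total 0 (RCLike.re (x 0)) with h0 | h0
  · rw [max_eq_left h0, sub_self, abs_zero]; linarith
  · rw [max_eq_right h0, sub_zero, abs_of_nonpos h0]; linarith

/-- The inverse of the tube map near the image of a point, read in a chart. -/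
theorem exists_local_inverse (h : Profile 𝕜 r δ η K γ A B g a b) {x : BddSeq 𝕜}
    (hx : x ∈ tubeDom 𝕜 r δ) {t : ℝ} (ht : t = max (RCLike.re (x 0)) 0) :
    ∃ y ∈ chartDom 𝕜 r δ t, segChart γ a b t y = x ∧
      (∀ n, ‖tubeMap γ A B x n - (stair n t : 𝕜)‖ ≤ 17 * r) ∧
      ∀ u, ‖u - tubeMap γ A B x‖ ≤ δ / 4 → ∃ p ∈ chartDom 𝕜 r δ t,
        tubeMap γ A B (segChart γ a b t p) = u ∧
          ‖p - y‖ ≤ (1 + 100 * η) * ‖u - tubeMap γ A B x‖ := by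
  have hr := h.r_pos
  have hδ := h.δ_pos
  have hη := h.η_pos
  have hη1 := h.η_le
  have ht0 : 0 ≤ t := ht ▸ le_max_right _ _
  obtain ⟨y, hy, hyx, hn⟩ := h.exists_chart_point ht0 (ρ := 2 * r) (by linarith)
    (by rw [ht]; exact h.abs_sub_max_le hx) hx.2.2 hx.2.1
  have hG : readMap γ A B a b t y = tubeMap γ A B x := by rw [readMap, hyx]
  refine ⟨y, hy, hyx, fun n => ?_, fun u hu => ?_⟩
  · have e1 := BddSeq.sub_apply_le (readMap γ A B a b t y) y n
    rw [hG] at e1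
    have e2 := h.readMap_near ht0 hy
    rw [hG] at e2
    have := norm_sub_le_norm_sub_add_norm_sub (tubeMap γ A B x n) (y n) (stair n t : 𝕜)
    linarith [(hn n).1]
  · have hball : ∀ p : BddSeq 𝕜, ‖p - y‖ ≤ δ / 2 → p ∈ chartDom 𝕜 r δ t := by
      intro p hp n
      have e1 := (BddSeq.sub_apply_le p y n).trans hp
      have e2 := norm_sub_le_norm_sub_add_norm_sub (p n) (y n) (stair n t : 𝕜)
      have e3 := abs_re_sub_le (p n) (stair n t)
      have e4 := (RCLike.abs_im_le_norm (p n - y n)).trans e1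
      rw [map_sub] at e4
      constructor
      · linarith [(hn n).1, h.δ_le_r]
      · have e5 := abs_add_le (RCLike.im (p n) - RCLike.im (y n)) (RCLike.im (y n))
        rw [sub_add_cancel] at e5
        linarith [(hn n).2]
    have hn0 := norm_nonneg (u - tubeMap γ A B x)
    have hsq : (1 + 100 * η) * ‖u - tubeMap γ A B x‖ ≤ δ / 2 := by
      have : (1 + 100 * η) * ‖u - tubeMap γ A B x‖ ≤ 2 * ‖u - tubeMap γ A B x‖ :=
        mul_le_mul_of_nonneg_right (by linarith) hn0
      linarith
    -- The radius is admissible because `(1 - 31 η)(1 + 100 η) ≥ 1` for `η ≤ 10⁻⁶`.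
    obtain ⟨p, hp, hpu⟩ := exists_eq_of_contraction (𝕜 := 𝕜) (f := readMap γ A B a b t)
      (s := chartDom 𝕜 r δ t)
      (c := 31 * η) (ρ := (1 + 100 * η) * ‖u - tubeMap γ A B x‖) (y := y) (u := u)
      (by positivity) (by positivity)
      (fun p hp => hball p (by
        rw [Metric.mem_closedBall, dist_eq_norm] at hp
        exact hp.trans hsq))
      (h.readMap_contraction ht0) (by
        rw [hG, ← mul_assoc]
        refine le_mul_of_one_le_left hn0 ?_
        nlinarith)
    exact ⟨p, hball p (hp.trans hsq), hpu, hp⟩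

/-- The tube map is injective. -/
theorem injOn_tubeMap (h : Profile 𝕜 r δ η K γ A B g a b) :
    InjOn (tubeMap γ A B) (tubeDom 𝕜 r δ) := by
  intro x hx x' hx' hxx'
  have hr := h.r_pos
  have hr1 := h.r_le
  set t := max (RCLike.re (x 0)) 0 with ht
  set t' := max (RCLike.re (x' 0)) 0 with ht'
  obtain ⟨y, hy, hyx, hn, -⟩ := h.exists_local_inverse hx ht
  obtain ⟨y', hy', hyx', hn', -⟩ := h.exists_local_inverse hx' ht'
  have hs : ∀ n, |stair n t - stair n t'| ≤ 34 * r := by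
    intro n
    have e1 := hn n
    have e2 := hn' n
    rw [← hxx'] at e2
    rw [norm_sub_rev] at e1
    have e3 := norm_sub_le_norm_sub_add_norm_sub (stair n t : 𝕜) (tubeMap γ A B x n)
      (stair n t' : 𝕜)
    rw [← RCLike.ofReal_sub, RCLike.norm_ofReal] at e3
    linarith
  -- The times differ by at most `68 r`, so the time of `x'` is within `70 r` of `t`. This is less
  -- than the `100 r` covered by a chart: both points can be read in the chart at `t`, where the
  -- contraction estimate separates them.
  have htt := stair_sep (le_max_right _ _) (le_max_right _ _) (by linarith) hs
  have e1 := h.abs_sub_max_le hx'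
  obtain ⟨y', hy', hyx', -⟩ := h.exists_chart_point (x := x') (t := t) (le_max_right _ _)
    (ρ := 100 * r) le_rfl (by
      rw [← ht'] at e1
      have := abs_sub_le (RCLike.re (x' 0)) t' t
      rw [abs_sub_comm t' t] at this
      linarith) hx'.2.2 hx'.2.1
  have hc := h.readMap_contraction (le_max_right _ _) y hy y' hy'
  have e2 : readMap γ A B a b t y = readMap γ A B a b t y' := by
    rw [readMap, readMap, hyx, hyx', hxx']
  rw [e2, sub_sub_sub_cancel_left, norm_sub_rev] at hc
  have h0 : ‖y - y'‖ ≤ 0 := by nlinarith [norm_nonneg (y - y'), h.η_le, h.η_pos]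
  have : y = y' := by simpa [sub_eq_zero] using h0
  rw [← hyx, ← hyx', this]

/-- Points near the image of a point of the tube have preimages near that point. -/
theorem exists_preimage_near (h : Profile 𝕜 r δ η K γ A B g a b) {x : BddSeq 𝕜}
    (hx : x ∈ tubeDom 𝕜 r δ) {u : BddSeq 𝕜} (hu : ‖u - tubeMap γ A B x‖ ≤ δ / 4) :
    ∃ x', tubeMap γ A B x' = u ∧ ‖x' - x‖ ≤ 10 * ‖u - tubeMap γ A B x‖ := by
  obtain ⟨y, hy, hyx, -, hp⟩ := h.exists_local_inverse hx rfl
  obtain ⟨p, hp, hpu, hpy⟩ := hp u hu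
  refine ⟨_, hpu, ?_⟩
  have := h.segChart_lip (le_max_right _ _) hp hy
  rw [hyx] at this
  nlinarith [norm_nonneg (u - tubeMap γ A B x), h.η_le]

end Profile

end LocalInverse

/-! ### Sharp constants over the reals, and the image of the straight tube -/

section RealTube

/-- Further properties of the real functions which define a twisted tube. -/
structure RealProfile (r η : ℝ) (g a b : ℕ → ℝ → ℝ) : Prop where
  g_mono : ∀ (n : ℕ) (t u : ℝ), t ≤ u → 0 ≤ g n u - g n t ∧ g n u - g n t ≤ u - t
  g_late : ∀ (n : ℕ) (t u : ℝ), (n : ℝ) + 1 + 1 / 4 ≤ t → (n : ℝ) + 1 + 1 / 4 ≤ u →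
    |g n t - g n u| ≤ η * |t - u|
  g_early : ∀ (n : ℕ) (t u : ℝ), 1 ≤ n → t ≤ (n : ℝ) - 1 / 4 → u ≤ (n : ℝ) - 1 / 4 → |g n t - g n u| ≤ η * |t - u|
  a_late : ∀ (n : ℕ) (t : ℝ), (n : ℝ) + 1 / 2 ≤ t → a n t ≤ η
  b_early : ∀ (n : ℕ) (t : ℝ), t ≤ (n : ℝ) + 1 / 2 → b n t ≤ η
  a_near : ∀ (n : ℕ) (t : ℝ), 1 ≤ n → t ≤ n + 2 * r → 1 - η ≤ a n t
  b_near : ∀ (n : ℕ) (t : ℝ), (n : ℝ) + 1 - 2 * r ≤ t → 1 - η ≤ b n t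

variable {r δ η K : ℝ} {γ A B : ℕ → ℝ → ℝ} {g a b : ℕ → ℝ → ℝ}

/-- Writing the increment of `g n` as a slope times the increment of time allows it to be combined
with the coordinates that make up the time, so that their cancellations are not lost to a triangle
inequality. -/
theorem RealProfile.exists_slope (h : RealProfile r η g a b) (n : ℕ) (t u : ℝ) :
    ∃ q, 0 ≤ q ∧ q ≤ 1 ∧ g n t - g n u = q * (t - u) ∧
      (|g n t - g n u| ≤ η * |t - u| → t ≠ u → q ≤ η) := by
  rcases eq_or_ne t u with rfl | htu
  · exact ⟨0, le_rfl, zero_le_one, by simp, fun _ h => absurd rfl h⟩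
  have hne : t - u ≠ 0 := sub_ne_zero.2 htu
  have hq0 : 0 ≤ (g n t - g n u) / (t - u) := by
    rcases le_total t u with h1 | h1
    · exact div_nonneg_of_nonpos (by linarith [(h.g_mono n t u h1).1]) (by linarith)
    · exact div_nonneg (h.g_mono n u t h1).1 (by linarith)
  refine ⟨(g n t - g n u) / (t - u), hq0, ?_, (div_mul_cancel₀ _ hne).symm, fun h1 _ => ?_⟩
  · rcases le_total t u with h1 | h1
    · rw [div_le_one_of_neg (lt_of_le_of_ne (by linarith) hne)]
      linarith [(h.g_mono n t u h1).2]
    · rw [div_le_one (lt_of_le_of_ne (by linarith) hne.symm)]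
      exact (h.g_mono n u t h1).2
  · rw [← abs_of_nonneg hq0, abs_div, div_le_iff₀ (abs_pos.2 hne)]
    exact h1

theorem abs_lin_le {q s a b M u v w : ℝ} (hM : 0 ≤ M) (hu : |u| ≤ M) (hv : |v| ≤ M) (hw : |w| ≤ M)
    (hc : |q| + |a| + |b| ≤ s) : |q * u + a * v + b * w| ≤ s * M := by
  refine (abs_add_three _ _ _).trans ?_
  rw [abs_mul, abs_mul, abs_mul]
  have := mul_le_mul_of_nonneg_left hu (abs_nonneg q)
  have := mul_le_mul_of_nonneg_left hv (abs_nonneg a)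
  have := mul_le_mul_of_nonneg_left hw (abs_nonneg b)
  have := mul_le_mul_of_nonneg_right hc hM
  linarith

namespace Profile

/-- The sharp Lipschitz estimate for the charts over the reals. -/
theorem segChart_lip_real (h : Profile ℝ r δ η K γ A B g a b) (h' : RealProfile r η g a b) {t : ℝ}
    (ht : 0 ≤ t) {y p : BddSeq ℝ} (hy : y ∈ chartDom ℝ r δ t) (hp : p ∈ chartDom ℝ r δ t) :
    ‖segChart γ a b t p - segChart γ a b t y‖ ≤ (2 + 5 * η) * ‖p - y‖ := by
  have hη := h.η_pos
  have hr := h.r_pos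
  have hr1 := h.r_le
  set M := ‖p - y‖ with hM
  have hM0 : 0 ≤ M := norm_nonneg _
  set k := ⌊t⌋₊ with hk
  have hk0 : (k : ℝ) ≤ t := Nat.floor_le ht
  have hk1 : t < k + 1 := Nat.lt_floor_add_one t
  have hΔ : ∀ n, |p n - y n| ≤ M := fun n => BddSeq.sub_apply_le p y n
  have ha := h.a_nonneg k t
  have hb := h.b_nonneg k t
  have hab := h.ab_le k t
  have hT := (abs_le.1 (h.segTime_bounds ht hy).1)
  have hT' := (abs_le.1 (h.segTime_bounds ht hp).1)
  simp only [RCLike.re_to_real] at hT hT'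
  set T := segTime a b t y with hTdef
  set T' := segTime a b t p with hTdef'
  have eT : T' - T = (p k - y k) + a k t * (p (k - 1) - y (k - 1))
      + b k t * (p (k + 1) - y (k + 1)) := by
    simp only [hTdef, hTdef', segTime, chartTime, RCLike.ofReal_real_eq_id, id]; ring
  have hTT : |T' - T| ≤ 2 * M := h.segTime_lip_two t p y
  have hγ : ∀ n s, γ n s = g n s := fun n s => by simpa using h.γ_real n s
  have far : ∀ n, |g n T' - g n T| ≤ η * |T' - T| →
      |g n T' - g n T| + |p n - y n| ≤ (2 + 5 * η) * M := fun n hn => by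
    have := mul_le_mul_of_nonneg_left hTT hη.le
    have := mul_nonneg hη.le hM0
    linarith [hΔ n]
  refine BddSeq.norm_sub_le (by positivity) fun j => ?_
  rw [h.segChart_apply, h.segChart_apply]
  by_cases hj : j = 0
  · rw [if_pos hj, if_pos hj]
    have := mul_nonneg hη.le hM0
    refine hTT.trans (by linarith)
  rw [if_neg hj, if_neg hj]
  unfold segSide chartSide
  rw [if_neg hj, if_neg hj]
  change |(if j ≤ k then γ (j - 1) T' - p (j - 1) else p j - γ j T')
    - (if j ≤ k then γ (j - 1) T - y (j - 1) else y j - γ j T)| ≤ _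
  rcases lt_trichotomy j k with h1 | h1 | h1
  · have hjk : ((j - 1 : ℕ) : ℝ) + 1 + 1 ≤ k := by
      exact_mod_cast (show j - 1 + 1 + 1 ≤ k by omega)
    rw [if_pos h1.le, if_pos h1.le, hγ, hγ, sub_sub_sub_comm]
    exact (abs_sub _ _).trans
      (far _ (h'.g_late _ _ _ (by linarith [hT'.1]) (by linarith [hT.1])))
  · rw [if_pos h1.le, if_pos h1.le, hγ, hγ, sub_sub_sub_comm, h1]
    obtain ⟨q, hq0, hq1, hq, hqη⟩ := h'.exists_slope (k - 1) T' T
    rcases eq_or_ne T' T with hTe | hTe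
    · rw [hTe, sub_self, zero_sub, abs_neg]
      have := mul_nonneg hη.le hM0
      linarith [hΔ (k - 1)]
    -- The coefficients of the three coordinate increments have absolute sum `q + (1 - q a) + q b =
    -- 1 + q (1 - a + b)`. In the first half of the segment `b ≤ η`; in the second half step `k - 1`
    -- is over and `q ≤ η`. A plain triangle inequality would give the constant `3`.
    have hcoef : q * (1 - a k t + b k t) ≤ 1 + 5 * η := by
      rcases le_total t (k + 1 / 2) with h2 | h2
      · have := h'.b_early k t h2
        nlinarith
      · have hjk : ((k - 1 : ℕ) : ℝ) + 1 = k := by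
          exact_mod_cast (show k - 1 + 1 = k by omega)
        have := hqη (h'.g_late _ _ _ (by linarith [hT'.1]) (by linarith [hT.1])) hTe
        nlinarith [h.b_le_one k t]
    have e : g (k - 1) T' - g (k - 1) T - (p (k - 1) - y (k - 1)) =
        q * (p k - y k) + (q * a k t - 1) * (p (k - 1) - y (k - 1))
          + (q * b k t) * (p (k + 1) - y (k + 1)) := by
      rw [hq, eT]; ring
    rw [e]
    refine abs_lin_le hM0 (hΔ _) (hΔ _) (hΔ _) ?_
    have : q * a k t ≤ 1 := mul_le_one₀ hq1 ha (h.a_le_one k t)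
    rw [abs_of_nonneg hq0, abs_of_nonpos (by linarith), abs_of_nonneg (by positivity)]
    linarith
  · rw [if_neg (by omega), if_neg (by omega), hγ, hγ, sub_sub_sub_comm]
    rcases Nat.eq_or_lt_of_le (Nat.succ_le_of_lt h1) with h2 | h2
    · have h2 : j = k + 1 := h2.symm
      rw [h2]
      obtain ⟨q, hq0, hq1, hq, hqη⟩ := h'.exists_slope (k + 1) T' T
      rcases eq_or_ne T' T with hTe | hTe
      · rw [hTe, sub_self, sub_zero]
        have := mul_nonneg hη.le hM0
        linarith [hΔ (k + 1)]
      -- The mirror case: `a ≤ η` in the second half of the segment, and in the first half step `k +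
      -- 1` has not begun, so `q ≤ η`.
      have hcoef : q * (1 + a k t - b k t) ≤ 1 + 5 * η := by
        rcases le_total ((k : ℝ) + 1 / 2) t with h2 | h2
        · have := h'.a_late k t h2
          nlinarith
        · have := hqη (h'.g_early _ _ _ (by omega) (by push_cast; linarith [hT'.2])
            (by push_cast; linarith [hT.2])) hTe
          nlinarith [h.a_le_one k t]
      have e : p (k + 1) - y (k + 1) - (g (k + 1) T' - g (k + 1) T) =
          (-q) * (p k - y k) + (-(q * a k t)) * (p (k - 1) - y (k - 1))
            + (1 - q * b k t) * (p (k + 1) - y (k + 1)) := by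
        rw [hq, eT]; ring
      rw [e]
      refine abs_lin_le hM0 (hΔ _) (hΔ _) (hΔ _) ?_
      have : q * b k t ≤ 1 := mul_le_one₀ hq1 hb (h.b_le_one k t)
      rw [abs_neg, abs_neg, abs_of_nonneg hq0, abs_of_nonneg (show 0 ≤ q * a k t by positivity),
        abs_of_nonneg (by linarith)]
      linarith
    · have hjk : (k : ℝ) + 1 + 1 ≤ j := by exact_mod_cast h2
      refine (abs_sub _ _).trans ?_
      rw [add_comm]
      exact far _ (h'.g_early _ _ _ (by omega) (by linarith [hT'.2]) (by linarith [hT.2]))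

/-- The sharp Lipschitz estimates at a point for the inverse of the real tube map. -/
theorem exists_preimage_real (h : Profile ℝ r δ η K γ A B g a b) (h' : RealProfile r η g a b)
    {x : BddSeq ℝ} (hx : x ∈ tubeDom ℝ r δ) {u : BddSeq ℝ}
    (hu : ‖u - tubeMap γ A B x‖ ≤ δ / 4) {t : ℝ} (ht : t = max (x 0) 0) :
    ∃ x', tubeMap γ A B x' = u ∧
      ‖x' - x‖ ≤ (2 + 5 * η) * (1 + 100 * η) * ‖u - tubeMap γ A B x‖ ∧
      |x' 0 - x 0| ≤ (1 + a ⌊t⌋₊ t + b ⌊t⌋₊ t) * (1 + 100 * η) * ‖u - tubeMap γ A B x‖ := by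
  obtain ⟨y, hy, hyx, -, hp⟩ := h.exists_local_inverse (t := t) hx ht
  obtain ⟨p, hp, hpu, hpy⟩ := hp u hu
  have ht0 : 0 ≤ t := ht ▸ le_max_right _ _
  have hη := h.η_pos
  refine ⟨_, hpu, ?_, ?_⟩
  · rw [mul_assoc]
    have := h.segChart_lip_real h' ht0 hy hp
    rw [hyx] at this
    exact this.trans (mul_le_mul_of_nonneg_left hpy (by positivity))
  · have e1 : segChart γ a b t p 0 = segTime a b t p := by rw [h.segChart_apply, if_pos rfl]
    have e2 : x 0 = segTime a b t y := by rw [← hyx, h.segChart_apply, if_pos rfl]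
    rw [e1, e2, mul_assoc]
    exact (h.segTime_lip t p y).trans (mul_le_mul_of_nonneg_left hpy
      (by linarith [h.a_nonneg ⌊t⌋₊ t, h.b_nonneg ⌊t⌋₊ t]))

theorem γ_eq (h : Profile ℝ r δ η K γ A B g a b) (n : ℕ) (t : ℝ) : γ n t = g n t := by
  simpa using h.γ_real n t

theorem A_eq (h : Profile ℝ r δ η K γ A B g a b) (n : ℕ) (t : ℝ) : A n t = a n t := by
  simpa using h.A_real n t

theorem B_eq (h : Profile ℝ r δ η K γ A B g a b) (n : ℕ) (t : ℝ) : B n t = b n t := by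
  simpa using h.B_real n t

theorem straightTube_subset (h : Profile ℝ r δ η K γ A B g a b) :
    straightTube r ⊆ tubeDom ℝ r δ := by
  intro x hx
  have hr := h.r_pos
  refine ⟨?_, fun n hn => ?_, fun n => ?_⟩
  · have := hx.1
    simp only [RCLike.re_to_real]
    linarith
  · have := hx.2 n hn
    simp only [RCLike.re_to_real]
    linarith
  · simpa using by linarith [h.δ_pos]

/-- The image of the straight tube is close to the staircase path. -/
theorem tubeMap_near_stair (h : Profile ℝ r δ η K γ A B g a b) (h' : RealProfile r η g a b)
    {x : BddSeq ℝ} (hx : x ∈ straightTube r) (n : ℕ) :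
    |tubeMap γ A B x n - stair n (max (x 0) 0)| ≤ 3 / 2 * r := by
  have hr := h.r_pos
  have hηr := h.ηr_le
  have hη := h.η_pos
  rw [h.tubeMap_apply, h.γ_eq, h.A_eq, h.B_eq]
  have hx0 := hx.1
  have e1 := h.g_near n (x 0) (by linarith [h.r_le])
  have hxs := (hx.2 (n + 1) (by omega)).le
  have e2 : |a n (x 0) * x n| ≤ a n (x 0) * r := by
    rcases Nat.eq_zero_or_pos n with h0 | h0
    · simp [h.coef_zero h0]
    · rw [abs_mul, abs_of_nonneg (h.a_nonneg _ _)]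
      exact mul_le_mul_of_nonneg_left (hx.2 n h0).le (h.a_nonneg _ _)
  have e3 : |b n (x 0) * x (n + 1)| ≤ b n (x 0) * r := by
    rw [abs_mul, abs_of_nonneg (h.b_nonneg _ _)]
    exact mul_le_mul_of_nonneg_left hxs (h.b_nonneg _ _)
  -- At negative times only coordinate `0` of the path has moved, by less than `r`. There `a = 0`
  -- and `b ≤ η`, so this displacement and the transverse one never add up.
  have e4 : |stair n (x 0) - stair n (max (x 0) 0)| + a n (x 0) * r + b n (x 0) * r ≤
      r + η * r := by
    have e5 := mul_le_mul_of_nonneg_right (h.ab_le n (x 0)) hr.le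
    rcases le_total 0 (x 0) with h1 | h1
    · rw [max_eq_left h1, sub_self, abs_zero]
      have := mul_nonneg hη.le hr.le
      linarith
    · rw [max_eq_right h1]
      rcases Nat.eq_zero_or_pos n with h0 | h0
      · have e6 := stair_lip n (x 0) 0
        rw [sub_zero, abs_of_nonpos h1] at e6
        have e7 := h'.b_early n (x 0) (by linarith [(n.cast_nonneg : (0 : ℝ) ≤ n)])
        have e8 := mul_le_mul_of_nonneg_right e7 hr.le
        rw [h.coef_zero h0]
        linarith
      · have e6 : ∀ s : ℝ, s ≤ 0 → stair n s = 0 := fun s hs =>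
          stair_gt (by rw [Nat.floor_of_nonpos hs]; exact h0)
        rw [e6 _ h1, e6 _ le_rfl, sub_self, abs_zero]
        have := mul_nonneg hη.le hr.le
        linarith
  have e9 : g n (x 0) + a n (x 0) * x n - b n (x 0) * x (n + 1) - stair n (max (x 0) 0)
      = (g n (x 0) - stair n (x 0)) + (stair n (x 0) - stair n (max (x 0) 0)) +
        (a n (x 0) * x n - b n (x 0) * x (n + 1)) := by ring
  rw [e9]
  refine (abs_add_three _ _ _).trans ?_
  have := abs_sub (a n (x 0) * x n) (b n (x 0) * x (n + 1))
  linarith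

/-- The tube map is Lipschitz at the points of the straight tube. -/
theorem tubeMap_lip (h : Profile ℝ r δ η K γ A B g a b) (h' : RealProfile r η g a b)
    {x : BddSeq ℝ} (hx : x ∈ straightTube r) (x' : BddSeq ℝ) :
    ‖tubeMap γ A B x' - tubeMap γ A B x‖ ≤ (2 + η) * ‖x' - x‖ := by
  have hr := h.r_pos
  have hη := h.η_pos
  set M := ‖x' - x‖ with hM
  have hM0 : 0 ≤ M := norm_nonneg _
  have hΔ : ∀ n, |x' n - x n| ≤ M := fun n => BddSeq.sub_apply_le x' x n
  have hK : K * M * r ≤ η / 24000 * M := by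
    have := mul_le_mul_of_nonneg_right h.K_le hM0
    linarith
  refine BddSeq.norm_sub_le (by positivity) fun n => ?_
  rw [h.tubeMap_apply, h.tubeMap_apply]
  have e1 : |γ n (x' 0) - γ n (x 0)| ≤ M := by
    obtain ⟨q, hq0, hq1, hq, -⟩ := h'.exists_slope n (x' 0) (x 0)
    rw [h.γ_eq, h.γ_eq, hq, abs_mul, abs_of_nonneg hq0]
    exact (mul_le_of_le_one_left (abs_nonneg _) hq1).trans (hΔ 0)
  have him : ∀ s : ℝ, |RCLike.im s| ≤ 3 * δ := fun s => by simp [h.δ_pos.le]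
  have side : ∀ (c : ℝ → ℝ) (m : ℕ), (1 ≤ m) → |c (x' 0) - c (x 0)| ≤ K * ‖x' 0 - x 0‖ →
      |c (x' 0) * x' m - c (x 0) * x m| ≤ |c (x' 0)| * M + η / 24000 * M := by
    intro c m hm hc
    have e : c (x' 0) * x' m - c (x 0) * x m
      = c (x' 0) * (x' m - x m) + (c (x' 0) - c (x 0)) * x m := by ring
    rw [e]
    refine (abs_add_le _ _).trans ?_
    rw [abs_mul, abs_mul]
    refine add_le_add (mul_le_mul_of_nonneg_left (hΔ m) (abs_nonneg _)) (le_trans ?_ hK)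
    exact mul_le_mul (hc.trans (mul_le_mul_of_nonneg_left (hΔ 0) h.K_nonneg)) (hx.2 m hm).le
      (abs_nonneg _) (mul_nonneg h.K_nonneg hM0)
  have e2 : |A n (x' 0) * x' n - A n (x 0) * x n| ≤ a n (x' 0) * M + η / 24000 * M := by
    rcases Nat.eq_zero_or_pos n with h0 | h0
    · subst h0
      rw [h.A_zero, h.A_zero, zero_mul, zero_mul, sub_zero, abs_zero]
      have := h.a_nonneg 0 (x' 0)
      positivity
    · have := side (A n) n h0 (h.A_lip n _ _ (him _) (him _))
      rwa [show |A n (x' 0)| = a n (x' 0) by rw [h.A_eq, abs_of_nonneg (h.a_nonneg _ _)]] at this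
  have e3 : |B n (x' 0) * x' (n + 1) - B n (x 0) * x (n + 1)| ≤ b n (x' 0) * M + η / 24000 * M := by
    have := side (B n) (n + 1) (by omega) (h.B_lip n _ _ (him _) (him _))
    rwa [show |B n (x' 0)| = b n (x' 0) by rw [h.B_eq, abs_of_nonneg (h.b_nonneg _ _)]] at this
  have e4 := mul_le_mul_of_nonneg_right (h.ab_le n (x' 0)) hM0
  have e : γ n (x' 0) + A n (x' 0) * x' n - B n (x' 0) * x' (n + 1)
      - (γ n (x 0) + A n (x 0) * x n - B n (x 0) * x (n + 1))
      = (γ n (x' 0) - γ n (x 0)) + (A n (x' 0) * x' n - A n (x 0) * x n)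
        - (B n (x' 0) * x' (n + 1) - B n (x 0) * x (n + 1)) := by ring
  rw [e]
  refine (abs_sub _ _).trans ?_
  have := abs_add_le (γ n (x' 0) - γ n (x 0)) (A n (x' 0) * x' n - A n (x 0) * x n)
  have := mul_nonneg hη.le hM0
  linarith

/-- Points near the staircase path are images of points of the straight tube. -/
theorem exists_mem_straightTube (h : Profile ℝ r δ η K γ A B g a b) (h' : RealProfile r η g a b)
    {t : ℝ} (ht : 0 ≤ t) {u : BddSeq ℝ} (hu : ∀ n, |u n - stair n t| ≤ r / 2) :
    ∃ x ∈ straightTube r, tubeMap γ A B x = u ∧ |x 0 - t| ≤ 2 * r := by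
  have hr := h.r_pos
  have hr1 := h.r_le
  have hη := h.η_pos
  have hη1 := h.η_le
  have hηr := h.ηr_le
  have hball : ∀ p : BddSeq ℝ, ‖p - u‖ ≤ r / 40 → ∀ n, |p n - stair n t| ≤ 21 / 40 * r := by
    intro p hp n
    have e1 : |p n - u n| ≤ r / 40 := (BddSeq.sub_apply_le p u n).trans hp
    have := abs_sub_le (p n) (u n) (stair n t)
    linarith [hu n]
  have hdom : ∀ p : BddSeq ℝ, ‖p - u‖ ≤ r / 40 → p ∈ chartDom ℝ r δ t := by
    intro p hp n
    refine ⟨?_, by simp [h.δ_pos.le]⟩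
    simp only [RCLike.re_to_real]
    linarith [hball p hp n]
  -- The radius `r / 40` beats the translation `r / 50`; hence `p` is within `r/2 + r/40 = 21 r /
  -- 40` of the path and its time within twice that.
  obtain ⟨p, hp, hpu⟩ := exists_eq_of_contraction (𝕜 := ℝ) (f := readMap γ A B a b t)
    (s := chartDom ℝ r δ t) (c := 31 * η) (ρ := r / 40) (y := u) (u := u)
    (by positivity) (by positivity)
    (fun p hp => hdom p (by rwa [Metric.mem_closedBall, dist_eq_norm] at hp))
    (h.readMap_contraction ht) (by
      rw [norm_sub_rev]
      refine (h.readMap_near ht (hdom u (by simp; positivity))).trans ?_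
      nlinarith)
  have hh := hball p hp
  have hpd := hdom p hp
  set k := ⌊t⌋₊ with hk
  have hk0 : (k : ℝ) ≤ t := Nat.floor_le ht
  have hk1 : t < k + 1 := Nat.lt_floor_add_one t
  have ha := h.a_nonneg k t
  have hb := h.b_nonneg k t
  have hab := h.ab_le k t
  have eT := h.segTime_re ht p
  simp only [RCLike.re_to_real] at eT
  have hTt : |segTime a b t p - t| ≤ 21 / 20 * r := by
    rw [eT]
    exact (h.abs_weighted_le _ _ (hh _) (hh _) (hh _)).trans (by linarith)
  set T := segTime a b t p with hT
  have hx0 : segChart γ a b t p 0 = T := by rw [h.segChart_apply, if_pos rfl]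
  have hTt' := abs_le.1 hTt
  -- The general bound `21 r / 20` on the time error is too weak near time `0`. There `a = 0` and `b
  -- ≤ η`, so the error is about `21 r / 40`.
  have hT0 : -r < T := by
    rcases le_total (1 / 2) t with h1 | h1
    · linarith
    · have hk' : k = 0 := by
        rw [hk, Nat.floor_eq_zero]; linarith
      have e1 := h'.b_early k t (by rw [hk']; push_cast; linarith)
      rw [← hk, h.coef_zero hk', zero_mul, add_zero] at eT
      have e2 := abs_le.1 (hh k)
      have e3 := abs_le.1 (hh (k + 1))
      have e4 : |b k t * (p (k + 1) - stair (k + 1) t)| ≤ η * (21 / 40 * r) := by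
        rw [abs_mul, abs_of_nonneg hb]
        exact mul_le_mul e1 (hh _) (abs_nonneg _) hη.le
      have e5 := abs_le.1 e4
      linarith
  have herr : ∀ n, |g n T - stair n T| ≤ η * r := fun n => h.g_near n T (by linarith)
  refine ⟨segChart γ a b t p, ⟨by rw [hx0]; exact hT0, fun j hj => ?_⟩, hpu, by
    rw [hx0]; linarith⟩
  have hj0 : j ≠ 0 := by omega
  rw [h.segChart_apply, if_neg hj0]
  unfold segSide chartSide
  rw [if_neg hj0]
  change |if j ≤ k then γ (j - 1) T - p (j - 1) else p j - γ j T| < r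
  split_ifs with h1
  · obtain ⟨n, rfl⟩ : ∃ n, j = n + 1 := ⟨j - 1, by omega⟩
    rw [Nat.add_sub_cancel, h.γ_eq]
    have e1 := abs_le.1 (herr n)
    have e2 := hh n
    rw [stair_lt ht (by omega)] at e2
    have e3 := abs_le.1 e2
    -- Adding the errors of `T` and `p n` would exceed `r`. Either step `n` is over at time `T`, so
    -- that only `p n` errs, or `k = n + 1` with `a ≈ 1`. Then `T - n - p n = p k - (1 - a)(p n -
    -- 1)` up to a small term: the error of `p n` nearly cancels. The case of `j > k` is the mirror
    -- image, with `b ≈ 1`.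
    rcases le_or_gt ((n : ℝ) + 1) T with h2 | h2
    · have e4 : stair n T = 1 := by
        refine stair_lt (by linarith [(n.cast_nonneg : (0 : ℝ) ≤ n)]) ?_
        exact Nat.le_floor (by push_cast; exact h2)
      rw [e4] at e1
      rw [abs_lt]
      constructor <;> linarith
    · have hnk : k = n + 1 := by
        have : (k : ℝ) < (n + 1 : ℕ) + 1 := by push_cast; linarith
        have : k < n + 1 + 1 := by exact_mod_cast this
        omega
      have hnk' : (k : ℝ) = n + 1 := by exact_mod_cast hnk
      have hfl : ⌊T⌋₊ = n := by
        rw [Nat.floor_eq_iff (by linarith [(n.cast_nonneg : (0 : ℝ) ≤ n)])]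
        exact ⟨by linarith, h2⟩
      have e4 : stair n T = T - n := by
        have := stair_floor (show (0 : ℝ) ≤ T by linarith [(n.cast_nonneg : (0 : ℝ) ≤ n)])
        rwa [hfl] at this
      rw [e4] at e1
      have e5 := h'.a_near k t (by omega) (by linarith)
      have e6 : k - 1 = n := by omega
      rw [← hk, e6, stair_lt ht (show n < ⌊t⌋₊ by omega)] at eT
      have e7 := abs_le.1 (hh k)
      have e8 : |(1 - a k t) * (p n - 1)| ≤ η * (21 / 40 * r) := by
        rw [abs_mul, abs_of_nonneg (by linarith [h.a_le_one k t])]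
        exact mul_le_mul (by linarith) e2 (abs_nonneg _) hη.le
      have e9 : |b k t * (p (k + 1) - stair (k + 1) t)| ≤ η * (21 / 40 * r) := by
        rw [abs_mul, abs_of_nonneg hb]
        exact mul_le_mul (by linarith) (hh _) (abs_nonneg _) hη.le
      have e10 := abs_le.1 e8
      have e11 := abs_le.1 e9
      rw [abs_lt]
      constructor <;> linarith
  · rw [h.γ_eq]
    have hjk : k < j := by omega
    have e1 := abs_le.1 (herr j)
    have e2 := hh j
    rw [stair_gt hjk] at e2
    have e3 := abs_le.1 e2
    rcases lt_or_ge T j with h2 | h2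
    · have e4 : stair j T = 0 := stair_gt ((Nat.floor_lt' hj0).2 h2)
      rw [e4] at e1
      rw [abs_lt]
      constructor <;> linarith
    · have hnk : j = k + 1 := by
        have : (j : ℝ) < (k + 1 : ℕ) + 1 := by push_cast; linarith
        have : j < k + 1 + 1 := by exact_mod_cast this
        omega
      have hnk' : (j : ℝ) = k + 1 := by exact_mod_cast hnk
      have hT0' : 0 ≤ T := by linarith [(j.cast_nonneg : (0 : ℝ) ≤ j)]
      have hfl : ⌊T⌋₊ = j := by
        rw [Nat.floor_eq_iff hT0']
        exact ⟨h2, by linarith⟩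
      have e4 : stair j T = T - j := by
        have := stair_floor hT0'
        rwa [hfl] at this
      rw [e4] at e1
      have e5 := h'.b_near k t (by linarith)
      rw [← hk, ← hnk, stair_gt (show ⌊t⌋₊ < j from hjk)] at eT
      have e7 := abs_le.1 (hh k)
      have e8 : |(1 - b k t) * (p j - 0)| ≤ η * (21 / 40 * r) := by
        rw [abs_mul, abs_of_nonneg (by linarith [h.b_le_one k t])]
        exact mul_le_mul (by linarith) e2 (abs_nonneg _) hη.le
      have e9 : |a k t * (p (k - 1) - stair (k - 1) t)| ≤ η * (21 / 40 * r) := by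
        rw [abs_mul, abs_of_nonneg ha]
        exact mul_le_mul (by linarith) (hh _) (abs_nonneg _) hη.le
      have e10 := abs_le.1 e8
      have e11 := abs_le.1 e9
      rw [abs_lt]
      constructor <;> linarith

end Profile

end RealTube

/-! ### Entire maps with values in the bounded sequences -/

section Holomorphic

open Filter Topology Metric

/-- Cauchy's estimate is applied twice on unit discs, passing from radius `3` to `2` to `1`. The
constant depends only on the bound for `f`, hence is uniform over a sequence of functions. -/
theorem norm_taylor_le {f : ℂ → ℂ} {z₀ : ℂ} {C : ℝ} (hf : Differentiable ℂ f)
    (hC : ∀ z, ‖z - z₀‖ ≤ 3 → ‖f z‖ ≤ C) {w : ℂ} (hw : ‖w - z₀‖ ≤ 1) :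
    ‖f w - f z₀ - deriv f z₀ * (w - z₀)‖ ≤ C * ‖w - z₀‖ * ‖w - z₀‖ := by
  have hd1 : ∀ z, ‖z - z₀‖ ≤ 2 → ‖deriv f z‖ ≤ C := by
    intro z hz
    have := Complex.norm_deriv_le_of_forall_mem_sphere_norm_le (c := z) (f := f) one_pos
      hf.diffContOnCl (C := C) fun u hu => hC u (by
        rw [mem_sphere, dist_eq_norm] at hu
        have := norm_add_le (u - z) (z - z₀)
        rw [sub_add_sub_cancel] at this
        linarith)
    simpa using this
  have hdf : Differentiable ℂ (deriv f) := fun z =>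
    (hf.analyticAt z).deriv.differentiableAt
  have hd2 : ∀ z, ‖z - z₀‖ ≤ 1 → ‖deriv (deriv f) z‖ ≤ C := by
    intro z hz
    have := Complex.norm_deriv_le_of_forall_mem_sphere_norm_le (c := z) (f := deriv f) one_pos
      hdf.diffContOnCl (C := C) fun u hu => hd1 u (by
        rw [mem_sphere, dist_eq_norm] at hu
        have := norm_add_le (u - z) (z - z₀)
        rw [sub_add_sub_cancel] at this
        linarith)
    simpa using this
  have hlip : ∀ z ∈ closedBall z₀ ‖w - z₀‖, ‖deriv f z - deriv f z₀‖ ≤ C * ‖w - z₀‖ := by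
    intro z hz
    have hz' : ‖z - z₀‖ ≤ ‖w - z₀‖ := by rwa [mem_closedBall, dist_eq_norm] at hz
    have h1 := (convex_closedBall z₀ 1).norm_image_sub_le_of_norm_deriv_le (𝕜 := ℂ) (f := deriv f)
      (fun u _ => hdf u) (C := C) (x := z₀) (y := z)
      (fun u hu => hd2 u (by rwa [mem_closedBall, dist_eq_norm] at hu))
      (mem_closedBall_self zero_le_one) (by
        rw [mem_closedBall, dist_eq_norm]; exact hz'.trans hw)
    have hC0 : 0 ≤ C := (norm_nonneg _).trans (hC z₀ (by simp))
    exact h1.trans (mul_le_mul_of_nonneg_left hz' hC0)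
  have h2 := (convex_closedBall z₀ ‖w - z₀‖).norm_image_sub_le_of_norm_hasDerivWithin_le
    (f := fun z => f z - deriv f z₀ * z) (f' := fun z => deriv f z - deriv f z₀)
    (C := C * ‖w - z₀‖) (x := z₀) (y := w)
    (fun z _ => by
      have h3 := ((hf z).hasDerivAt.sub ((hasDerivAt_id z).const_mul (deriv f z₀)))
      simp only [mul_one] at h3
      exact h3.hasDerivWithinAt) hlip
    (mem_closedBall_self (norm_nonneg _)) (by rw [mem_closedBall, dist_eq_norm])
  have e : f w - f z₀ - deriv f z₀ * (w - z₀)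
    = f w - deriv f z₀ * w - (f z₀ - deriv f z₀ * z₀) := by ring
  rw [e]
  exact h2

/-- A locally bounded sequence of entire functions is an entire function with values in the space
of bounded sequences. -/
theorem differentiable_ofFun {f : ℕ → ℂ → ℂ} (hf : ∀ n, Differentiable ℂ (f n))
    (hb : ∀ R : ℝ, ∃ C, ∀ n z, ‖z‖ ≤ R → ‖f n z‖ ≤ C) :
    Differentiable ℂ fun z => (BddSeq.ofFun fun n => f n z : BddSeq ℂ) := by
  intro z₀
  obtain ⟨C, hC⟩ := hb (‖z₀‖ + 3)
  have hC' : ∀ n z, ‖z - z₀‖ ≤ 3 → ‖f n z‖ ≤ C := fun n z hz => hC n z (by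
    have := norm_add_le (z - z₀) z₀
    rw [sub_add_cancel] at this
    linarith)
  have hC0 : 0 ≤ C := (norm_nonneg _).trans (hC' 0 z₀ (by simp))
  have hd : ∀ n, ‖deriv (f n) z₀‖ ≤ C := fun n => by
    have := Complex.norm_deriv_le_of_forall_mem_sphere_norm_le (c := z₀) (f := f n) one_pos
      (hf n).diffContOnCl (C := C) fun u hu => hC' n u (by
        rw [mem_sphere, dist_eq_norm] at hu
        linarith)
    simpa using this
  have key : HasDerivAt (fun z => (BddSeq.ofFun fun n => f n z : BddSeq ℂ))
      (BddSeq.ofFun fun n => deriv (f n) z₀) z₀ := by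
    rw [hasDerivAt_iff_isLittleO]
    have hO : (fun z => (BddSeq.ofFun fun n => f n z : BddSeq ℂ) - (BddSeq.ofFun fun n => f n z₀)
        - (z - z₀) • (BddSeq.ofFun fun n => deriv (f n) z₀ : BddSeq ℂ))
        =O[𝓝 z₀] fun z => ‖z - z₀‖ ^ 2 := by
      refine Asymptotics.IsBigO.of_bound C ?_
      filter_upwards [closedBall_mem_nhds z₀ one_pos] with w hw
      rw [mem_closedBall, dist_eq_norm] at hw
      rw [Real.norm_of_nonneg (by positivity)]
      refine BddSeq.norm_le (by positivity) fun n => ?_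
      have e1 : ‖w - z₀‖ ≤ 3 := by linarith
      simp only [lp.coeFn_sub, lp.coeFn_smul, Pi.sub_apply, Pi.smul_apply, smul_eq_mul]
      rw [BddSeq.ofFun_apply (fun n => hC' n w e1), BddSeq.ofFun_apply (fun n => hC' n z₀ (by simp)),
        BddSeq.ofFun_apply hd, mul_comm]
      have := norm_taylor_le (hf n) (hC' n) hw
      linarith
    exact hO.trans_isLittleO (Asymptotics.isLittleO_pow_sub_sub z₀ one_lt_two)
  exact key.differentiableAt

/-- Local boundedness of a sequence of functions. -/
def LocBdd (f : ℕ → ℂ → ℂ) : Prop := ∀ R : ℝ, ∃ C, ∀ n z, ‖z‖ ≤ R → ‖f n z‖ ≤ C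

/-- Bounded sequences form a Banach algebra, so the map is assembled from three sequence-valued
entire functions of the first coordinate by products with `x` and its backward shift. -/
theorem tubeMap_analytic {γ A B : ℕ → ℂ → ℂ} (hγ : ∀ n, Differentiable ℂ (γ n))
    (hA : ∀ n, Differentiable ℂ (A n)) (hB : ∀ n, Differentiable ℂ (B n))
    (bγ : LocBdd γ) (bA : LocBdd A) (bB : LocBdd B) :
    AnalyticOnNhd ℂ (tubeMap γ A B) univ := by
  intro x _
  have e : tubeMap γ A B = fun x => (BddSeq.ofFun fun n => γ n (BddSeq.coord ℂ 0 x))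
      + (BddSeq.ofFun fun n => A n (BddSeq.coord ℂ 0 x)) * x
      - (BddSeq.ofFun fun n => B n (BddSeq.coord ℂ 0 x)) * BddSeq.shift ℂ x := by
    funext x
    obtain ⟨C₁, h₁⟩ := bγ ‖x 0‖
    obtain ⟨C₂, h₂⟩ := bA ‖x 0‖
    obtain ⟨C₃, h₃⟩ := bB ‖x 0‖
    have h₁' := fun n => h₁ n (x 0) le_rfl
    have h₂' := fun n => h₂ n (x 0) le_rfl
    have h₃' := fun n => h₃ n (x 0) le_rfl
    have hb : ∀ n, γ n (x 0) + A n (x 0) * x n - B n (x 0) * x (n + 1) =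
        ((BddSeq.ofFun fun n => γ n (BddSeq.coord ℂ 0 x))
      + (BddSeq.ofFun fun n => A n (BddSeq.coord ℂ 0 x)) * x
      - (BddSeq.ofFun fun n => B n (BddSeq.coord ℂ 0 x)) * BddSeq.shift ℂ x : BddSeq ℂ) n := by
      intro n
      simp only [lp.coeFn_sub, lp.coeFn_add, lp.infty_coeFn_mul, Pi.sub_apply, Pi.add_apply,
        Pi.mul_apply, BddSeq.coord_apply, BddSeq.shift_apply]
      rw [BddSeq.ofFun_apply h₁', BddSeq.ofFun_apply h₂', BddSeq.ofFun_apply h₃']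
    ext n
    rw [tubeMap, BddSeq.ofFun_apply (fun n => by rw [hb]; exact BddSeq.apply_le _ n), hb]
  have hv : ∀ {f : ℕ → ℂ → ℂ}, (∀ n, Differentiable ℂ (f n)) → LocBdd f →
      AnalyticAt ℂ (fun x : BddSeq ℂ => (BddSeq.ofFun fun n => f n (BddSeq.coord ℂ 0 x) : BddSeq ℂ))
        x := fun h1 h2 =>
    ((differentiable_ofFun h1 h2).analyticAt _).comp ((BddSeq.coord ℂ 0).analyticAt x)
  rw [e]
  exact ((hv hγ bγ).add ((hv hA bA).mul analyticAt_id)).sub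
    ((hv hB bB).mul ((BddSeq.shift ℂ).analyticAt x))

end Holomorphic

/-! ### Real and complex sequences -/

section Complexification

@[simp] theorem cplx_apply (x y : EllInf) (n : ℕ) : cplx x y n = ⟨x n, y n⟩ := rfl

theorem cplx_zero_apply (x : EllInf) (n : ℕ) : cplx x 0 n = (x n : ℂ) := rfl

theorem norm_cplx_sub (x y : EllInf) : ‖cplx x y - cplx x 0‖ ≤ ‖y‖ := by
  refine BddSeq.norm_sub_le (norm_nonneg y) fun n => ?_
  rw [cplx_apply, cplx_zero_apply]
  have : (⟨x n, y n⟩ : ℂ) - (x n : ℂ) = (y n : ℂ) * Complex.I := by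
    apply Complex.ext <;> simp
  rw [this, norm_mul, Complex.norm_I, mul_one, Complex.norm_real]
  exact BddSeq.apply_le y n

/-- The inclusion of the real bounded sequences into the complex ones. -/
noncomputable def toComplexSeq : EllInf →L[ℝ] EllInfC :=
  LinearMap.mkContinuous
    { toFun := fun x => cplx x 0
      map_add' := fun x y => by ext n; apply Complex.ext <;> simp
      map_smul' := fun c x => by ext n; apply Complex.ext <;> simp } 1
    (fun x => by
      rw [one_mul]
      refine BddSeq.norm_le (norm_nonneg x) fun n => ?_
      change ‖((x n : ℝ) : ℂ)‖ ≤ _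
      rw [Complex.norm_real]
      exact BddSeq.apply_le x n)

/-- The coordinatewise real part. -/
noncomputable def reSeq : EllInfC →L[ℝ] EllInf :=
  LinearMap.mkContinuous
    { toFun := fun z => ⟨fun n => (z n).re, BddSeq.memlp_of_bound fun n =>
        (Complex.abs_re_le_norm (z n)).trans (BddSeq.apply_le z n)⟩
      map_add' := fun _ _ => by ext n; exact Complex.add_re _ _
      map_smul' := fun _ _ => by ext n; simp } 1
    (fun z => by
      rw [one_mul]
      exact BddSeq.norm_le (norm_nonneg z) fun n =>
        (Complex.abs_re_le_norm (z n)).trans (BddSeq.apply_le z n))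

theorem reSeq_cplx (x y : EllInf) : reSeq (cplx x y) = x := rfl

/-- A real map with a holomorphic extension to the whole space is analytic. -/
theorem analyticOnNhd_of_extension {F : EllInf → EllInf} {Fc : EllInfC → EllInfC}
    (hFc : AnalyticOnNhd ℂ Fc univ) (hF : ∀ x, Fc (cplx x 0) = cplx (F x) 0) :
    AnalyticOnNhd ℝ F univ := by
  intro x _
  have e : F = fun x => reSeq (Fc (toComplexSeq x)) := by
    funext x
    change F x = reSeq (Fc (cplx x 0))
    rw [hF, reSeq_cplx]
  rw [e]
  have h1 : AnalyticAt ℝ Fc (toComplexSeq x) := (hFc _ (mem_univ _)).restrictScalars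
  exact (reSeq.analyticAt _).comp (h1.comp (toComplexSeq.analyticAt x))

end Complexification

/-! ### An entire sigmoid and its primitive -/

section Sigmoid

/-- An entire sigmoid function: it tends to `0` in left half planes and to `1` at the right end of
thin horizontal strips. -/
noncomputable def sig (κ : ℝ) (z : ℂ) : ℂ := 1 - Complex.exp (-Complex.exp (κ * z))

/-- The sigmoid function on the real line. -/
noncomputable def sigR (κ t : ℝ) : ℝ := 1 - Real.exp (-Real.exp (κ * t))

theorem sig_ofReal (κ t : ℝ) : sig κ (t : ℂ) = (sigR κ t : ℂ) := by
  simp [sig, sigR]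

theorem sigR_nonneg (κ t : ℝ) : 0 ≤ sigR κ t := by
  have : Real.exp (-Real.exp (κ * t)) ≤ 1 := Real.exp_le_one_iff.2 (by simp [Real.exp_nonneg])
  unfold sigR; linarith

theorem sigR_le_one (κ t : ℝ) : sigR κ t ≤ 1 := by
  have := Real.exp_pos (-Real.exp (κ * t))
  unfold sigR; linarith

theorem sigR_le_exp (κ t : ℝ) : sigR κ t ≤ Real.exp (κ * t) := by
  have := Real.add_one_le_exp (-Real.exp (κ * t))
  unfold sigR; linarith

theorem one_sub_sigR_le (κ t : ℝ) : 1 - sigR κ t ≤ Real.exp (-(κ * t)) := by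
  have := Real.add_one_le_exp (κ * t)
  unfold sigR
  rw [sub_sub_cancel]
  exact Real.exp_le_exp.2 (by linarith)

theorem sigR_mono {κ : ℝ} (hκ : 0 ≤ κ) : Monotone (sigR κ) := by
  intro t u htu
  have h1 : Real.exp (κ * t) ≤ Real.exp (κ * u) :=
    Real.exp_le_exp.2 (mul_le_mul_of_nonneg_left htu hκ)
  have h2 : Real.exp (-Real.exp (κ * u)) ≤ Real.exp (-Real.exp (κ * t)) :=
    Real.exp_le_exp.2 (by linarith)
  unfold sigR; linarith

theorem hasDerivAt_sig (κ : ℝ) (z : ℂ) :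
    HasDerivAt (sig κ) (κ * (Complex.exp (κ * z) * Complex.exp (-Complex.exp (κ * z)))) z := by
  have h1 : HasDerivAt (fun z : ℂ => (κ : ℂ) * z) κ z := by
    simpa using (hasDerivAt_id z).const_mul (κ : ℂ)
  have h2 := (h1.cexp.neg.cexp).const_sub 1
  refine h2.congr_deriv ?_
  simp only [Pi.neg_apply]
  ring

theorem differentiable_sig (κ : ℝ) : Differentiable ℂ (sig κ) := fun z =>
  (hasDerivAt_sig κ z).differentiableAt

theorem norm_exp_mul (κ : ℝ) (z : ℂ) : ‖Complex.exp (κ * z)‖ = Real.exp (κ * z.re) := by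
  rw [Complex.norm_exp]; simp

/-- The inner exponential is bounded on a left half plane, whatever the imaginary part. The bound
therefore serves all translates to the right at once, which makes the coefficient sequences locally
bounded. -/
theorem norm_sig_le_of_re_le {κ R : ℝ} (hκ : 0 ≤ κ) {z : ℂ} (hz : z.re ≤ R) :
    ‖sig κ z‖ ≤ 1 + Real.exp (Real.exp (κ * R)) := by
  refine (norm_sub_le _ _).trans ?_
  rw [norm_one, Complex.norm_exp]
  refine add_le_add_right (Real.exp_le_exp.2 ?_) 1
  refine (Complex.re_le_norm _).trans ?_
  rw [norm_neg, norm_exp_mul]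
  exact Real.exp_le_exp.2 (mul_le_mul_of_nonneg_left hz hκ)

/-- The thin strips on which the sigmoid is controlled. -/
theorem half_exp_le_re {κ : ℝ} {z : ℂ} (h : |κ * z.im| ≤ 1) :
    Real.exp (κ * z.re) / 2 ≤ (Complex.exp (κ * z)).re := by
  rw [Complex.exp_re]
  have h1 : (κ * z : ℂ).re = κ * z.re := by simp
  have h2 : (κ * z : ℂ).im = κ * z.im := by simp
  rw [h1, h2, div_eq_mul_inv]
  refine mul_le_mul_of_nonneg_left ?_ (Real.exp_nonneg _)
  have h3 := Real.one_sub_sq_div_two_le_cos (x := κ * z.im)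
  have h4 : (κ * z.im) ^ 2 ≤ 1 := by rw [← sq_abs]; exact pow_le_one₀ (abs_nonneg _) h
  linarith

theorem norm_one_sub_sig_le_exp {κ : ℝ} {z : ℂ} (h : |κ * z.im| ≤ 1) :
    ‖sig κ z - 1‖ ≤ Real.exp (-(Real.exp (κ * z.re) / 2)) := by
  rw [sig, sub_sub_cancel_left, norm_neg, Complex.norm_exp]
  refine Real.exp_le_exp.2 ?_
  rw [Complex.neg_re]
  linarith [half_exp_le_re h]

theorem norm_sig_sub_one_le_one {κ : ℝ} {z : ℂ} (h : |κ * z.im| ≤ 1) : ‖sig κ z - 1‖ ≤ 1 :=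
  (norm_one_sub_sig_le_exp h).trans (Real.exp_le_one_iff.2 (by
    have := Real.exp_nonneg (κ * z.re); linarith))

theorem norm_sig_sub_one_le {κ : ℝ} {z : ℂ} (h : |κ * z.im| ≤ 1) :
    ‖sig κ z - 1‖ ≤ 2 * Real.exp (-(κ * z.re)) := by
  refine (norm_one_sub_sig_le_exp h).trans ?_
  have h1 := Real.exp_pos (κ * z.re)
  have h2 := Real.add_one_le_exp (Real.exp (κ * z.re) / 2)
  rw [Real.exp_neg, Real.exp_neg, ← div_eq_mul_inv, inv_eq_one_div,
    div_le_div_iff₀ (Real.exp_pos _) h1]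
  linarith

theorem norm_sig_le_two {κ : ℝ} {z : ℂ} (h : |κ * z.im| ≤ 1) : ‖sig κ z‖ ≤ 2 := by
  have h1 := norm_add_le (sig κ z - 1) 1
  rw [sub_add_cancel, norm_one] at h1
  linarith [norm_sig_sub_one_le_one h]

theorem norm_sig_le {κ : ℝ} {z : ℂ} (h : |κ * z.im| ≤ 1) :
    ‖sig κ z‖ ≤ 2 * Real.exp (κ * z.re) := by
  rcases le_total (Real.exp (κ * z.re)) 1 with h1 | h1
  · rw [sig, norm_sub_rev]
    refine (Complex.norm_exp_sub_one_le (x := -Complex.exp (κ * z)) ?_).trans ?_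
    · rwa [norm_neg, norm_exp_mul]
    · rw [norm_neg, norm_exp_mul]
  · exact (norm_sig_le_two h).trans (by linarith)

/-- With `y = exp (κ Re z)` this is the inequality `y exp (-y/2) ≤ 2`. -/
theorem norm_deriv_sig_le {κ : ℝ} (hκ : 0 ≤ κ) {z : ℂ} (h : |κ * z.im| ≤ 1) :
    ‖(κ * (Complex.exp (κ * z) * Complex.exp (-Complex.exp (κ * z))) : ℂ)‖ ≤ 2 * κ := by
  rw [norm_mul, norm_mul, norm_exp_mul, Complex.norm_real, Real.norm_of_nonneg hκ, mul_comm 2]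
  refine mul_le_mul_of_nonneg_left ?_ hκ
  have h1 := norm_one_sub_sig_le_exp h
  rw [sig, sub_sub_cancel_left, norm_neg] at h1
  have h2 := Real.add_one_le_exp (Real.exp (κ * z.re) / 2)
  have h3 := Real.exp_pos (κ * z.re)
  refine (mul_le_mul_of_nonneg_left h1 h3.le).trans ?_
  rw [Real.exp_neg, ← div_eq_mul_inv, div_le_iff₀ (Real.exp_pos _)]
  linarith

theorem convex_strip (d : ℝ) : Convex ℝ {z : ℂ | |z.im| ≤ d} := by
  have : {z : ℂ | |z.im| ≤ d} = Complex.imLm ⁻¹' (Metric.closedBall 0 d) := by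
    ext z; simp
  rw [this]
  exact (convex_closedBall 0 d).linear_preimage _

theorem sig_lip {κ d : ℝ} (hκ : 0 ≤ κ) (hd : κ * d ≤ 1) {z w : ℂ} (hz : |z.im| ≤ d)
    (hw : |w.im| ≤ d) : ‖sig κ z - sig κ w‖ ≤ 2 * κ * ‖z - w‖ :=
  (convex_strip d).norm_image_sub_le_of_norm_hasDerivWithin_le
    (fun u _ => (hasDerivAt_sig κ u).hasDerivWithinAt)
    (fun u hu => norm_deriv_sig_le hκ (by
      rw [abs_mul, abs_of_nonneg hκ]
      exact (mul_le_mul_of_nonneg_left hu hκ).trans hd)) hw hz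

theorem exists_ramp (κ : ℝ) :
    ∃ F : ℂ → ℂ, F 0 = 0 ∧ ∀ z, HasDerivAt F (sig κ z) z := by
  obtain ⟨F, hF⟩ := (differentiable_sig κ).isExactOn_univ
  exact ⟨fun z => F z - F 0, by simp, fun z => (hF z (mem_univ z)).sub_const _⟩

/-- An entire primitive of the sigmoid function: an approximation of `max t 0`. -/
noncomputable def ramp (κ : ℝ) : ℂ → ℂ := Classical.choose (exists_ramp κ)

theorem ramp_zero (κ : ℝ) : ramp κ 0 = 0 := (Classical.choose_spec (exists_ramp κ)).1

theorem hasDerivAt_ramp (κ : ℝ) (z : ℂ) : HasDerivAt (ramp κ) (sig κ z) z :=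
  (Classical.choose_spec (exists_ramp κ)).2 z

/-- The ramp function on the real line. -/
noncomputable def rampR (κ t : ℝ) : ℝ := (ramp κ t).re

theorem hasDerivAt_rampR (κ t : ℝ) : HasDerivAt (rampR κ) (sigR κ t) t := by
  have := (hasDerivAt_ramp κ t).real_of_complex
  rwa [sig_ofReal, Complex.ofReal_re] at this

theorem ramp_ofReal (κ t : ℝ) : ramp κ (t : ℂ) = (rampR κ t : ℂ) := by
  have h1 : ∀ s : ℝ, HasDerivAt (fun s : ℝ => (ramp κ s).im) 0 s := by
    intro s
    have h2 : HasDerivAt (fun s : ℝ => ramp κ s) (sig κ s) s := (hasDerivAt_ramp κ s).comp_ofReal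
    have h3 := Complex.imCLM.hasFDerivAt.comp_hasDerivAt s h2
    have h4 : Complex.imCLM (sig κ s) = 0 := by rw [sig_ofReal]; simp
    rw [h4] at h3
    exact h3
  have h5 : (ramp κ t).im = (ramp κ (0 : ℝ)).im :=
    is_const_of_deriv_eq_zero (fun s => (h1 s).differentiableAt) (fun s => (h1 s).deriv) t 0
  apply Complex.ext
  · simp [rampR]
  · rw [h5]; simp [ramp_zero]

theorem rampR_zero (κ : ℝ) : rampR κ 0 = 0 := by simp [rampR, ramp_zero]

/-- The derivative differs from that of `max t 0` by at most `exp (-κ |t|)`, whose integral over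
each half line is `1 / κ`. Four monotone comparison functions express this without integrals. -/
theorem rampR_near {κ : ℝ} (hκ : 0 < κ) (t : ℝ) : |rampR κ t - max t 0| ≤ 1 / κ := by
  have hexp : ∀ c s : ℝ, HasDerivAt (fun s => Real.exp (c * s)) (Real.exp (c * s) * c) s := by
    intro c s
    have : HasDerivAt (fun s : ℝ => c * s) c s := by simpa using (hasDerivAt_id s).const_mul c
    exact this.exp
  have mono : ∀ {f f' : ℝ → ℝ}, (∀ s, HasDerivAt f (f' s) s) → (∀ s, 0 ≤ f' s) →
      Monotone f := fun h1 h2 =>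
    monotone_of_deriv_nonneg (fun s => (h1 s).differentiableAt) fun s => by
      rw [(h1 s).deriv]; exact h2 s
  have m1 : Monotone (rampR κ) := mono (hasDerivAt_rampR κ) (sigR_nonneg κ)
  have m2 : Monotone fun s => s - rampR κ s :=
    mono (fun s => (hasDerivAt_id s).sub (hasDerivAt_rampR κ s))
      (fun s => by linarith [sigR_le_one κ s])
  have m3 : Monotone fun s => Real.exp (κ * s) / κ - rampR κ s :=
    mono (fun s => ((hexp κ s).div_const κ).sub (hasDerivAt_rampR κ s)) (fun s => by
      rw [mul_div_assoc, div_self hκ.ne', mul_one]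
      linarith [sigR_le_exp κ s])
  have m4 : Monotone fun s => rampR κ s - s - Real.exp (-κ * s) / κ :=
    mono (fun s => ((hasDerivAt_rampR κ s).sub (hasDerivAt_id s)).sub ((hexp (-κ) s).div_const κ))
      (fun s => by
        have := one_sub_sigR_le κ s
        rw [← neg_mul] at this
        have e : Real.exp (-κ * s) * -κ / κ = -Real.exp (-κ * s) := by field_simp
        rw [e]
        linarith)
  have hk : 0 < 1 / κ := by positivity
  rcases le_total 0 t with h | h
  · have h2 := m2 h
    have h4 := m4 h
    simp only [rampR_zero, mul_zero, Real.exp_zero] at h2 h4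
    have : 0 ≤ Real.exp (-κ * t) / κ := by positivity
    rw [max_eq_left h, abs_le]
    constructor <;> linarith
  · have h1 := m1 h
    have h3 := m3 h
    simp only [rampR_zero, mul_zero, Real.exp_zero] at h1 h3
    have : 0 ≤ Real.exp (κ * t) / κ := by positivity
    rw [max_eq_right h, abs_le]
    constructor <;> linarith

end Sigmoid

/-! ### The concrete coefficient functions and their scales -/

section Profiles

/-- The starting time of the `n`-th step of the smoothed staircase. -/
noncomputable def stepStart (n : ℕ) : ℝ := if n = 0 then -1 else n

/-- The smoothed staircase. -/
noncomputable def stepC (κ : ℝ) (n : ℕ) (z : ℂ) : ℂ :=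
  ramp κ (z - stepStart n) - ramp κ (z - (n + 1 : ℝ)) - (if n = 0 then 1 else 0 : ℝ)

/-- The smoothed staircase on the real line. -/
noncomputable def stepR (κ : ℝ) (n : ℕ) (t : ℝ) : ℝ :=
  rampR κ (t - stepStart n) - rampR κ (t - (n + 1 : ℝ)) - (if n = 0 then 1 else 0 : ℝ)

/-- The coefficient of `x n` in the `n`-th coordinate. -/
noncomputable def leftC (κ θ : ℝ) (n : ℕ) (z : ℂ) : ℂ :=
  if n = 0 then 0 else 1 - sig κ (z - (n + θ : ℝ))

/-- The coefficient of `x n` in the `n`-th coordinate, on the real line. -/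
noncomputable def leftR (κ θ : ℝ) (n : ℕ) (t : ℝ) : ℝ :=
  if n = 0 then 0 else 1 - sigR κ (t - (n + θ : ℝ))

/-- The coefficient of `- x (n + 1)` in the `n`-th coordinate. -/
noncomputable def rightC (κ θ : ℝ) (n : ℕ) (z : ℂ) : ℂ := sig κ (z - (n + 1 - θ : ℝ))

/-- The coefficient of `- x (n + 1)` in the `n`-th coordinate, on the real line. -/
noncomputable def rightR (κ θ : ℝ) (n : ℕ) (t : ℝ) : ℝ := sigR κ (t - (n + 1 - θ : ℝ))

theorem stepC_ofReal (κ : ℝ) (n : ℕ) (t : ℝ) : stepC κ n t = (stepR κ n t : ℂ) := by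
  rw [stepC, stepR, ← Complex.ofReal_sub, ← Complex.ofReal_sub, ramp_ofReal, ramp_ofReal]
  push_cast; rfl

theorem leftC_ofReal (κ θ : ℝ) (n : ℕ) (t : ℝ) : leftC κ θ n t = (leftR κ θ n t : ℂ) := by
  unfold leftC leftR
  split_ifs
  · simp
  · rw [← Complex.ofReal_sub, sig_ofReal]; push_cast; rfl

theorem rightC_ofReal (κ θ : ℝ) (n : ℕ) (t : ℝ) : rightC κ θ n t = (rightR κ θ n t : ℂ) := by
  rw [rightC, rightR, ← Complex.ofReal_sub, sig_ofReal]

theorem stepStart_le (n : ℕ) : stepStart n ≤ n := by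
  unfold stepStart
  split_ifs with h
  · linarith [(n.cast_nonneg : (0 : ℝ) ≤ n)]
  · exact le_rfl

theorem stepStart_pos {n : ℕ} (h : n ≠ 0) : stepStart n = n := if_neg h

/-- Starting the first step at `-1` lets the path run straight through time `0`, so that the
beginning of the tube is not a corner. -/
theorem stepStart_zero : stepStart 0 = -1 := if_pos rfl

theorem hasDerivAt_stepC (κ : ℝ) (n : ℕ) (z : ℂ) :
    HasDerivAt (stepC κ n) (sig κ (z - stepStart n) - sig κ (z - (n + 1 : ℝ))) z :=
  (((hasDerivAt_ramp κ _).comp_sub_const z _).sub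
    ((hasDerivAt_ramp κ _).comp_sub_const z _)).sub_const _

theorem hasDerivAt_stepR (κ : ℝ) (n : ℕ) (t : ℝ) :
    HasDerivAt (stepR κ n) (sigR κ (t - stepStart n) - sigR κ (t - (n + 1 : ℝ))) t :=
  (((hasDerivAt_rampR κ _).comp_sub_const t _).sub
    ((hasDerivAt_rampR κ _).comp_sub_const t _)).sub_const _

theorem differentiable_stepC (κ : ℝ) (n : ℕ) : Differentiable ℂ (stepC κ n) := fun z =>
  (hasDerivAt_stepC κ n z).differentiableAt

theorem differentiable_rightC (κ θ : ℝ) (n : ℕ) : Differentiable ℂ (rightC κ θ n) := fun z =>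
  ((hasDerivAt_sig κ _).comp_sub_const z _).differentiableAt

theorem differentiable_leftC (κ θ : ℝ) (n : ℕ) : Differentiable ℂ (leftC κ θ n) := by
  by_cases h : n = 0
  · have : leftC κ θ n = fun _ => 0 := by funext z; simp [leftC, h]
    rw [this]; exact differentiable_const 0
  · have : leftC κ θ n = fun z => 1 - sig κ (z - (n + θ : ℝ)) := by funext z; simp [leftC, h]
    rw [this]
    exact fun z => (((hasDerivAt_sig κ _).comp_sub_const z _).const_sub 1).differentiableAt

theorem locBdd_rightC {κ θ : ℝ} (hκ : 0 ≤ κ) (hθ1 : θ ≤ 1) :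
    LocBdd (rightC κ θ) := fun R =>
  ⟨_, fun n z hz => norm_sig_le_of_re_le hκ (R := R) (by
    rw [Complex.sub_re, Complex.ofReal_re]
    linarith [Complex.re_le_norm z, (n.cast_nonneg : (0 : ℝ) ≤ n)])⟩

theorem locBdd_leftC {κ θ : ℝ} (hκ : 0 ≤ κ) (hθ : 0 ≤ θ) : LocBdd (leftC κ θ) := fun R =>
  ⟨1 + (1 + Real.exp (Real.exp (κ * R))), fun n z hz => by
    unfold leftC
    split_ifs
    · rw [norm_zero]; positivity
    · refine (norm_sub_le _ _).trans ?_
      rw [norm_one]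
      have := norm_sig_le_of_re_le hκ (R := R) (z := z - (n + θ : ℝ)) (by
        rw [Complex.sub_re, Complex.ofReal_re]
        linarith [Complex.re_le_norm z, (n.cast_nonneg : (0 : ℝ) ≤ n)])
      linarith⟩

/-- Two ramps are compared at points at distance at most `2`, through the bound on the derivative
`sig` in a left half plane; neither ramp is bounded separately. -/
theorem locBdd_stepC {κ : ℝ} (hκ : 0 ≤ κ) : LocBdd (stepC κ) := by
  intro R
  refine ⟨(1 + Real.exp (Real.exp (κ * (R + 1)))) * 2 + 1, fun n z hz => ?_⟩
  have hconv : Convex ℝ {w : ℂ | w.re ≤ R + 1} := convex_halfSpace_re_le _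
  have hn : (0 : ℝ) ≤ n := n.cast_nonneg
  have hs : (n : ℝ) - 1 ≤ stepStart n := by
    unfold stepStart
    split_ifs with h
    · simp [h]
    · linarith
  have hs2 := stepStart_le n
  have hre : z.re ≤ R := (Complex.re_le_norm z).trans hz
  have h1 := hconv.norm_image_sub_le_of_norm_hasDerivWithin_le
    (f := ramp κ) (f' := sig κ) (C := 1 + Real.exp (Real.exp (κ * (R + 1))))
    (x := z - (n + 1 : ℝ)) (y := z - stepStart n)
    (fun w _ => (hasDerivAt_ramp κ w).hasDerivWithinAt)
    (fun w hw => norm_sig_le_of_re_le hκ hw)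
    (by
      change (_ - _ : ℂ).re ≤ _
      rw [Complex.sub_re, Complex.ofReal_re]; linarith)
    (by
      change (_ - _ : ℂ).re ≤ _
      rw [Complex.sub_re, Complex.ofReal_re]; linarith)
  have h2 : ‖z - stepStart n - (z - (n + 1 : ℝ))‖ ≤ 2 := by
    rw [sub_sub_sub_cancel_left, ← Complex.ofReal_sub, Complex.norm_real, Real.norm_eq_abs, abs_le]
    constructor <;> linarith
  have h3 : ‖((if n = 0 then 1 else 0 : ℝ) : ℂ)‖ ≤ 1 := by split_ifs <;> simp
  refine (norm_sub_le _ _).trans (add_le_add (h1.trans ?_) h3)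
  exact mul_le_mul_of_nonneg_left h2 (by positivity)

/-- The conditions on the scales: `θ` is the size of the corner zones, `1 / κ₁` the scale of the
transitions in the transverse coefficients, and `1 / κ₂` the scale of the smoothing of the
staircase. -/
structure Scales (θ κ₁ κ₂ r δ η : ℝ) : Prop where
  θ_pos : 0 < θ
  θ_le : θ ≤ 1 / 4
  κ₁_pos : 0 < κ₁
  κ₂_pos : 0 < κ₂
  r_pos : 0 < r
  r_le : r ≤ 1 / 10000
  r_le_θ : 2000 * r ≤ θ / 4
  δ_pos : 0 < δ
  δ_le : δ ≤ η * r
  η_pos : 0 < η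
  η_le : η ≤ 1 / 1000000
  exp₁ : 2 * Real.exp (-(κ₁ * (θ / 4))) ≤ η / 4
  exp₂ : 2 * Real.exp (-(κ₂ * (θ / 4))) ≤ η / 4
  κ₁_r : 2 * κ₁ * r ≤ η / 24000
  κ₂_r : 2 / κ₂ ≤ η * r
  κ₁_δ : κ₁ * (3 * δ) ≤ 1
  κ₂_δ : κ₂ * (3 * δ) ≤ 1

namespace Scales

variable {θ κ₁ κ₂ r δ η : ℝ}

theorem exp_le_of_le {κ s e d : ℝ} (hκ : 0 < κ) (h : 2 * Real.exp (-(κ * e)) ≤ d) (hs : s ≤ -e) :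
    2 * Real.exp (κ * s) ≤ d := by
  refine le_trans ?_ h
  have : κ * s ≤ -(κ * e) := by
    have := mul_le_mul_of_nonneg_left hs hκ.le
    linarith
  have := Real.exp_le_exp.2 this
  linarith

theorem sigR_small {κ s e d : ℝ} (hκ : 0 < κ) (h : 2 * Real.exp (-(κ * e)) ≤ d) (hs : s ≤ -e) :
    sigR κ s ≤ d / 2 := by
  have := exp_le_of_le hκ h hs
  linarith [sigR_le_exp κ s]

theorem one_sub_sigR_small {κ s e d : ℝ} (hκ : 0 < κ) (h : 2 * Real.exp (-(κ * e)) ≤ d)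
    (hs : e ≤ s) : 1 - sigR κ s ≤ d / 2 := by
  have := exp_le_of_le (s := -s) hκ h (by linarith)
  rw [mul_neg] at this
  linarith [one_sub_sigR_le κ s]

theorem sig_small {κ e d : ℝ} {z : ℂ} (hκ : 0 < κ) (h : 2 * Real.exp (-(κ * e)) ≤ d)
    (hs : z.re ≤ -e) (him : κ * |z.im| ≤ 1) : ‖sig κ z‖ ≤ d :=
  (norm_sig_le (by rwa [abs_mul, abs_of_pos hκ])).trans (exp_le_of_le hκ h hs)

theorem sig_sub_one_small {κ e d : ℝ} {z : ℂ} (hκ : 0 < κ) (h : 2 * Real.exp (-(κ * e)) ≤ d)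
    (hs : e ≤ z.re) (him : κ * |z.im| ≤ 1) : ‖sig κ z - 1‖ ≤ d := by
  refine (norm_sig_sub_one_le (by rwa [abs_mul, abs_of_pos hκ])).trans ?_
  rw [← mul_neg]
  exact exp_le_of_le hκ h (by linarith)

theorem im₁ (h : Scales θ κ₁ κ₂ r δ η) {z : ℂ} (hz : |z.im| ≤ 3 * δ) (s : ℝ) :
    κ₁ * |(z - (s : ℂ)).im| ≤ 1 := by
  rw [Complex.sub_im, Complex.ofReal_im, sub_zero]
  exact (mul_le_mul_of_nonneg_left hz h.κ₁_pos.le).trans h.κ₁_δ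

theorem im₂ (h : Scales θ κ₁ κ₂ r δ η) {z : ℂ} (hz : |z.im| ≤ 3 * δ) (s : ℝ) :
    κ₂ * |(z - (s : ℂ)).im| ≤ 1 := by
  rw [Complex.sub_im, Complex.ofReal_im, sub_zero]
  exact (mul_le_mul_of_nonneg_left hz h.κ₂_pos.le).trans h.κ₂_δ

theorem stepC_lip (h : Scales θ κ₁ κ₂ r δ η) (n : ℕ) {z w : ℂ} (hz : |z.im| ≤ 3 * δ)
    (hw : |w.im| ≤ 3 * δ) : ‖stepC κ₂ n z - stepC κ₂ n w‖ ≤ 4 * ‖z - w‖ := by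
  refine (convex_strip (3 * δ)).norm_image_sub_le_of_norm_hasDerivWithin_le
    (fun u _ => (hasDerivAt_stepC κ₂ n u).hasDerivWithinAt) (fun u hu => ?_) hw hz
  refine (norm_sub_le _ _).trans ?_
  have e1 := norm_sig_le_two (κ := κ₂) (z := u - stepStart n) (by
    rw [abs_mul, abs_of_pos h.κ₂_pos]; exact h.im₂ hu _)
  have e2 := norm_sig_le_two (κ := κ₂) (z := u - (n + 1 : ℝ)) (by
    rw [abs_mul, abs_of_pos h.κ₂_pos]; exact h.im₂ hu _)
  linarith

/-- The exact staircase is the same combination of positive parts once `t ≥ -1`, and each of the two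
ramps errs by at most `1 / κ₂`. -/
theorem stepR_near (h : Scales θ κ₁ κ₂ r δ η) (n : ℕ) {t : ℝ} (ht : -1 ≤ t) :
    |stepR κ₂ n t - stair n t| ≤ η * r := by
  have e1 := abs_le.1 (rampR_near h.κ₂_pos (t - stepStart n))
  have e2 := abs_le.1 (rampR_near h.κ₂_pos (t - (n + 1 : ℝ)))
  have e3 := h.κ₂_r
  rw [show 2 / κ₂ = 1 / κ₂ + 1 / κ₂ by ring] at e3
  have e4 : stair n t = max (t - stepStart n) 0 - max (t - (n + 1 : ℝ)) 0
      - (if n = 0 then 1 else 0 : ℝ) := by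
    unfold stair stepStart
    split_ifs with h0
    · subst h0
      push_cast
      rw [max_eq_left (by linarith : (0 : ℝ) ≤ t - -1)]
      rcases le_total t 1 with h1 | h1
      · rw [min_eq_left h1, max_eq_right (by linarith)]; ring
      · rw [min_eq_right h1, max_eq_left (by linarith)]; ring
    · rcases le_total t n with h1 | h1
      · rw [min_eq_left (by linarith), max_eq_left (by linarith), max_eq_right (by linarith),
          max_eq_right (by linarith)]; ring
      · rcases le_total t (n + 1) with h2 | h2
        · rw [min_eq_left (by linarith), max_eq_right (by linarith), max_eq_left (by linarith),
            max_eq_right (by linarith)]; ring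
        · rw [min_eq_right (by linarith), max_eq_right (by linarith), max_eq_left (by linarith),
            max_eq_left (by linarith)]; ring
  rw [e4, stepR, abs_le]
  constructor <;> linarith

theorem convex_paramBox (r δ t : ℝ) : Convex ℝ (paramBox ℂ r δ t) := by
  have : paramBox ℂ r δ t = (Complex.reLm ⁻¹' (Metric.closedBall t (2000 * r))) ∩
      (Complex.imLm ⁻¹' (Metric.closedBall 0 (3 * δ))) := by
    ext z; simp [paramBox, Real.dist_eq]
  rw [this]
  exact ((convex_closedBall _ _).linear_preimage _).inter ((convex_closedBall _ _).linear_preimage _)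

/-- The sigmoid centred at `k` both ends step `k - 1` and starts step `k`, which leaves the weight
`1 - p`; likewise `1 - q` at `k + 1`. The derivative `1` of the identity is split as `(1 - p) + p`.
-/
theorem hasDerivAt_balance (κ : ℝ) (k : ℕ) {p q : ℝ} (hp : k = 0 → p = 0) (z : ℂ) :
    HasDerivAt (fun z => stepC κ k z + (p : ℂ) * stepC κ (k - 1) z + (q : ℂ) * stepC κ (k + 1) z - z)
      (((1 - p : ℝ) : ℂ) * (sig κ (z - stepStart k) - 1)
        + (p : ℂ) * (sig κ (z - stepStart (k - 1)) - 1)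
        - ((1 - q : ℝ) : ℂ) * sig κ (z - (k + 1 : ℝ)) - (q : ℂ) * sig κ (z - (k + 2 : ℝ))) z := by
  have h1 := (((hasDerivAt_stepC κ k z).add ((hasDerivAt_stepC κ (k - 1) z).const_mul (p : ℂ))).add
    ((hasDerivAt_stepC κ (k + 1) z).const_mul (q : ℂ))).sub (hasDerivAt_id z)
  refine h1.congr_deriv ?_
  rw [stepStart_pos (Nat.succ_ne_zero k)]
  have e1 : (((k + 1 : ℕ) : ℝ) + 1) = k + 2 := by push_cast; ring
  have e2 : ((k + 1 : ℕ) : ℝ) = (k : ℝ) + 1 := by push_cast; ring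
  rw [e1, e2]
  rcases Nat.eq_zero_or_pos k with h0 | h0
  · rw [hp h0]; push_cast; ring
  · have e3 : (((k - 1 : ℕ) : ℝ) + 1) = k := by exact_mod_cast (show k - 1 + 1 = k by omega)
    rw [e3, stepStart_pos (show k ≠ 0 by omega)]
    push_cast; ring

theorem leftR_nonneg (n : ℕ) (t : ℝ) : 0 ≤ leftR κ₁ θ n t := by
  unfold leftR
  split_ifs
  · exact le_rfl
  · linarith [sigR_le_one κ₁ (t - (n + θ))]

/-- As `θ ≤ 1/4`, the left coefficient is switched off at `n + θ`, before the right one is switched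
on at `n + 1 - θ`. -/
theorem leftR_add_rightR_le (h : Scales θ κ₁ κ₂ r δ η) (n : ℕ) (t : ℝ) :
    leftR κ₁ θ n t + rightR κ₁ θ n t ≤ 1 := by
  unfold leftR rightR
  split_ifs
  · linarith [sigR_le_one κ₁ (t - (n + 1 - θ))]
  · have := sigR_mono h.κ₁_pos.le (show t - (n + 1 - θ) ≤ t - (n + θ) by linarith [h.θ_le])
    linarith

/-- Each of the four terms is at most `η / 4`. Away from its kink a sigmoid is saturated. Within `θ
/ 2` of the kinks at `k ≥ 1` and `k + 1` it need not be, but there the weight `1 - p` or `1 - q` is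
small, because the coefficients switch at distance `θ` from the corners. -/
theorem balance (h : Scales θ κ₁ κ₂ r δ η) {t : ℝ} (ht : 0 ≤ t) {z : ℂ}
    (hz : z ∈ paramBox ℂ r δ t) {k : ℕ} (hk : k = ⌊t⌋₊) {p q : ℝ} (hp : p = leftR κ₁ θ k t)
    (hq : q = rightR κ₁ θ k t) :
    ‖((1 - p : ℝ) : ℂ) * (sig κ₂ (z - stepStart k) - 1)
        + (p : ℂ) * (sig κ₂ (z - stepStart (k - 1)) - 1)
        - ((1 - q : ℝ) : ℂ) * sig κ₂ (z - (k + 1 : ℝ)) - (q : ℂ) * sig κ₂ (z - (k + 2 : ℝ))‖ ≤ η := by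
  have hk0 : (k : ℝ) ≤ t := hk ▸ Nat.floor_le ht
  have hk1 : t < k + 1 := hk ▸ Nat.lt_floor_add_one t
  have hp0 : 0 ≤ p := hp ▸ leftR_nonneg k t
  have hq0 : 0 ≤ q := hq ▸ sigR_nonneg _ _
  have hpq : p + q ≤ 1 := by rw [hp, hq]; exact h.leftR_add_rightR_le k t
  have hθ := h.θ_pos
  have hθ4 := h.θ_le
  have hr := h.r_le_θ
  have hη := h.η_pos
  have hre := abs_le.1 hz.1
  have him : |z.im| ≤ 3 * δ := hz.2
  simp only [RCLike.re_eq_complex_re] at hre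
  have re_sub : ∀ s : ℝ, (z - (s : ℂ)).re = z.re - s := fun s => by simp
  have small : ∀ {c d : ℝ} {w : ℂ}, 0 ≤ c → c ≤ 1 → ‖w‖ ≤ d → ‖(c : ℂ) * w‖ ≤ d := by
    intro c d w h0 h1 hw
    rw [norm_mul, Complex.norm_real, Real.norm_of_nonneg h0]
    exact (mul_le_of_le_one_left (norm_nonneg _) h1).trans hw
  have x1 : ‖((1 - p : ℝ) : ℂ) * (sig κ₂ (z - stepStart k) - 1)‖ ≤ η / 4 := by
    rcases le_or_gt (k + θ / 2) t with h1 | h1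
    · refine small (by linarith) (by linarith) (sig_sub_one_small h.κ₂_pos h.exp₂ ?_ (h.im₂ him _))
      rw [re_sub]
      linarith [stepStart_le k]
    · rcases Nat.eq_zero_or_pos k with h0 | h0
      · refine small (by linarith) (by linarith)
          (sig_sub_one_small h.κ₂_pos h.exp₂ ?_ (h.im₂ him _))
        rw [re_sub, h0, stepStart_zero]
        linarith
      · have e1 : 1 - p ≤ η / 4 / 2 := by
          rw [hp, leftR, if_neg (by omega), sub_sub_cancel]
          exact sigR_small h.κ₁_pos h.exp₁ (by linarith)
        rw [norm_mul, Complex.norm_real, Real.norm_of_nonneg (by linarith)]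
        have e2 := norm_sig_sub_one_le_one (κ := κ₂) (z := z - stepStart k) (by
          rw [abs_mul, abs_of_pos h.κ₂_pos]; exact h.im₂ him _)
        have := mul_le_mul e1 e2 (norm_nonneg _) (by positivity)
        linarith
  have x2 : ‖(p : ℂ) * (sig κ₂ (z - stepStart (k - 1)) - 1)‖ ≤ η / 4 := by
    refine small hp0 (by linarith) (sig_sub_one_small h.κ₂_pos h.exp₂ ?_ (h.im₂ him _))
    rw [re_sub]
    rcases Nat.eq_zero_or_pos k with h0 | h0
    · rw [h0, Nat.zero_sub, stepStart_zero]
      linarith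
    · have e1 := stepStart_le (k - 1)
      have e3 : (((k - 1 : ℕ) : ℝ) + 1) = k := by exact_mod_cast (show k - 1 + 1 = k by omega)
      linarith
  have x3 : ‖((1 - q : ℝ) : ℂ) * sig κ₂ (z - (k + 1 : ℝ))‖ ≤ η / 4 := by
    rcases le_or_gt t (k + 1 - θ / 2) with h1 | h1
    · refine small (by linarith) (by linarith) (sig_small h.κ₂_pos h.exp₂ ?_ (h.im₂ him _))
      rw [re_sub]
      linarith
    · have e1 : 1 - q ≤ η / 4 / 2 := by
        rw [hq, rightR]
        exact one_sub_sigR_small h.κ₁_pos h.exp₁ (by linarith)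
      rw [norm_mul, Complex.norm_real, Real.norm_of_nonneg (by linarith)]
      have e2 := norm_sig_le_two (κ := κ₂) (z := z - (k + 1 : ℝ)) (by
        rw [abs_mul, abs_of_pos h.κ₂_pos]; exact h.im₂ him _)
      have := mul_le_mul e1 e2 (norm_nonneg _) (by positivity)
      linarith
  have x4 : ‖(q : ℂ) * sig κ₂ (z - (k + 2 : ℝ))‖ ≤ η / 4 := by
    refine small hq0 (by linarith) (sig_small h.κ₂_pos h.exp₂ ?_ (h.im₂ him _))
    rw [re_sub]
    linarith
  refine (norm_sub_le _ _).trans ?_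
  have y1 := norm_sub_le (((1 - p : ℝ) : ℂ) * (sig κ₂ (z - stepStart k) - 1)
        + (p : ℂ) * (sig κ₂ (z - stepStart (k - 1)) - 1))
        (((1 - q : ℝ) : ℂ) * sig κ₂ (z - (k + 1 : ℝ)))
  have y2 := norm_add_le (((1 - p : ℝ) : ℂ) * (sig κ₂ (z - stepStart k) - 1))
        ((p : ℂ) * (sig κ₂ (z - stepStart (k - 1)) - 1))
  linarith

theorem profile (h : Scales θ κ₁ κ₂ r δ η) :
    Profile ℂ r δ η (2 * κ₁) (stepC κ₂) (leftC κ₁ θ) (rightC κ₁ θ)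
      (stepR κ₂) (leftR κ₁ θ) (rightR κ₁ θ) where
  r_pos := h.r_pos
  r_le := h.r_le
  δ_pos := h.δ_pos
  δ_le := h.δ_le
  η_pos := h.η_pos
  η_le := h.η_le
  K_nonneg := by linarith [h.κ₁_pos]
  K_le := h.κ₁_r
  bdd z := by
    obtain ⟨C₁, h₁⟩ := locBdd_stepC h.κ₂_pos.le ‖z‖
    obtain ⟨C₂, h₂⟩ := locBdd_leftC h.κ₁_pos.le h.θ_pos.le ‖z‖
    obtain ⟨C₃, h₃⟩ := locBdd_rightC h.κ₁_pos.le (by linarith [h.θ_le]) ‖z‖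
    exact ⟨max C₁ (max C₂ C₃), fun n => ⟨(h₁ n z le_rfl).trans (le_max_left _ _),
      (h₂ n z le_rfl).trans ((le_max_left _ _).trans (le_max_right _ _)),
      (h₃ n z le_rfl).trans ((le_max_right _ _).trans (le_max_right _ _))⟩⟩
  A_zero z := by simp [leftC]
  γ_real := stepC_ofReal κ₂
  A_real := leftC_ofReal κ₁ θ
  B_real := rightC_ofReal κ₁ θ
  a_nonneg := leftR_nonneg
  b_nonneg n t := sigR_nonneg _ _
  ab_le := h.leftR_add_rightR_le
  γ_lip n z w hz hw := h.stepC_lip n hz hw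
  A_lip n z w hz hw := by
    unfold leftC
    split_ifs
    · rw [sub_zero, norm_zero]; have := h.κ₁_pos; positivity
    · rw [sub_sub_sub_cancel_left, norm_sub_rev]
      have := sig_lip h.κ₁_pos.le h.κ₁_δ (z := z - (n + θ : ℝ)) (w := w - (n + θ : ℝ))
        (by simpa using hz) (by simpa using hw)
      rwa [sub_sub_sub_cancel_right] at this
  B_lip n z w hz hw := by
    have := sig_lip h.κ₁_pos.le h.κ₁_δ (z := z - (n + 1 - θ : ℝ)) (w := w - (n + 1 - θ : ℝ))
      (by simpa using hz) (by simpa using hw)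
    rwa [sub_sub_sub_cancel_right] at this
  A_lt t ht n hn z hz := by
    have h1 : ((n + 1 : ℕ) : ℝ) ≤ t := (Nat.le_floor_iff ht).1 hn
    push_cast at h1
    have hre := abs_le.1 hz.1
    simp only [RCLike.re_eq_complex_re] at hre
    have hη := h.η_pos
    unfold leftC
    split_ifs
    · rw [norm_zero]; exact hη.le
    · rw [norm_sub_rev]
      refine (sig_sub_one_small h.κ₁_pos h.exp₁ ?_ (h.im₁ hz.2 _)).trans (by linarith)
      rw [Complex.sub_re, Complex.ofReal_re]
      linarith [h.r_le_θ, h.θ_le]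
  B_lt t ht n hn z hz := by
    have h1 : ((n + 1 : ℕ) : ℝ) ≤ t := (Nat.le_floor_iff ht).1 hn
    push_cast at h1
    have hre := abs_le.1 hz.1
    simp only [RCLike.re_eq_complex_re] at hre
    refine (sig_sub_one_small h.κ₁_pos h.exp₁ ?_ (h.im₁ hz.2 _)).trans (by linarith [h.η_pos])
    rw [Complex.sub_re, Complex.ofReal_re]
    linarith [h.r_le_θ, h.θ_pos]
  A_gt t ht n hn z hz := by
    have h1 : t < n := Nat.lt_of_floor_lt hn
    have hre := abs_le.1 hz.1
    simp only [RCLike.re_eq_complex_re] at hre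
    rw [leftC, if_neg (by omega), sub_sub_cancel_left, norm_neg]
    refine (sig_small h.κ₁_pos h.exp₁ ?_ (h.im₁ hz.2 _)).trans (by linarith [h.η_pos])
    rw [Complex.sub_re, Complex.ofReal_re]
    linarith [h.r_le_θ, h.θ_pos]
  B_gt t ht n hn z hz := by
    have h1 : t < n := Nat.lt_of_floor_lt hn
    have hre := abs_le.1 hz.1
    simp only [RCLike.re_eq_complex_re] at hre
    refine (sig_small h.κ₁_pos h.exp₁ ?_ (h.im₁ hz.2 _)).trans (by linarith [h.η_pos])
    rw [Complex.sub_re, Complex.ofReal_re]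
    linarith [h.r_le_θ, h.θ_le]
  balance t ht z hz w hw :=
    (convex_paramBox r δ t).norm_image_sub_le_of_norm_hasDerivWithin_le
      (fun u _ => (hasDerivAt_balance κ₂ ⌊t⌋₊
        (p := leftR κ₁ θ ⌊t⌋₊ t) (q := rightR κ₁ θ ⌊t⌋₊ t)
        (fun h0 => by simp [leftR, h0]) u).hasDerivWithinAt)
      (fun u hu => h.balance ht hu rfl rfl rfl) hw hz
  g_near n t ht := h.stepR_near n ht

theorem stepR_deriv_bounds (h : Scales θ κ₁ κ₂ r δ η) (n : ℕ) (t : ℝ) :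
    0 ≤ sigR κ₂ (t - stepStart n) - sigR κ₂ (t - (n + 1 : ℝ)) ∧
      sigR κ₂ (t - stepStart n) - sigR κ₂ (t - (n + 1 : ℝ)) ≤ 1 := by
  have := sigR_mono h.κ₂_pos.le (show t - (n + 1) ≤ t - stepStart n by linarith [stepStart_le n])
  constructor
  · linarith
  · linarith [sigR_le_one κ₂ (t - stepStart n), sigR_nonneg κ₂ (t - (n + 1))]

theorem realProfile (h : Scales θ κ₁ κ₂ r δ η) :
    RealProfile r η (stepR κ₂) (leftR κ₁ θ) (rightR κ₁ θ) where
  g_mono n t u htu := by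
    have hd : Differentiable ℝ (stepR κ₂ n) := fun s => (hasDerivAt_stepR κ₂ n s).differentiableAt
    have h1 := mul_sub_le_image_sub_of_le_deriv hd (C := 0) (fun s => by
      rw [(hasDerivAt_stepR κ₂ n s).deriv]; exact (h.stepR_deriv_bounds n s).1) htu
    have h2 := image_sub_le_mul_sub_of_deriv_le hd (C := 1) (fun s => by
      rw [(hasDerivAt_stepR κ₂ n s).deriv]; exact (h.stepR_deriv_bounds n s).2) htu
    constructor <;> linarith
  g_late n t u ht hu := by
    refine (convex_Ici ((n : ℝ) + 1 + 1 / 4)).norm_image_sub_le_of_norm_hasDerivWithin_le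
      (f := stepR κ₂ n)
      (fun s _ => (hasDerivAt_stepR κ₂ n s).hasDerivWithinAt) (fun s hs => ?_) hu ht
    rw [Real.norm_of_nonneg (h.stepR_deriv_bounds n s).1]
    have e1 := one_sub_sigR_small h.κ₂_pos h.exp₂ (s := s - (n + 1)) (by
      have : (n : ℝ) + 1 + 1 / 4 ≤ s := hs
      linarith [h.θ_le])
    linarith [sigR_le_one κ₂ (s - stepStart n), h.η_pos]
  g_early n t u hn ht hu := by
    refine (convex_Iic ((n : ℝ) - 1 / 4)).norm_image_sub_le_of_norm_hasDerivWithin_le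
      (f := stepR κ₂ n)
      (fun s _ => (hasDerivAt_stepR κ₂ n s).hasDerivWithinAt) (fun s hs => ?_) hu ht
    rw [Real.norm_of_nonneg (h.stepR_deriv_bounds n s).1]
    have e1 := sigR_small h.κ₂_pos h.exp₂ (s := s - stepStart n) (by
      have : s ≤ (n : ℝ) - 1 / 4 := hs
      rw [stepStart_pos (by omega)]
      linarith [h.θ_le])
    linarith [sigR_nonneg κ₂ (s - (n + 1)), h.η_pos]
  a_late n t ht := by
    unfold leftR
    split_ifs
    · exact h.η_pos.le
    · have := one_sub_sigR_small h.κ₁_pos h.exp₁ (s := t - (n + θ)) (by linarith [h.θ_le])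
      linarith [h.η_pos]
  b_early n t ht := by
    have := sigR_small h.κ₁_pos h.exp₁ (s := t - (n + 1 - θ)) (by linarith [h.θ_le])
    unfold rightR
    linarith [h.η_pos]
  a_near n t hn ht := by
    rw [leftR, if_neg (by omega)]
    have := sigR_small h.κ₁_pos h.exp₁ (s := t - (n + θ)) (by
      linarith [h.r_le_θ, h.r_pos, h.θ_pos])
    linarith [h.η_pos]
  b_near n t ht := by
    have := one_sub_sigR_small h.κ₁_pos h.exp₁ (s := t - (n + 1 - θ)) (by
      linarith [h.r_le_θ, h.r_pos, h.θ_pos])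
    unfold rightR
    linarith [h.η_pos]

/-- Away from the corners both transverse coefficients are small. -/
theorem coef_small (h : Scales θ κ₁ κ₂ r δ η) {n : ℕ} {t : ℝ} (h1 : n + 2 * θ ≤ t)
    (h2 : t ≤ n + 1 - 2 * θ) : leftR κ₁ θ n t + rightR κ₁ θ n t ≤ η := by
  have e1 := sigR_small h.κ₁_pos h.exp₁ (s := t - (n + 1 - θ)) (by linarith [h.θ_pos])
  have e2 := one_sub_sigR_small h.κ₁_pos h.exp₁ (s := t - (n + θ)) (by linarith [h.θ_pos])
  unfold leftR rightR
  split_ifs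
  · linarith [h.η_pos]
  · linarith [h.η_pos]

end Scales

/-- The restriction of a complex profile to the real line. -/
theorem Profile.toReal {r δ η K : ℝ} {γ A B : ℕ → ℂ → ℂ} {g a b : ℕ → ℝ → ℝ}
    (h : Profile ℂ r δ η K γ A B g a b) : Profile ℝ r δ η K g a b g a b := by
  have hg : ∀ n (t : ℝ), γ n (t : ℂ) = (g n t : ℂ) := h.γ_real
  have ha : ∀ n (t : ℝ), A n (t : ℂ) = (a n t : ℂ) := h.A_real
  have hb : ∀ n (t : ℝ), B n (t : ℂ) = (b n t : ℂ) := h.B_real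
  have hbox : ∀ {t z : ℝ}, z ∈ paramBox ℝ r δ t → (z : ℂ) ∈ paramBox ℂ r δ t := fun hz =>
    ⟨by simpa using hz.1, by simpa using hz.2⟩
  have him : ∀ z : ℝ, |RCLike.im (z : ℂ)| ≤ 3 * δ := fun z => by simpa using h.δ_pos.le
  constructor
  case r_pos => exact h.r_pos
  case r_le => exact h.r_le
  case δ_pos => exact h.δ_pos
  case δ_le => exact h.δ_le
  case η_pos => exact h.η_pos
  case η_le => exact h.η_le
  case K_nonneg => exact h.K_nonneg
  case K_le => exact h.K_le
  case bdd =>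
    intro z
    obtain ⟨C, hC⟩ := h.bdd (z : ℂ)
    refine ⟨C, fun n => ?_⟩
    have := hC n
    rwa [hg, ha, hb, Complex.norm_real, Complex.norm_real, Complex.norm_real] at this
  case A_zero =>
    intro z
    have := h.A_zero (z : ℂ)
    rw [ha] at this
    exact_mod_cast this
  case γ_real => intro n t; rfl
  case A_real => intro n t; rfl
  case B_real => intro n t; rfl
  case a_nonneg => exact h.a_nonneg
  case b_nonneg => exact h.b_nonneg
  case ab_le => exact h.ab_le
  case γ_lip =>
    intro n z w _ _
    have := h.γ_lip n (z : ℂ) (w : ℂ) (him z) (him w)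
    rwa [hg, hg, ← Complex.ofReal_sub, ← Complex.ofReal_sub, Complex.norm_real,
      Complex.norm_real] at this
  case A_lip =>
    intro n z w _ _
    have := h.A_lip n (z : ℂ) (w : ℂ) (him z) (him w)
    rwa [ha, ha, ← Complex.ofReal_sub, ← Complex.ofReal_sub, Complex.norm_real,
      Complex.norm_real] at this
  case B_lip =>
    intro n z w _ _
    have := h.B_lip n (z : ℂ) (w : ℂ) (him z) (him w)
    rwa [hb, hb, ← Complex.ofReal_sub, ← Complex.ofReal_sub, Complex.norm_real,
      Complex.norm_real] at this
  case A_lt =>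
    intro t ht n hn z hz
    have := h.A_lt t ht n hn z (hbox hz)
    rwa [ha, Complex.norm_real] at this
  case B_lt =>
    intro t ht n hn z hz
    have := h.B_lt t ht n hn z (hbox hz)
    rwa [hb, ← Complex.ofReal_one, ← Complex.ofReal_sub, Complex.norm_real] at this
  case A_gt =>
    intro t ht n hn z hz
    have := h.A_gt t ht n hn z (hbox hz)
    rwa [ha, ← Complex.ofReal_one, ← Complex.ofReal_sub, Complex.norm_real] at this
  case B_gt =>
    intro t ht n hn z hz
    have := h.B_gt t ht n hn z (hbox hz)
    rwa [hb, Complex.norm_real] at this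
  case balance =>
    intro t ht z hz w hw
    have := h.balance t ht z (hbox hz) w (hbox hw)
    simp only [hg, RCLike.ofReal_eq_complex_ofReal, ← Complex.ofReal_mul, ← Complex.ofReal_add,
      ← Complex.ofReal_sub, Complex.norm_real] at this
    exact this
  case g_near => exact h.g_near

end Profiles

/-! ### The gluing function, from a Fejér kernel -/

section Gluing

open Finset

/-- The derivative of the gluing function. -/
noncomputable def glueDeriv (M : ℕ) (t : ℝ) : ℝ :=
  1 + 1 / M - (1 / M ^ 2) *
    ∑ j ∈ range M, ∑ k ∈ range M, Real.cos (2 * Real.pi * ((j : ℝ) - k) * t)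

/-- The gluing function: the identity plus a trigonometric polynomial of period `1`. -/
noncomputable def glueR (M : ℕ) (t : ℝ) : ℝ :=
  t - (1 / M ^ 2) * ∑ j ∈ range M, ∑ k ∈ range M,
    Real.sin (2 * Real.pi * ((j : ℝ) - k) * t) / (2 * Real.pi * ((j : ℝ) - k))

/-- The entire extension of the gluing function. -/
noncomputable def glueC (M : ℕ) (z : ℂ) : ℂ :=
  z - ((1 / M ^ 2 : ℝ) : ℂ) * ∑ j ∈ range M, ∑ k ∈ range M,
    Complex.sin ((2 * Real.pi * ((j : ℝ) - k) : ℝ) * z) / (2 * Real.pi * ((j : ℝ) - k) : ℝ)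

theorem glueC_ofReal (M : ℕ) (t : ℝ) : glueC M (t : ℂ) = (glueR M t : ℂ) := by
  unfold glueC glueR
  push_cast
  rfl

/-- Division by zero makes the term `c = 0` constant, so the diagonal can stay in the double sums.
-/
theorem hasDerivAt_sin_div (c : ℂ) (z : ℂ) :
    HasDerivAt (fun z => Complex.sin (c * z) / c) (if c = 0 then 0 else Complex.cos (c * z)) z := by
  split_ifs with h
  · subst h; simpa using hasDerivAt_const z (0 : ℂ)
  · have h1 : HasDerivAt (fun z => c * z) c z := by simpa using (hasDerivAt_id z).const_mul c
    refine (h1.csin.div_const c).congr_deriv ?_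
    field_simp

theorem hasDerivAt_glueC (M : ℕ) (z : ℂ) :
    HasDerivAt (glueC M) (1 - ((1 / M ^ 2 : ℝ) : ℂ) * ∑ j ∈ range M, ∑ k ∈ range M,
      (if ((2 * Real.pi * ((j : ℝ) - k) : ℝ) : ℂ) = 0 then 0
        else Complex.cos ((2 * Real.pi * ((j : ℝ) - k) : ℝ) * z))) z := by
  refine (hasDerivAt_id z).sub (HasDerivAt.const_mul _ ?_)
  refine HasDerivAt.fun_sum fun j _ => HasDerivAt.fun_sum fun k _ => ?_
  exact hasDerivAt_sin_div _ z

theorem two_pi_mul_sub_eq_zero {j k : ℕ} : 2 * Real.pi * ((j : ℝ) - k) = 0 ↔ j = k := by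
  rw [mul_eq_zero, sub_eq_zero, Nat.cast_inj]
  simp [Real.pi_ne_zero]

theorem hasDerivAt_glueR {M : ℕ} (hM : 0 < M) (t : ℝ) :
    HasDerivAt (glueR M) (glueDeriv M t) t := by
  have h1 := (hasDerivAt_glueC M (t : ℂ)).real_of_complex
  simp only [glueC_ofReal, Complex.ofReal_re] at h1
  refine h1.congr_deriv ?_
  have h2 : ∀ j k : ℕ, (if ((2 * Real.pi * ((j : ℝ) - k) : ℝ) : ℂ) = 0 then 0
        else Complex.cos ((2 * Real.pi * ((j : ℝ) - k) : ℝ) * (t : ℂ)))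
      = ((Real.cos (2 * Real.pi * ((j : ℝ) - k) * t) - if j = k then 1 else 0 : ℝ) : ℂ) := by
    intro j k
    by_cases h : j = k
    · rw [if_pos (by rw [two_pi_mul_sub_eq_zero.2 h]; simp), if_pos h,
        two_pi_mul_sub_eq_zero.2 h]
      simp
    · rw [if_neg (by rw [Complex.ofReal_eq_zero, two_pi_mul_sub_eq_zero]; exact h), if_neg h,
        sub_zero, Complex.ofReal_cos]
      push_cast; rfl
  rw [Finset.sum_congr rfl fun j _ => Finset.sum_congr rfl fun k _ => h2 j k]
  simp only [← Complex.ofReal_sum, ← Complex.ofReal_mul, ← Complex.ofReal_one,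
    ← Complex.ofReal_sub, Complex.ofReal_re]
  -- The `M` diagonal terms are missing from the derivative but present in `glueDeriv`; divided by
  -- `M ^ 2` they give exactly its extra `1 / M`.
  have h3 : ∑ j ∈ range M, ∑ k ∈ range M, (if j = k then (1 : ℝ) else 0) = M := by
    rw [Finset.sum_congr rfl (g := fun _ => (1 : ℝ)) fun j hj => by
      rw [Finset.sum_ite_eq, if_pos hj]]
    simp
  simp only [Finset.sum_sub_distrib, h3, glueDeriv]
  have : (M : ℝ) ≠ 0 := by positivity
  generalize ∑ j ∈ range M, ∑ k ∈ range M, Real.cos (2 * Real.pi * ((j : ℝ) - k) * t) = s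
  field_simp
  ring

/-- This is `|∑ e^{2πijt}|²`. Its positivity bounds the slope of the gluing function above, and its
maximal value `M ^ 2`, taken at integers, makes that slope small there. -/
theorem sum_cos_eq (M : ℕ) (t : ℝ) :
    ∑ j ∈ range M, ∑ k ∈ range M, Real.cos (2 * Real.pi * ((j : ℝ) - k) * t) =
      (∑ j ∈ range M, Real.cos (2 * Real.pi * j * t)) ^ 2
        + (∑ j ∈ range M, Real.sin (2 * Real.pi * j * t)) ^ 2 := by
  rw [sq, sq, Finset.sum_mul_sum, Finset.sum_mul_sum, ← Finset.sum_add_distrib]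
  refine Finset.sum_congr rfl fun j _ => ?_
  rw [← Finset.sum_add_distrib]
  refine Finset.sum_congr rfl fun k _ => ?_
  rw [← Real.cos_sub]
  ring_nf

theorem glueDeriv_le {M : ℕ} (t : ℝ) : glueDeriv M t ≤ 1 + 1 / M := by
  rw [glueDeriv, sum_cos_eq]
  have : 0 ≤ 1 / (M : ℝ) ^ 2 * ((∑ j ∈ range M, Real.cos (2 * Real.pi * j * t)) ^ 2
        + (∑ j ∈ range M, Real.sin (2 * Real.pi * j * t)) ^ 2) := by positivity
  linarith

theorem glueDeriv_nonneg {M : ℕ} (hM : 0 < M) (t : ℝ) : 0 ≤ glueDeriv M t := by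
  have h1 : ∑ j ∈ range M, ∑ k ∈ range M, Real.cos (2 * Real.pi * ((j : ℝ) - k) * t) ≤
      ∑ j ∈ range M, ∑ k ∈ range M, (1 : ℝ) :=
    Finset.sum_le_sum fun j _ => Finset.sum_le_sum fun k _ => Real.cos_le_one _
  simp only [Finset.sum_const, card_range, nsmul_eq_mul, mul_one] at h1
  have hM' : (0 : ℝ) < M := by positivity
  have h2 := mul_le_mul_of_nonneg_left h1 (show 0 ≤ 1 / (M : ℝ) ^ 2 by positivity)
  have h3 : 1 / (M : ℝ) ^ 2 * (M * M) = 1 := by field_simp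
  have h4 : 0 < 1 / (M : ℝ) := by positivity
  rw [glueDeriv]
  linarith

theorem glueDeriv_zero {M : ℕ} (hM : 0 < M) : glueDeriv M 0 = 1 / M := by
  have hM' : (M : ℝ) ≠ 0 := by positivity
  simp only [glueDeriv, mul_zero, Real.cos_zero, Finset.sum_const, card_range, nsmul_eq_mul,
    mul_one]
  field_simp
  ring

theorem two_pi_mul_add (j k : ℕ) (t : ℝ) (n : ℤ) : 2 * Real.pi * ((j : ℝ) - k) * (t + n) =
    2 * Real.pi * ((j : ℝ) - k) * t + ((((j : ℤ) - k) * n : ℤ) : ℝ) * (2 * Real.pi) := by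
  push_cast; ring

theorem glueDeriv_add_int (M : ℕ) (t : ℝ) (n : ℤ) : glueDeriv M (t + n) = glueDeriv M t := by
  simp only [glueDeriv, two_pi_mul_add, Real.cos_add_int_mul_two_pi]

theorem glueR_add_int (M : ℕ) (t : ℝ) (n : ℤ) : glueR M (t + n) = glueR M t + n := by
  simp only [glueR, two_pi_mul_add, Real.sin_add_int_mul_two_pi]
  ring

/-- The function commutes with integer translations and fixes integers, so the slope bound `1 + 1 /
M`, applied from both ends of a period, controls it from both sides. -/
theorem glueR_near {M : ℕ} (hM : 0 < M) (t : ℝ) : |glueR M t - t| ≤ 1 / M := by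
  have h0 : glueR M 0 = 0 := by simp [glueR]
  have h1 : glueR M 1 = 1 := by
    have := glueR_add_int M 0 1
    rw [h0] at this
    simpa using this
  have hd : Differentiable ℝ (glueR M) := fun s => (hasDerivAt_glueR hM s).differentiableAt
  have hle : ∀ s, deriv (glueR M) s ≤ 1 + 1 / M := fun s => by
    rw [(hasDerivAt_glueR hM s).deriv]; exact glueDeriv_le s
  have e1 := image_sub_le_mul_sub_of_deriv_le hd hle (Int.fract_nonneg t)
  have e2 := image_sub_le_mul_sub_of_deriv_le hd hle (Int.fract_lt_one t).le
  have e3 := glueR_add_int M (Int.fract t) ⌊t⌋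
  rw [Int.fract_add_floor] at e3
  have e4 : glueR M t - t = glueR M (Int.fract t) - Int.fract t := by
    rw [e3]; linarith [Int.floor_add_fract t]
  rw [e4, abs_le]
  rw [h0] at e1
  rw [h1] at e2
  have hM' : (0 : ℝ) < 1 / M := by positivity
  have e5 := mul_le_mul_of_nonneg_left (Int.fract_lt_one t).le hM'.le
  have e6 := mul_nonneg hM'.le (Int.fract_nonneg t)
  constructor <;> linarith

theorem continuous_glueDeriv (M : ℕ) : Continuous (glueDeriv M) := by
  unfold glueDeriv; fun_prop

theorem norm_cos_le (z : ℂ) : ‖Complex.cos z‖ ≤ Real.exp |z.im| := by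
  rw [Complex.cos, norm_div, Complex.norm_ofNat, div_le_iff₀ two_pos]
  refine (norm_add_le _ _).trans ?_
  rw [Complex.norm_exp, Complex.norm_exp]
  have h1 : (z * Complex.I).re = -z.im := by simp
  have h2 : (-z * Complex.I).re = z.im := by simp
  rw [h1, h2]
  have h3 := Real.exp_le_exp.2 (neg_le_abs z.im)
  have h4 := Real.exp_le_exp.2 (le_abs_self z.im)
  linarith

theorem exists_glueC_lip (M : ℕ) : ∃ L : ℝ, 0 < L ∧ ∀ z w : ℂ, |z.im| ≤ 1 → |w.im| ≤ 1 →
    ‖glueC M z - glueC M w‖ ≤ L * ‖z - w‖ := by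
  set S : ℝ := ∑ j ∈ range M, ∑ k ∈ range M, Real.exp |2 * Real.pi * ((j : ℝ) - k)| with hS
  have hS0 : 0 ≤ S := Finset.sum_nonneg fun j _ => Finset.sum_nonneg fun k _ => Real.exp_nonneg _
  refine ⟨1 + |1 / (M : ℝ) ^ 2| * S, by positivity, fun z w hz hw => ?_⟩
  refine (convex_strip 1).norm_image_sub_le_of_norm_hasDerivWithin_le
    (fun u _ => (hasDerivAt_glueC M u).hasDerivWithinAt) (fun u hu => ?_) hw hz
  refine (norm_sub_le _ _).trans ?_
  rw [norm_one, norm_mul, Complex.norm_real, Real.norm_eq_abs]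
  refine add_le_add le_rfl (mul_le_mul_of_nonneg_left ?_ (abs_nonneg _))
  refine (norm_sum_le _ _).trans (Finset.sum_le_sum fun j _ =>
    (norm_sum_le _ _).trans (Finset.sum_le_sum fun k _ => ?_))
  split_ifs
  · rw [norm_zero]; exact Real.exp_nonneg _
  · refine (norm_cos_le _).trans (Real.exp_le_exp.2 ?_)
    rw [Complex.im_ofReal_mul, abs_mul]
    exact mul_le_of_le_one_right (abs_nonneg _) hu

/-- The gluing function: close to the identity, with derivative nearly bounded by `1`, and bounded
by `1 / 2` near the integers. -/
theorem exists_gluing {c : ℝ} (hc : 0 < c) : ∃ (α α' : ℝ → ℝ) (αc : ℂ → ℂ) (ω L : ℝ),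
    0 < ω ∧ 0 < L ∧ Differentiable ℂ αc ∧ (∀ t : ℝ, αc (t : ℂ) = (α t : ℂ)) ∧
    (∀ t, HasDerivAt α (α' t) t) ∧ (∀ t, 0 ≤ α' t ∧ α' t ≤ 1 + c) ∧
    (∀ (n : ℕ) (t : ℝ), |t - n| ≤ ω → α' t ≤ 1 / 2) ∧ (∀ t, |α t - t| ≤ c) ∧
    ∀ z w : ℂ, |z.im| ≤ 1 → |w.im| ≤ 1 → ‖αc z - αc w‖ ≤ L * ‖z - w‖ := by
  obtain ⟨m, hm⟩ := exists_nat_one_div_lt (show 0 < min c (1 / 2) by positivity)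
  have hm1 : 1 / ((m + 1 : ℕ) : ℝ) < c := by push_cast; exact hm.trans_le (min_le_left _ _)
  have hm2 : 1 / ((m + 1 : ℕ) : ℝ) < 1 / 2 := by push_cast; exact hm.trans_le (min_le_right _ _)
  have hM : 0 < m + 1 := Nat.succ_pos m
  generalize m + 1 = M at hm1 hm2 hM
  obtain ⟨L, hL, hlip⟩ := exists_glueC_lip M
  have hlt : ∀ᶠ t in nhds (0 : ℝ), glueDeriv M t < 1 / 2 :=
    (continuous_glueDeriv M).continuousAt.eventually_lt continuousAt_const
      (by rw [glueDeriv_zero hM]; exact hm2)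
  obtain ⟨ω, hω, hball⟩ := Metric.eventually_nhds_iff.1 hlt
  refine ⟨glueR M, glueDeriv M, glueC M, ω / 2, L, by positivity, hL,
    fun z => (hasDerivAt_glueC M z).differentiableAt, glueC_ofReal M, hasDerivAt_glueR hM,
    fun t => ⟨glueDeriv_nonneg hM t, (glueDeriv_le t).trans (by linarith)⟩, fun n t ht => ?_,
    fun t => (glueR_near hM t).trans hm1.le, hlip⟩
  have h1 := hball (y := t - n) (by rw [Real.dist_eq, sub_zero]; linarith)
  have h2 := glueDeriv_add_int M (t - n) n
  rw [Int.cast_natCast, sub_add_cancel] at h2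
  rw [h2]
  exact h1.le

end Gluing

/-! ### Inverses on open neighbourhoods of the tube, and the choice of scales -/

section Assembly

open Filter Topology

instance BddSeq.instNonempty {𝕜 : Type} [RCLike 𝕜] : Nonempty (BddSeq 𝕜) := ⟨0⟩

theorem Profile.analyticAt_inv {𝕜 : Type} [RCLike 𝕜] {r δ η K : ℝ} {γ A B : ℕ → 𝕜 → 𝕜}
    {g a b : ℕ → ℝ → ℝ} (h : Profile 𝕜 r δ η K γ A B g a b) {U : Set (BddSeq 𝕜)} (hU : IsOpen U)
    (hUd : U ⊆ tubeDom 𝕜 r δ) {x : BddSeq 𝕜} (hx : x ∈ U)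
    (ha : AnalyticAt 𝕜 (tubeMap γ A B) x) :
    AnalyticAt 𝕜 (Function.invFunOn (tubeMap γ A B) U) (tubeMap γ A B x) := by
  obtain ⟨τ, hτ, hball⟩ := Metric.isOpen_iff.1 hU x hx
  have hδ := h.δ_pos
  refine analyticAt_invFunOn (C := 10) (ρ := min (δ / 4) (τ / 10)) hU (h.injOn_tubeMap.mono hUd) hx
    ha (by positivity) fun u hu => ?_
  obtain ⟨x', h1, h2⟩ := h.exists_preimage_near (hUd hx) (hu.le.trans (min_le_left _ _))
  refine ⟨x', hball ?_, h1, h2⟩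
  rw [Metric.mem_ball, dist_eq_norm]
  linarith [hu.trans_le (min_le_right _ _)]

/-- A neighbourhood of the straight tube. -/
def thickTube (r δ : ℝ) : Set EllInf := Metric.thickening (δ / 200) (straightTube r)

/-- A complex neighbourhood of the straight tube. -/
def thickTubeC (r δ : ℝ) : Set EllInfC :=
  Metric.thickening (δ / 200) ((fun x => cplx x 0) '' straightTube r)

theorem isOpen_thickTube (r δ : ℝ) : IsOpen (thickTube r δ) := Metric.isOpen_thickening

theorem isOpen_thickTubeC (r δ : ℝ) : IsOpen (thickTubeC r δ) := Metric.isOpen_thickening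

theorem mem_thickTube {r δ : ℝ} {x x' : EllInf} (hx : x ∈ straightTube r)
    (h : ‖x' - x‖ < δ / 200) : x' ∈ thickTube r δ :=
  Metric.mem_thickening_iff.2 ⟨x, hx, by rwa [dist_eq_norm]⟩

theorem mem_thickTubeC {r δ : ℝ} {x : EllInf} {z : EllInfC} (hx : x ∈ straightTube r)
    (h : ‖z - cplx x 0‖ < δ / 200) : z ∈ thickTubeC r δ :=
  Metric.mem_thickening_iff.2 ⟨cplx x 0, mem_image_of_mem _ hx, by rwa [dist_eq_norm]⟩

theorem thickTube_subset {r δ : ℝ} (hr : δ ≤ r) (hδ : 0 < δ) :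
    thickTube r δ ⊆ tubeDom ℝ r δ := by
  intro x hx
  obtain ⟨s, hs, hxs⟩ := Metric.mem_thickening_iff.1 hx
  rw [dist_eq_norm] at hxs
  have h1 : ∀ n, |x n - s n| < δ / 200 := fun n => (BddSeq.sub_apply_le x s n).trans_lt hxs
  refine ⟨?_, fun n hn => ?_, fun n => by simpa using by linarith⟩
  · have := abs_lt.1 (h1 0)
    simp only [RCLike.re_to_real]
    linarith [hs.1]
  · have := abs_lt.1 (h1 n)
    have := abs_lt.1 (hs.2 n hn)
    simp only [RCLike.re_to_real]
    rw [abs_le]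
    constructor <;> linarith

theorem thickTubeC_subset {r δ : ℝ} (hr : δ ≤ r) (hδ : 0 < δ) :
    thickTubeC r δ ⊆ tubeDom ℂ r δ := by
  intro z hz
  obtain ⟨_, ⟨s, hs, rfl⟩, hzs⟩ := Metric.mem_thickening_iff.1 hz
  rw [dist_eq_norm] at hzs
  have h0 : ∀ n, ‖z n - (s n : ℂ)‖ < δ / 200 := fun n =>
    (BddSeq.sub_apply_le z (cplx s 0) n).trans_lt hzs
  have h1 : ∀ n, |RCLike.re (z n) - s n| < δ / 200 := fun n =>
    (abs_re_sub_le (z n) (s n)).trans_lt (h0 n)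
  have h2 : ∀ n, |RCLike.im (z n)| < δ / 200 := fun n =>
    (abs_im_le_norm_sub_ofReal (z n) (s n)).trans_lt (h0 n)
  refine ⟨?_, fun n hn => ?_, fun n => by linarith [h2 n]⟩
  · have := abs_lt.1 (h1 0)
    linarith [hs.1]
  · have := abs_lt.1 (h1 n)
    have := abs_lt.1 (hs.2 n hn)
    rw [abs_le]
    constructor <;> linarith

theorem stairPath_apply {t : ℝ} (ht : 0 ≤ t) (n : ℕ) : stairPath t n = stair n t := by
  change stairCoord t n = stair n t
  have hn : (0 : ℝ) ≤ n := n.cast_nonneg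
  unfold stairCoord stair
  split_ifs with h1 h2 h3 h4 h5
  · subst h2; rw [min_eq_right]; push_cast at h1; linarith
  · rw [min_eq_right (by linarith)]; norm_num
  · subst h4; push_cast at h1 ⊢; rw [min_eq_left] <;> linarith
  · rw [min_eq_left (by linarith), max_eq_right (by linarith)]
  · subst h5; push_cast at h3; linarith
  · rw [min_eq_left (by linarith), max_eq_left (by linarith)]

namespace Profile

variable {r δ η K : ℝ} {γ A B : ℕ → ℂ → ℂ} {g a b : ℕ → ℝ → ℝ}

theorem tubeMap_cplx (h : Profile ℂ r δ η K γ A B g a b) (x : EllInf) :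
    tubeMap γ A B (cplx x 0) = cplx (tubeMap g a b x) 0 := by
  have hg : ∀ n (t : ℝ), γ n (t : ℂ) = (g n t : ℂ) := h.γ_real
  have ha : ∀ n (t : ℝ), A n (t : ℂ) = (a n t : ℂ) := h.A_real
  have hb : ∀ n (t : ℝ), B n (t : ℂ) = (b n t : ℂ) := h.B_real
  ext n
  rw [h.tubeMap_apply, cplx_zero_apply, cplx_zero_apply, cplx_zero_apply, cplx_zero_apply,
    h.toReal.tubeMap_apply, hg, ha, hb]
  push_cast
  rfl

/-- The complex tube map is Lipschitz near the straight tube. -/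
theorem norm_tubeMap_sub_le (h : Profile ℂ r δ η K γ A B g a b) {x y : EllInf}
    (hx : x ∈ straightTube r) (hy : ‖y‖ ≤ δ) :
    ‖tubeMap γ A B (cplx x y) - cplx (tubeMap g a b x) 0‖ ≤ 10 * ‖y‖ := by
  have hr := h.r_pos
  have hKr : K * r ≤ 1 := by linarith [h.K_le, h.η_le]
  have hd0 := norm_nonneg y
  have hz : ∀ n, ‖cplx x y n - (x n : ℂ)‖ ≤ ‖y‖ := fun n =>
    (BddSeq.sub_apply_le (cplx x y) (cplx x 0) n).trans (norm_cplx_sub x y)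
  have him : |RCLike.im (cplx x y 0)| ≤ 3 * δ := by
    have : |y 0| ≤ ‖y‖ := BddSeq.apply_le y 0
    change |y 0| ≤ _
    linarith [h.δ_pos]
  have him' : |RCLike.im ((x 0 : ℝ) : ℂ)| ≤ 3 * δ := by simpa using h.δ_pos.le
  have hyr : ‖y‖ ≤ r := hy.trans (by linarith [h.δ_le_r])
  have side : ∀ (c : ℂ → ℂ) (s : ℝ) (m : ℕ), 1 ≤ m → c (x 0) = (s : ℂ) → |s| ≤ 1 →
      ‖c (cplx x y 0) - c (x 0)‖ ≤ K * ‖cplx x y 0 - (x 0 : ℂ)‖ →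
      ‖c (cplx x y 0) * cplx x y m - c (x 0) * (x m : ℂ)‖ ≤ 3 * ‖y‖ := by
    intro c s m hm hc hs hl
    have h1 : ‖c (cplx x y 0) - c (x 0)‖ ≤ K * ‖y‖ :=
      hl.trans (mul_le_mul_of_nonneg_left (hz 0) h.K_nonneg)
    have h2 : ‖c (x 0)‖ ≤ 1 := by rwa [hc, Complex.norm_real]
    have h3 : K * ‖y‖ ≤ 1 := (mul_le_mul_of_nonneg_left hyr h.K_nonneg).trans hKr
    have h4 : ‖c (cplx x y 0)‖ ≤ 2 := by
      have := norm_add_le (c (cplx x y 0) - c (x 0)) (c (x 0))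
      rw [sub_add_cancel] at this
      linarith
    have h5 := norm_mul_sub_mul_le h4 (v' := (x m : ℂ)) (q := r)
      (by rw [Complex.norm_real]; exact (hx.2 m hm).le) h1 (hz m)
    have h6 := mul_le_mul_of_nonneg_right hKr hd0
    linarith
  rw [← h.tubeMap_cplx]
  refine BddSeq.norm_sub_le (by positivity) fun n => ?_
  rw [h.tubeMap_apply, h.tubeMap_apply, cplx_zero_apply, cplx_zero_apply, cplx_zero_apply]
  have e1 : ‖γ n (cplx x y 0) - γ n (x 0)‖ ≤ 4 * ‖y‖ :=
    (h.γ_lip n _ _ him him').trans (by linarith [hz 0])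
  have e2 : ‖A n (cplx x y 0) * cplx x y n - A n (x 0) * (x n : ℂ)‖ ≤ 3 * ‖y‖ := by
    rcases Nat.eq_zero_or_pos n with h0 | h0
    · subst h0
      rw [h.A_zero, h.A_zero, zero_mul, zero_mul, sub_zero, norm_zero]; positivity
    · exact side (A n) (a n (x 0)) n h0 (h.A_real n _)
        (by rw [abs_of_nonneg (h.a_nonneg _ _)]; exact h.a_le_one _ _) (h.A_lip n _ _ him him')
  have e3 := side (B n) (b n (x 0)) (n + 1) (by omega) (h.B_real n _)
        (by rw [abs_of_nonneg (h.b_nonneg _ _)]; exact h.b_le_one _ _) (h.B_lip n _ _ him him')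
  have e : ∀ u v w u' v' w' : ℂ,
      u + v - w - (u' + v' - w') = (u - u') + (v - v') - (w - w') := by intros; ring
  rw [e]
  refine (norm_sub_le _ _).trans ?_
  have := norm_add_le (γ n (cplx x y 0) - γ n (x 0))
    (A n (cplx x y 0) * cplx x y n - A n (x 0) * (x n : ℂ))
  linarith

/-- The inverse of the real tube map. -/
noncomputable def _root_.tubeInv (g a b : ℕ → ℝ → ℝ) (r δ : ℝ) : EllInf → EllInf :=
  Function.invFunOn (tubeMap g a b) (thickTube r δ)

/-- The inverse of the complex tube map. -/
noncomputable def _root_.tubeInvC (γ A B : ℕ → ℂ → ℂ) (r δ : ℝ) : EllInfC → EllInfC :=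
  Function.invFunOn (tubeMap γ A B) (thickTubeC r δ)

theorem straight_subset_thick (h : Profile ℂ r δ η K γ A B g a b) :
    straightTube r ⊆ thickTube r δ := fun x hx =>
  mem_thickTube hx (by rw [sub_self, norm_zero]; linarith [h.δ_pos])

theorem cplx_mem_thick (h : Profile ℂ r δ η K γ A B g a b) {x : EllInf}
    (hx : x ∈ straightTube r) : cplx x 0 ∈ thickTubeC r δ :=
  mem_thickTubeC hx (by rw [sub_self, norm_zero]; linarith [h.δ_pos])

theorem injOn_thick (h : Profile ℂ r δ η K γ A B g a b) :
    InjOn (tubeMap g a b) (thickTube r δ) :=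
  h.toReal.injOn_tubeMap.mono (thickTube_subset (by linarith [h.δ_le_r, h.r_pos]) h.δ_pos)

theorem injOn_thickC (h : Profile ℂ r δ η K γ A B g a b) :
    InjOn (tubeMap γ A B) (thickTubeC r δ) :=
  h.injOn_tubeMap.mono (thickTubeC_subset (by linarith [h.δ_le_r, h.r_pos]) h.δ_pos)

theorem tubeInv_tubeMap (h : Profile ℂ r δ η K γ A B g a b) {x : EllInf} (hx : x ∈ thickTube r δ) :
    tubeInv g a b r δ (tubeMap g a b x) = x := h.injOn_thick.leftInvOn_invFunOn hx

theorem tubeInvC_tubeMap (h : Profile ℂ r δ η K γ A B g a b) {z : EllInfC}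
    (hz : z ∈ thickTubeC r δ) : tubeInvC γ A B r δ (tubeMap γ A B z) = z :=
  h.injOn_thickC.leftInvOn_invFunOn hz

/-- Lipschitz bounds at a single point are enough to bound the derivative of the inverse there, so
that derivative is never computed. The margin `δ / 1000`, multiplied by at most `4`, keeps preimages
in the thickened tube. -/
theorem tubeInv_near (h : Profile ℂ r δ η K γ A B g a b) (h' : RealProfile r η g a b)
    {x : EllInf} (hx : x ∈ straightTube r) {t : ℝ} (ht : t = max (x 0) 0) :
    ∀ᶠ u in 𝓝 (tubeMap g a b x),
      ‖tubeInv g a b r δ u - x‖ ≤ (2 + 5 * η) * (1 + 100 * η) * ‖u - tubeMap g a b x‖ ∧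
      |tubeInv g a b r δ u 0 - x 0| ≤
        (1 + a ⌊t⌋₊ t + b ⌊t⌋₊ t) * (1 + 100 * η) * ‖u - tubeMap g a b x‖ := by
  have hδ := h.δ_pos
  have hη := h.η_pos
  have hη1 := h.η_le
  filter_upwards [Metric.ball_mem_nhds (tubeMap g a b x) (show 0 < δ / 1000 by positivity)]
    with u hu
  rw [Metric.mem_ball, dist_eq_norm] at hu
  obtain ⟨x', h1, h2, h3⟩ := h.toReal.exists_preimage_real h'
    (h.toReal.straightTube_subset hx) (u := u) (by linarith) ht
  have hx' : x' ∈ thickTube r δ := mem_thickTube hx (by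
    have h4 : (2 + 5 * η) * (1 + 100 * η) ≤ 4 := by nlinarith
    have := mul_le_mul_of_nonneg_right h4 (norm_nonneg (u - tubeMap g a b x))
    linarith)
  rw [← h1, h.tubeInv_tubeMap hx', h1]
  exact ⟨h2, h3⟩

theorem norm_fderiv_tubeInv_le (h : Profile ℂ r δ η K γ A B g a b) (h' : RealProfile r η g a b)
    {x : EllInf} (hx : x ∈ straightTube r) :
    ‖fderiv ℝ (tubeInv g a b r δ) (tubeMap g a b x)‖ ≤ (2 + 5 * η) * (1 + 100 * η) := by
  have hη := h.η_pos
  refine norm_fderiv_le_of_lip' ℝ (by positivity) ((h.tubeInv_near h' hx rfl).mono fun u hu => ?_)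
  rw [h.tubeInv_tubeMap (h.straight_subset_thick hx)]
  exact hu.1

theorem norm_fderiv_tubeInv_zero_le (h : Profile ℂ r δ η K γ A B g a b)
    (h' : RealProfile r η g a b) {x : EllInf} (hx : x ∈ straightTube r) {t : ℝ}
    (ht : t = max (x 0) 0) :
    ‖fderiv ℝ (fun u => tubeInv g a b r δ u 0) (tubeMap g a b x)‖ ≤
      (1 + a ⌊t⌋₊ t + b ⌊t⌋₊ t) * (1 + 100 * η) := by
  have hη := h.η_pos
  have ha := h.a_nonneg ⌊t⌋₊ t
  have hb := h.b_nonneg ⌊t⌋₊ t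
  refine norm_fderiv_le_of_lip' ℝ (by positivity) ((h.tubeInv_near h' hx ht).mono fun u hu => ?_)
  rw [h.tubeInv_tubeMap (h.straight_subset_thick hx)]
  exact hu.2

theorem tubeInvC_near (h : Profile ℂ r δ η K γ A B g a b)
    (hG : AnalyticOnNhd ℂ (tubeMap γ A B) univ) {x : EllInf} (hx : x ∈ straightTube r)
    {v : EllInf} (hv : ‖v‖ < δ / 4000) :
    AnalyticAt ℂ (tubeInvC γ A B r δ) (cplx (tubeMap g a b x) v) ∧
      ‖tubeInvC γ A B r δ (cplx (tubeMap g a b x) v) - cplx x 0‖ ≤ 10 * ‖v‖ := by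
  have hδ := h.δ_pos
  have hsub : thickTubeC r δ ⊆ tubeDom ℂ r δ :=
    thickTubeC_subset (by linarith [h.δ_le_r, h.r_pos]) h.δ_pos
  have hw : ‖cplx (tubeMap g a b x) v - tubeMap γ A B (cplx x 0)‖ ≤ ‖v‖ := by
    rw [h.tubeMap_cplx]; exact norm_cplx_sub _ _
  obtain ⟨z, h1, h2⟩ := h.exists_preimage_near (hsub (h.cplx_mem_thick hx))
    (hw.trans (by linarith))
  have hz : ‖z - cplx x 0‖ ≤ 10 * ‖v‖ := h2.trans (by linarith)
  have hzU : z ∈ thickTubeC r δ := mem_thickTubeC hx (by linarith)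
  rw [← h1]
  refine ⟨h.analyticAt_inv (isOpen_thickTubeC r δ) hsub hzU (hG _ (mem_univ _)), ?_⟩
  rw [h.tubeInvC_tubeMap hzU]
  exact hz

end Profile

/-- The scales can be chosen one after the other. -/
theorem exists_scales {θ η c : ℝ} (hθ : 0 < θ) (hθ4 : θ ≤ 1 / 4) (hη : 0 < η)
    (hη1 : η ≤ 1 / 1000000) (hc : 0 < c) :
    ∃ κ₁ κ₂ r δ : ℝ, r < c ∧ Scales θ κ₁ κ₂ r δ η := by
  -- The threshold makes the exponent at least `8 / η`, and `exp x ≥ x` does the rest.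
  have hexp : ∀ κ : ℝ, 32 / (θ * η) ≤ κ → 2 * Real.exp (-(κ * (θ / 4))) ≤ η / 4 := by
    intro κ hκ
    have h1 : 8 / η ≤ κ * (θ / 4) := by
      have := mul_le_mul_of_nonneg_right hκ (show 0 ≤ θ / 4 by positivity)
      refine le_trans (le_of_eq ?_) this
      field_simp
      norm_num
    have h2 := Real.add_one_le_exp (κ * (θ / 4))
    have h3 : 8 / η ≤ Real.exp (κ * (θ / 4)) := by linarith
    rw [Real.exp_neg]
    have h4 := inv_anti₀ (show 0 < 8 / η by positivity) h3
    rw [inv_div] at h4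
    linarith
  set κ₁ := 32 / (θ * η) with hκ₁
  have hκ₁0 : 0 < κ₁ := by positivity
  set r := min (min (c / 2) (1 / 10000)) (min (θ / 8000) (η / (48000 * κ₁))) with hr
  have hr0 : 0 < r := by positivity
  have r1 : r ≤ c / 2 := (min_le_left _ _).trans (min_le_left _ _)
  have r2 : r ≤ 1 / 10000 := (min_le_left _ _).trans (min_le_right _ _)
  have r3 : r ≤ θ / 8000 := (min_le_right _ _).trans (min_le_left _ _)
  have r4 : r ≤ η / (48000 * κ₁) := (min_le_right _ _).trans (min_le_right _ _)
  -- The first summand gives the exponential condition already known for `κ₁`, the second gives `2 /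
  -- κ₂ ≤ η r`; only now that `r` is fixed can it be chosen.
  set κ₂ := κ₁ + 2 / (η * r) with hκ₂
  have hκ₂0 : 0 < κ₂ := by positivity
  set δ := min (η * r) (min (1 / (3 * κ₁)) (1 / (3 * κ₂))) with hδ
  have hδ0 : 0 < δ := by positivity
  have d2 : δ ≤ 1 / (3 * κ₁) := (min_le_right _ _).trans (min_le_left _ _)
  have d3 : δ ≤ 1 / (3 * κ₂) := (min_le_right _ _).trans (min_le_right _ _)
  refine ⟨κ₁, κ₂, r, δ, by linarith, ?_⟩
  exact
    { θ_pos := hθ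
      θ_le := hθ4
      κ₁_pos := hκ₁0
      κ₂_pos := hκ₂0
      r_pos := hr0
      r_le := r2
      r_le_θ := by linarith
      δ_pos := hδ0
      δ_le := min_le_left _ _
      η_pos := hη
      η_le := hη1
      exp₁ := hexp κ₁ le_rfl
      exp₂ := hexp κ₂ (le_add_of_nonneg_right (by positivity))
      κ₁_r := by
        rw [le_div_iff₀ (by positivity)] at r4
        linarith
      κ₂_r := by
        have h1 : 2 / (η * r) ≤ κ₂ := le_add_of_nonneg_left hκ₁0.le
        rw [div_le_iff₀ (by positivity)] at h1
        rw [div_le_iff₀ hκ₂0]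
        linarith
      κ₁_δ := by
        rw [le_div_iff₀ (by positivity)] at d2
        linarith
      κ₂_δ := by
        rw [le_div_iff₀ (by positivity)] at d3
        linarith }

/-- The gluing function compensates the derivative of the inverse tube map near the corners. -/
theorem Scales.glue_bound {θ κ₁ κ₂ r δ η ε : ℝ} (h : Scales θ κ₁ κ₂ r δ η) (hε : ε ≤ 1)
    (hη : η = ε / 1000000) {α' : ℝ → ℝ} {ω : ℝ} (hω : 2 * θ ≤ ω)
    (h1 : ∀ t, 0 ≤ α' t ∧ α' t ≤ 1 + ε / 8)
    (h2 : ∀ (n : ℕ) (t : ℝ), |t - n| ≤ ω → α' t ≤ 1 / 2) {s t : ℝ} (ht : t = max s 0) :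
    α' s * ((1 + leftR κ₁ θ ⌊t⌋₊ t + rightR κ₁ θ ⌊t⌋₊ t) * (1 + 100 * η)) ≤ 1 + ε := by
  have hη0 := h.η_pos
  have hη1 := h.η_le
  have hab := h.leftR_add_rightR_le ⌊t⌋₊ t
  have ha : 0 ≤ leftR κ₁ θ ⌊t⌋₊ t := Scales.leftR_nonneg ⌊t⌋₊ t
  have hb : 0 ≤ rightR κ₁ θ ⌊t⌋₊ t := sigR_nonneg _ _
  have small : leftR κ₁ θ ⌊t⌋₊ t + rightR κ₁ θ ⌊t⌋₊ t ≤ η →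
      α' s * ((1 + leftR κ₁ θ ⌊t⌋₊ t + rightR κ₁ θ ⌊t⌋₊ t) * (1 + 100 * η)) ≤ 1 + ε := by
    intro h3
    have h4 : (1 + leftR κ₁ θ ⌊t⌋₊ t + rightR κ₁ θ ⌊t⌋₊ t) * (1 + 100 * η) ≤ 1 + 102 * η := by
      have := mul_le_mul_of_nonneg_right (show 1 + leftR κ₁ θ ⌊t⌋₊ t + rightR κ₁ θ ⌊t⌋₊ t ≤ 1 + η by
        linarith) (show 0 ≤ 1 + 100 * η by positivity)
      nlinarith
    have h5 := mul_le_mul (h1 s).2 h4 (by positivity) (by linarith)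
    nlinarith
  have corner : α' s ≤ 1 / 2 →
      α' s * ((1 + leftR κ₁ θ ⌊t⌋₊ t + rightR κ₁ θ ⌊t⌋₊ t) * (1 + 100 * η)) ≤ 1 + ε := by
    intro h3
    have h4 : (1 + leftR κ₁ θ ⌊t⌋₊ t + rightR κ₁ θ ⌊t⌋₊ t) * (1 + 100 * η) ≤ 2 * (1 + 100 * η) :=
      mul_le_mul_of_nonneg_right (by linarith) (by positivity)
    have h5 := mul_le_mul h3 h4 (by positivity) (by norm_num)
    linarith
  -- Inside a segment `a + b ≤ η`. Within `2 θ` of an integer the slope `1/2` compensates the factor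
  -- `2`. Before time `0` the frozen time is `0`, where `a = 0` and `b ≤ η`.
  rcases le_total 0 s with hs | hs
  · rw [max_eq_left hs] at ht
    have f1 : (⌊t⌋₊ : ℝ) ≤ t := Nat.floor_le (ht ▸ hs)
    have f2 : t < ⌊t⌋₊ + 1 := Nat.lt_floor_add_one t
    rcases le_total ((⌊t⌋₊ : ℝ) + 2 * θ) t with h3 | h3
    · rcases le_total t ((⌊t⌋₊ : ℝ) + 1 - 2 * θ) with h4 | h4
      · exact small (h.coef_small h3 h4)
      · refine corner (h2 (⌊t⌋₊ + 1) s ?_)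
        rw [← ht, abs_le]
        push_cast
        constructor <;> linarith
    · refine corner (h2 ⌊t⌋₊ s ?_)
      rw [← ht, abs_le]
      constructor <;> linarith
  · rw [max_eq_right hs] at ht
    refine small ?_
    rw [ht, Nat.floor_zero]
    have h3 := h.realProfile.b_early 0 0 (by norm_num)
    have h4 : leftR κ₁ θ 0 0 = 0 := by simp [leftR]
    rw [h4]
    linarith

end Assembly

/-! ### The tube lies between two neighbourhoods of the path -/

section Neighbourhoods

open Filter Topology

theorem stairImage_nonempty : stairImage.Nonempty := ⟨stairPath 0, 0, le_refl (0 : ℝ), rfl⟩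

namespace Profile

variable {r δ η K : ℝ} {g a b : ℕ → ℝ → ℝ}

theorem exists_preimage_of_near_stairPath (h : Profile ℝ r δ η K g a b g a b)
    (h' : RealProfile r η g a b) {t : ℝ} (ht : 0 ≤ t) {u : EllInf}
    (hu : ‖u - stairPath t‖ ≤ r / 2) :
    ∃ x ∈ straightTube r, tubeMap g a b x = u ∧ |x 0 - t| ≤ 2 * r :=
  h.exists_mem_straightTube h' ht fun n => by
    rw [← stairPath_apply ht]
    exact (BddSeq.sub_apply_le u (stairPath t) n).trans hu

theorem stairNhd_subset_image (h : Profile ℝ r δ η K g a b g a b) (h' : RealProfile r η g a b) :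
    stairNhd (r / 2) ⊆ tubeMap g a b '' straightTube r := by
  intro u hu
  obtain ⟨_, ⟨t, ht, rfl⟩, hd⟩ := (Metric.infDist_lt_iff stairImage_nonempty).1 hu
  rw [dist_eq_norm] at hd
  obtain ⟨x, hx, rfl, -⟩ := h.exists_preimage_of_near_stairPath h' ht hd.le
  exact mem_image_of_mem _ hx

theorem image_subset_stairNhd (h : Profile ℝ r δ η K g a b g a b) (h' : RealProfile r η g a b) :
    tubeMap g a b '' straightTube r ⊆ stairNhd (2 * r) := by
  rintro _ ⟨x, hx, rfl⟩
  have hr := h.r_pos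
  have ht : (0 : ℝ) ≤ max (x 0) 0 := le_max_right _ _
  refine (Metric.infDist_lt_iff stairImage_nonempty).2
    ⟨stairPath (max (x 0) 0), ⟨_, ht, rfl⟩, ?_⟩
  rw [dist_eq_norm]
  refine lt_of_le_of_lt (BddSeq.norm_sub_le (𝕜 := ℝ) (C := 3 / 2 * r) (by positivity) fun n => ?_)
    (by linarith)
  rw [stairPath_apply ht]
  exact h.tubeMap_near_stair h' hx n

end Profile

end Neighbourhoods

/-! ### Choice of the parameters and conclusion -/

theorem mainTheorem10 (ε : ℝ) (hε0 : 0 < ε) (hε1 : ε ≤ 1) :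
    ∃ r ∈ Ioo (0 : ℝ) (ε / 64), ∃ δ ∈ Ioo (0 : ℝ) (ε / 64),
    ∃ (G : EllInf → EllInf) (Gc : EllInfC → EllInfC),
      AnalyticOnNhd ℝ G univ ∧
      IsHolomorphicExtension G univ Gc univ ∧
      ∃ (T : Set EllInf) (Ginv : EllInf → EllInf),
        IsDiffeoBetween G Ginv (straightTube r) T ∧
        stairNhd (r / 2) ⊆ T ∧ T ⊆ stairNhd (2 * r) ∧
        (∀ t : ℝ, 0 ≤ t → ∀ x : EllInf, ‖x - stairPath t‖ ≤ r / 2 →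
          x ∈ T ∧ |Ginv x 0 - t| ≤ ε) ∧
        (∀ x ∈ straightTube r, ‖fderiv ℝ G x‖ ≤ 2 + ε) ∧
        (∀ u ∈ T, ‖fderiv ℝ Ginv u‖ ≤ 2 + ε) ∧
        (∀ x ∈ straightTube r, ∀ y : EllInf, ‖y‖ ≤ δ →
          ‖Gc (cplx x y) - cplx (G x) 0‖ ≤ ε) ∧
        ∃ (α : ℝ → ℝ) (αc : ℂ → ℂ),
          Differentiable ℂ αc ∧ (∀ t : ℝ, αc (t : ℂ) = (α t : ℂ)) ∧
          (∀ u ∈ T, DifferentiableAt ℝ (glue α Ginv) u ∧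
            ‖fderiv ℝ (glue α Ginv) u‖ ≤ 1 + ε) ∧
          (∀ t : ℝ, 0 ≤ t → ∀ x : EllInf, ‖x - stairPath t‖ < r / 2 →
            |glue α Ginv x - t| ≤ ε) ∧
          ∃ GinvC : EllInfC → EllInfC,
            IsHolomorphicExtension Ginv T GinvC (complexStrip T δ) ∧
            ∀ u ∈ T, ∀ v : EllInf, ‖v‖ < δ →
              ‖GinvC (cplx u v) - cplx (Ginv u) 0‖ ≤ ε ∧
              ‖αc (GinvC (cplx u v) 0)‖ ≤ 2 * (glue α Ginv u + 1) := by
  obtain ⟨α, α', αc, ω, L, hω, hL, hαc, hαr, hαd, hα', hαn, hαt, hαl⟩ :=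
    exists_gluing (c := ε / 8) (by positivity)
  set θ := min (ω / 2) (1 / 4) with hθ
  have hθ0 : 0 < θ := by positivity
  have hθω : 2 * θ ≤ ω := by linarith [min_le_left (ω / 2) (1 / 4 : ℝ)]
  set η := ε / 1000000 with hη
  have hη0 : 0 < η := by positivity
  obtain ⟨κ₁, κ₂, r, δ, hrc, hs⟩ := exists_scales (c := ε / 1000) hθ0 (min_le_right _ _) hη0
    (show η ≤ 1 / 1000000 by linarith) (by positivity)
  have hP := hs.profile
  have hR := hP.toReal
  have hR' := hs.realProfile
  have hr0 := hs.r_pos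
  have hδ0 := hs.δ_pos
  have hδr : δ ≤ r := hs.δ_le.trans (by nlinarith)
  set G := tubeMap (stepR κ₂) (leftR κ₁ θ) (rightR κ₁ θ) with hG
  set Gc := tubeMap (stepC κ₂) (leftC κ₁ θ) (rightC κ₁ θ) with hGc
  have hGca : AnalyticOnNhd ℂ Gc univ := tubeMap_analytic (differentiable_stepC κ₂)
    (differentiable_leftC κ₁ θ) (differentiable_rightC κ₁ θ) (locBdd_stepC hs.κ₂_pos.le)
    (locBdd_leftC hs.κ₁_pos.le hθ0.le) (locBdd_rightC hs.κ₁_pos.le (by linarith [hs.θ_le]))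
  have hGa : AnalyticOnNhd ℝ G univ := analyticOnNhd_of_extension hGca hP.tubeMap_cplx
  have hinv : ∀ x ∈ straightTube r, tubeInv _ _ _ r δ (G x) = x := fun x hx =>
    hP.tubeInv_tubeMap (hP.straight_subset_thick hx)
  have hinva : ∀ x ∈ straightTube r, AnalyticAt ℝ
      (tubeInv (stepR κ₂) (leftR κ₁ θ) (rightR κ₁ θ) r δ) (G x) := fun x hx =>
    hR.analyticAt_inv (isOpen_thickTube r δ) (thickTube_subset hδr hδ0)
      (hP.straight_subset_thick hx) (hGa x (mem_univ x))
  -- The strip of the conclusion has width `d`. The inverse moves by at most `10 d`, which must stay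
  -- inside the thickened tube and change `αc`, of Lipschitz constant `L`, by at most `1/10`.
  set d := min (δ / 8000) (1 / (100 * L)) with hd
  have hd0 : 0 < d := by positivity
  have hdδ : d ≤ δ / 8000 := min_le_left _ _
  have hLd : L * (10 * d) ≤ 1 / 10 := by
    have := min_le_right (δ / 8000) (1 / (100 * L))
    rw [← hd, le_div_iff₀ (by positivity)] at this
    linarith
  refine ⟨r, ⟨hr0, by linarith⟩, d, ⟨hd0, by linarith⟩, G, Gc, hGa,
    ⟨hGca, fun x _ => ⟨mem_univ _, hP.tubeMap_cplx x⟩⟩, G '' straightTube r,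
    tubeInv (stepR κ₂) (leftR κ₁ θ) (rightR κ₁ θ) r δ, ⟨?_, ⟨?_, ?_⟩, ?_, ?_⟩,
    hR.stairNhd_subset_image hR', hR.image_subset_stairNhd hR', ?_, ?_, ?_, ?_, α, αc, hαc, hαr,
    ?_, ?_, tubeInvC (stepC κ₂) (leftC κ₁ θ) (rightC κ₁ θ) r δ, ⟨?_, ?_⟩, ?_⟩
  · exact (hP.injOn_thick.mono hP.straight_subset_thick).bijOn_image
  · exact hinv
  · rintro _ ⟨x, hx, rfl⟩
    rw [hinv x hx]
  · exact fun x _ => hGa x (mem_univ x)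
  · rintro _ ⟨x, hx, rfl⟩
    exact hinva x hx
  · intro t ht u hu
    obtain ⟨x, hx, rfl, hxt⟩ := hR.exists_preimage_of_near_stairPath hR' ht hu
    refine ⟨mem_image_of_mem _ hx, ?_⟩
    rw [hinv x hx]
    linarith
  · intro x hx
    refine (norm_fderiv_le_of_lip' ℝ (by positivity)
      (Filter.Eventually.of_forall fun x' => hR.tubeMap_lip hR' hx x')).trans ?_
    linarith
  · rintro _ ⟨x, hx, rfl⟩
    refine (hP.norm_fderiv_tubeInv_le hR' hx).trans ?_
    nlinarith
  · intro x hx y hy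
    have := hP.norm_tubeMap_sub_le hx (hy.trans (by linarith))
    linarith
  · rintro _ ⟨x, hx, rfl⟩
    have h1 : DifferentiableAt ℝ
        (fun u => tubeInv (stepR κ₂) (leftR κ₁ θ) (rightR κ₁ θ) r δ u 0) (G x) :=
      (BddSeq.coord ℝ 0).differentiableAt.comp _ (hinva x hx).differentiableAt
    have h2 := (hαd (tubeInv (stepR κ₂) (leftR κ₁ θ) (rightR κ₁ θ) r δ (G x) 0)).comp_hasFDerivAt
      (G x) h1.hasFDerivAt
    rw [hinv x hx] at h2
    refine ⟨h2.differentiableAt, ?_⟩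
    refine (le_of_eq (congrArg norm h2.fderiv)).trans ?_
    rw [norm_smul, Real.norm_eq_abs, abs_of_nonneg (hα' _).1]
    exact (mul_le_mul_of_nonneg_left (hP.norm_fderiv_tubeInv_zero_le hR' hx rfl) (hα' _).1).trans
      (hs.glue_bound hε1 hη hθω hα' hαn rfl)
  · intro t ht u hu
    obtain ⟨x, hx, rfl, hxt⟩ := hR.exists_preimage_of_near_stairPath hR' ht hu.le
    rw [glue, hinv x hx]
    linarith [abs_sub_le (α (x 0)) (x 0) t, hαt (x 0)]
  · rintro _ ⟨_, ⟨x, hx, rfl⟩, v, hv, rfl⟩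
    exact (hP.tubeInvC_near hGca hx (by linarith)).1
  · rintro _ ⟨x, hx, rfl⟩
    refine ⟨⟨G x, mem_image_of_mem _ hx, 0, by rwa [norm_zero], rfl⟩, ?_⟩
    rw [hinv x hx, ← hP.tubeMap_cplx, hP.tubeInvC_tubeMap (hP.cplx_mem_thick hx)]
  · rintro _ ⟨x, hx, rfl⟩ v hv
    have h1 := (hP.tubeInvC_near hGca hx (v := v) (by linarith)).2
    rw [glue, hinv x hx]
    refine ⟨h1.trans (by linarith), ?_⟩
    set z := tubeInvC (stepC κ₂) (leftC κ₁ θ) (rightC κ₁ θ) r δ (cplx (G x) v) with hz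
    have h2 : ‖z 0 - (x 0 : ℂ)‖ ≤ 10 * d :=
      (BddSeq.sub_apply_le z (cplx x 0) 0).trans (h1.trans (by linarith))
    have h3 : |(z 0).im| ≤ 1 := (abs_im_le_norm_sub_ofReal (z 0) (x 0)).trans (h2.trans (by linarith))
    have h4 := (hαl (z 0) (x 0) h3 (by simp)).trans (mul_le_mul_of_nonneg_left h2 hL.le)
    have h5 := norm_add_le (αc (z 0) - αc (x 0)) (αc (x 0))
    rw [sub_add_cancel, hαr, Complex.norm_real, Real.norm_eq_abs] at h5
    rw [hαr] at h4
    have h6 := abs_le.1 (hαt (x 0))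
    have h7 := hx.1
    -- It suffices that `|α (x 0)| + 1/10 ≤ 2 (α (x 0) + 1)`, which holds since `α (x 0) ≥ -r - ε /
    -- 8` is only slightly negative.
    rcases abs_cases (α (x 0)) with ⟨h8, -⟩ | ⟨h8, -⟩ <;> linarith
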